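/- Conventions. 2-categories, 2-functors, 2-natural transformations and 2-adjunctions are strict; $\cdot$ denotes horizontal composition (written in applicative order) and $1$ denotes identity cells. A *symmetric strict monoidal 2-category* is a strict monoidal 2-category $(\mathcal M,\otimes,I)$ (a monoid with respect to the Cartesian product of 2-categories; $\otimes$ is denoted by juxtaposition) with a 2-natural transformation $\sigma_{A,B}:AB\to BA$ such that $\sigma_{B,A}\cdot\sigma_{A,B}=1$ and $\sigma_{A,BC}=(1_B\sigma_{A,C})\cdot(\sigma_{A,B}1_C)$. *Eilenberg–Moore construction.* Let $\mathsf{Mnd}(\mathcal M)$ be the 2-category of monads $(A,t)$ in $\mathcal M$, monad morphisms $(f,\varphi):(A,t)\to(B,s)$ (with $\varphi:s\cdot f\to f\cdot t$ compatible with multiplications and units) and monad transformations. $\mathcal M$ *admits Eilenberg–Moore construction* if the inclusion $\mathcal M\to\mathsf{Mnd}(\mathcal M)$, $A\mapsto (A,1)$, has a right 2-adjoint $\mathsf H$. Write $A^t:=\mathsf H(A,t)$; let $(u^t,\varrho^t):(A^t,1)\to(A,t)$ be the component of the counit, with action $\varrho^t:t\cdot u^t\to u^t$, and let $f^t:A\to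 A^t$ be the left adjoint of $u^t$, i.e. the 1-cell corresponding to the monad morphism $(t,\mu):(A,1)\to(A,t)$, where $\mu$ is the multiplication of $t$. If an adjunction $l\dashv r:B\to A$ generates the monad $(A,t)$, its comparison 1-cell $k:B\to A^t$ is the unique 1-cell with $k\cdot l=f^t$ and $u^t\cdot k=r$. The construction is *monoidal* if the comparison 1-cells $I\to I^1$ (for $1\dashv 1$) and $A^tB^s\to (AB)^{ts}$ (for $f^tf^s\dashv u^tu^s$), for all monads $(A,t)$ and $(B,s)$, are identity 1-cells. *$q$-oidal objects.* For a symmetric strict monoidal 2-category $\mathcal N$ let $\mathcal N_{01}$ be the symmetric strict monoidal 2-category whose 0-cells are the pseudomonoids $(A,m,u,\alpha,\lambda,\rho)$ in $\mathcal N$, whose 1-cells are the opmonoidal 1-cells $(f,\varphi^2,\varphi^0)$, with $\varphi^2:f\cdot m\to m'\cdot ff$ and $\varphi^0:f\cdot u\to u'$ coassociative and counital, and whose 2-cells are the opmonoidal 2-cells. The monoidal product of pseudomonoids $A$ and $B$ is $AB$ with multiplication $(m_Am_B)\cdot(1_A\sigma_{B,A}1_B)$ and unit $u_Au_B$, the associativity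 and unit 2-cells being the products of those of $A$ and $B$ (the associativity one precomposed with the appropriate shuffle); the monoidal product on 1-cells and 2-cells is likewise that of $\mathcal N$ and the symmetry is $(\sigma,1,1)$. For $q\ge 0$ let $\mathcal M_{0q}$ be the $q$-fold iterate of $(-)_{01}$ on $\mathcal M$ (so $\mathcal M_{00}=\mathcal M$). Its 0-cells are the *$q$-oidal objects* of $\mathcal M$, and a *$(0,q)$-oidal monad* is a monad in $\mathcal M_{0q}$. A 1-cell of $\mathcal M_{0q}$ is *strict* if all of its opmonoidal structure 2-cells $\varphi^2,\varphi^0$, at each of the $q$ levels, are identities. **Statement.** Let $\mathcal M$ be a symmetric strict monoidal 2-category which admits monoidal Eilenberg–Moore construction, and let $q\ge 0$. For any $(0,q)$-oidal monad $(A,t)$ in $\mathcal M$, with underlying monad in $\mathcal M$ denoted by the same symbol, the $q$-oidal structure of $A$ lifts to the Eilenberg–Moore object $A^t$ along $u^t:A^t\to A$. That is, there is a $q$-oidal object with underlying 0-cell $A^t$, and a monad morphism in $\mathcal M_{0q}$ from the identity monad on this $q$-oidal object to $(A,t)$, whose underlying monad morphism in $\mathcal M$ is the counit component $(u^t,\varrho^t)$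 and whose 1-cell part is strict. (Thus $u^t$ is a strict $(0,q)$-oidal 1-cell, meaning that the structure 1-cells and 2-cells of $A^t$ are liftings of those of $A$ along $u^t$, and the action $\varrho^t:t\cdot u^t\to u^t$ is a $(0,q)$-oidal 2-cell.) -/

import Mathlib

universe u

/-- A (strict) 2-category, presented in one-sorted style: a type of 0-cells, a type of 1-cells with
source and target, a type of 2-cells with domain and codomain. The composition `comp` of 1-cells,
the vertical composition `vcomp` and the horizontal composition `hcomp` of 2-cells (all written in
applicative order, `comp g f` is `f` followed by `g`) are total functions, but they are constrained
only on composable pairs; their values on other pairs are irrelevant. -/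
structure TwoCat where
  Obj : Type u
  One : Type u
  Two : Type u
  src : One → Obj
  tgt : One → Obj
  dom : Two → One
  cod : Two → One
  id₁ : Obj → One
  id₂ : One → Two
  comp : One → One → One
  vcomp : Two → Two → Two
  hcomp : Two → Two → Two
  src_dom : ∀ α, src (dom α) = src (cod α)
  tgt_dom : ∀ α, tgt (dom α) = tgt (cod α)
  src_id₁ : ∀ A, src (id₁ A) = A
  tgt_id₁ : ∀ A, tgt (id₁ A) = A
  dom_id₂ : ∀ f, dom (id₂ f) = f
  cod_id₂ : ∀ f, cod (id₂ f) = f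
  src_comp : ∀ g f, tgt f = src g → src (comp g f) = src f
  tgt_comp : ∀ g f, tgt f = src g → tgt (comp g f) = tgt g
  dom_vcomp : ∀ β α, cod α = dom β → dom (vcomp β α) = dom α
  cod_vcomp : ∀ β α, cod α = dom β → cod (vcomp β α) = cod β
  dom_hcomp : ∀ β α, tgt (dom α) = src (dom β) → dom (hcomp β α) = comp (dom β) (dom α)
  cod_hcomp : ∀ β α, tgt (dom α) = src (dom β) → cod (hcomp β α) = comp (cod β) (cod α)
  comp_assoc : ∀ h g f, tgt f = src g → tgt g = src h →
    comp (comp h g) f = comp h (comp g f)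
  id₁_comp : ∀ f, comp (id₁ (tgt f)) f = f
  comp_id₁ : ∀ f, comp f (id₁ (src f)) = f
  vcomp_assoc : ∀ γ β α, cod α = dom β → cod β = dom γ →
    vcomp (vcomp γ β) α = vcomp γ (vcomp β α)
  id₂_vcomp : ∀ α, vcomp (id₂ (cod α)) α = α
  vcomp_id₂ : ∀ α, vcomp α (id₂ (dom α)) = α
  hcomp_assoc : ∀ γ β α, tgt (dom α) = src (dom β) → tgt (dom β) = src (dom γ) →
    hcomp (hcomp γ β) α = hcomp γ (hcomp β α)
  id₂_hcomp : ∀ α, hcomp (id₂ (id₁ (tgt (dom α)))) α = α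
  hcomp_id₂ : ∀ α, hcomp α (id₂ (id₁ (src (dom α)))) = α
  id₂_comp : ∀ g f, tgt f = src g → hcomp (id₂ g) (id₂ f) = id₂ (comp g f)
  interchange : ∀ β' β α' α, cod α = dom α' → cod β = dom β' → tgt (dom α) = src (dom β) →
    hcomp (vcomp β' β) (vcomp α' α) = vcomp (hcomp β' α') (hcomp β α)

namespace TwoCat

infixr:80 " ∘₁ " => TwoCat.comp _
infixr:70 " ∘ᵥ " => TwoCat.vcomp _
infixr:80 " ∘ₕ " => TwoCat.hcomp _

/-- `f` is a 1-cell from `A` to `B`. -/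
def Is₁ (M : TwoCat.{u}) (f : M.One) (A B : M.Obj) : Prop := M.src f = A ∧ M.tgt f = B
/-- `α` is a 2-cell from `f` to `g`. -/
def Is₂ (M : TwoCat.{u}) (α : M.Two) (f g : M.One) : Prop := M.dom α = f ∧ M.cod α = g

attribute [simp] src_dom src_id₁ tgt_id₁ dom_id₂ cod_id₂ src_comp tgt_comp dom_vcomp
  cod_vcomp dom_hcomp cod_hcomp comp_assoc id₁_comp comp_id₁ vcomp_assoc id₂_vcomp vcomp_id₂ hcomp_assoc id₂_hcomp hcomp_id₂ id₂_comp tgt_dom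

section
variable {M : TwoCat.{u}}

@[simp] theorem id₁_comp' {A : M.Obj} {f : M.One} (h : M.tgt f = A) : M.id₁ A ∘₁ f = f := by
  subst h; simp
@[simp] theorem comp_id₁' {A : M.Obj} {f : M.One} (h : M.src f = A) : f ∘₁ M.id₁ A = f := by
  subst h; simp
@[simp] theorem id₂_vcomp' {f : M.One} {α : M.Two} (h : M.cod α = f) : M.id₂ f ∘ᵥ α = α := by
  subst h; simp
@[simp] theorem vcomp_id₂' {f : M.One} {α : M.Two} (h : M.dom α = f) : α ∘ᵥ M.id₂ f = α := by
  subst h; simp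
@[simp] theorem id₂_hcomp' {A : M.Obj} {α : M.Two} (h : M.tgt (M.cod α) = A) :
    M.id₂ (M.id₁ A) ∘ₕ α = α := by
  subst h; rw [← tgt_dom]; exact M.id₂_hcomp α
@[simp] theorem hcomp_id₂' {A : M.Obj} {α : M.Two} (h : M.src (M.cod α) = A) :
    α ∘ₕ M.id₂ (M.id₁ A) = α := by
  subst h; rw [← src_dom]; exact M.hcomp_id₂ α

@[simp] theorem id₂_comp_assoc {g f : M.One} {α : M.Two} (h : M.tgt f = M.src g)
    (h' : M.tgt (M.cod α) = M.src f) :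
    M.id₂ g ∘ₕ M.id₂ f ∘ₕ α = M.id₂ (g ∘₁ f) ∘ₕ α := by
  rw [← M.id₂_comp _ _ h, M.hcomp_assoc] <;> simp [*]
/-- whiskering -/
@[simp] theorem wl {f : M.One} {β α : M.Two} (h : M.cod α = M.dom β)
    (h' : M.tgt (M.cod β) = M.src f) :
    M.id₂ f ∘ₕ (β ∘ᵥ α) = (M.id₂ f ∘ₕ β) ∘ᵥ (M.id₂ f ∘ₕ α) := by
  rw [← M.interchange] <;> simp [*]
@[simp] theorem wr {f : M.One} {β α : M.Two} (h : M.cod α = M.dom β)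
    (h' : M.tgt f = M.src (M.cod β)) :
    (β ∘ᵥ α) ∘ₕ M.id₂ f = (β ∘ₕ M.id₂ f) ∘ᵥ (α ∘ₕ M.id₂ f) := by
  rw [← M.interchange] <;> simp [*]
theorem exch₁ {a b : M.One} {β α : M.Two} (ha : M.dom β = a) (hb : M.cod α = b)
    (h : M.tgt (M.cod α) = M.src (M.cod β)) :
    (β ∘ₕ M.id₂ b) ∘ᵥ (M.id₂ a ∘ₕ α) = β ∘ₕ α := by
  subst ha hb
  rw [← M.interchange] <;> simp [*]
theorem exch₂ {a b : M.One} {β α : M.Two} (ha : M.cod β = a) (hb : M.dom α = b)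
    (h : M.tgt (M.cod α) = M.src (M.cod β)) :
    (M.id₂ a ∘ₕ α) ∘ᵥ (β ∘ₕ M.id₂ b) = β ∘ₕ α := by
  subst ha hb
  rw [← M.interchange] <;> simp [*]
theorem exch {a b a' b' : M.One} {β α : M.Two} (ha : M.dom β = a) (hb : M.cod α = b)
    (ha' : M.cod β = a') (hb' : M.dom α = b')
    (h : M.tgt (M.cod α) = M.src (M.cod β)) :
    (β ∘ₕ M.id₂ b) ∘ᵥ (M.id₂ a ∘ₕ α) = (M.id₂ a' ∘ₕ α) ∘ᵥ (β ∘ₕ M.id₂ b') := by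
  rw [exch₁ ha hb h, exch₂ ha' hb' h]
end

/-- A monad `(A, t, μ, η)` in a 2-category. -/
@[ext]
structure Monad (M : TwoCat.{u}) where
  A : M.Obj
  t : M.One
  μ : M.Two
  η : M.Two
  t_is : M.Is₁ t A A
  μ_is : M.Is₂ μ (t ∘₁ t) t
  η_is : M.Is₂ η (M.id₁ A) t
  assoc : μ ∘ᵥ (μ ∘ₕ M.id₂ t) = μ ∘ᵥ (M.id₂ t ∘ₕ μ)
  left_unit : μ ∘ᵥ (η ∘ₕ M.id₂ t) = M.id₂ t
  right_unit : μ ∘ᵥ (M.id₂ t ∘ₕ η) = M.id₂ t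

/-- A monad morphism `(f, φ) : (A, t) ⟶ (B, s)`, where `φ` is a 2-cell from `s.f` to `f.t`
compatible with the multiplications and the units. -/
@[ext]
structure MonadMor (M : TwoCat.{u}) where
  src : Monad M
  tgt : Monad M
  f : M.One
  φ : M.Two
  f_is : M.Is₁ f src.A tgt.A
  φ_is : M.Is₂ φ (tgt.t ∘₁ f) (f ∘₁ src.t)
  mul : (M.id₂ f ∘ₕ src.μ) ∘ᵥ (φ ∘ₕ M.id₂ src.t) ∘ᵥ (M.id₂ tgt.t ∘ₕ φ) =
    φ ∘ᵥ (tgt.μ ∘ₕ M.id₂ f)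
  unit : M.id₂ f ∘ₕ src.η = φ ∘ᵥ (tgt.η ∘ₕ M.id₂ f)

section
variable {M : TwoCat.{u}} (T : Monad M) (F : MonadMor M)
@[simp] theorem Monad.src_t : M.src T.t = T.A := T.t_is.1
@[simp] theorem Monad.tgt_t : M.tgt T.t = T.A := T.t_is.2
@[simp] theorem Monad.dom_μ : M.dom T.μ = T.t ∘₁ T.t := T.μ_is.1
@[simp] theorem Monad.cod_μ : M.cod T.μ = T.t := T.μ_is.2
@[simp] theorem Monad.dom_η : M.dom T.η = M.id₁ T.A := T.η_is.1
@[simp] theorem Monad.cod_η : M.cod T.η = T.t := T.η_is.2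
@[simp] theorem MonadMor.src_f : M.src F.f = F.src.A := F.f_is.1
@[simp] theorem MonadMor.tgt_f : M.tgt F.f = F.tgt.A := F.f_is.2
@[simp] theorem MonadMor.dom_φ : M.dom F.φ = F.tgt.t ∘₁ F.f := F.φ_is.1
@[simp] theorem MonadMor.cod_φ : M.cod F.φ = F.f ∘₁ F.src.t := F.φ_is.2
end

def MonadMor.id {M : TwoCat.{u}} (T : Monad M) : MonadMor M where
  src := T
  tgt := T
  f := M.id₁ T.A
  φ := M.id₂ T.t
  f_is := by simp [Is₁]
  φ_is := by simp [Is₂]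
  mul := by simp
  unit := by simp

def MonadMor.comp {M : TwoCat.{u}} (G F : MonadMor M) (h : F.tgt = G.src) : MonadMor M where
  src := F.src
  tgt := G.tgt
  f := G.f ∘₁ F.f
  φ := (M.id₂ G.f ∘ₕ F.φ) ∘ᵥ (G.φ ∘ₕ M.id₂ F.f)
  f_is := by simp (maxDischargeDepth := 9) [Is₁, h]
  φ_is := by simp (maxDischargeDepth := 9) [Is₂, h]
  mul := by
    have h1 := F.mul
    have h2 := G.mul
    rw [h] at h1
    calc _ = (M.id₂ G.f ∘ₕ ((M.id₂ F.f ∘ₕ F.src.μ) ∘ᵥ (F.φ ∘ₕ M.id₂ F.src.t))) ∘ᵥ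
              ((G.φ ∘ₕ M.id₂ (F.f ∘₁ F.src.t)) ∘ᵥ (M.id₂ (G.tgt.t ∘₁ G.f) ∘ₕ F.φ)) ∘ᵥ
              ((M.id₂ G.tgt.t ∘ₕ G.φ) ∘ₕ M.id₂ F.f) := by simp (maxDischargeDepth := 9) [h]
      _ = (M.id₂ G.f ∘ₕ ((M.id₂ F.f ∘ₕ F.src.μ) ∘ᵥ (F.φ ∘ₕ M.id₂ F.src.t))) ∘ᵥ
            ((M.id₂ (G.f ∘₁ G.src.t) ∘ₕ F.φ) ∘ᵥ (G.φ ∘ₕ M.id₂ (G.src.t ∘₁ F.f))) ∘ᵥ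
              ((M.id₂ G.tgt.t ∘ₕ G.φ) ∘ₕ M.id₂ F.f) := by
            rw [exch (β := G.φ) (α := F.φ) (a' := G.f ∘₁ G.src.t) (b' := G.src.t ∘₁ F.f)] <;> simp (maxDischargeDepth := 9) [h]
      _ = (M.id₂ G.f ∘ₕ ((M.id₂ F.f ∘ₕ F.src.μ) ∘ᵥ (F.φ ∘ₕ M.id₂ F.src.t) ∘ᵥ (M.id₂ G.src.t ∘ₕ F.φ))) ∘ᵥ
             (((G.φ ∘ₕ M.id₂ G.src.t) ∘ᵥ (M.id₂ G.tgt.t ∘ₕ G.φ)) ∘ₕ M.id₂ F.f) := by simp (maxDischargeDepth := 9) [h]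
      _ = (M.id₂ G.f ∘ₕ F.φ) ∘ᵥ (((M.id₂ G.f ∘ₕ G.src.μ) ∘ᵥ (G.φ ∘ₕ M.id₂ G.src.t) ∘ᵥ (M.id₂ G.tgt.t ∘ₕ G.φ)) ∘ₕ M.id₂ F.f) := by
           rw [h1]; simp (maxDischargeDepth := 9) [h]
      _ = _ := by rw [h2]; simp (maxDischargeDepth := 9) [h]
  unit := by
    have h1 := F.unit
    have h2 := G.unit
    rw [h] at h1
    calc _ = M.id₂ G.f ∘ₕ (M.id₂ F.f ∘ₕ F.src.η) := by simp (maxDischargeDepth := 9) [h]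
      _ = (M.id₂ G.f ∘ₕ F.φ) ∘ᵥ ((M.id₂ G.f ∘ₕ G.src.η) ∘ₕ M.id₂ F.f) := by
           rw [h1]; simp (maxDischargeDepth := 9) [h]
      _ = _ := by rw [h2]; simp (maxDischargeDepth := 9) [h]

/-- A monad transformation between parallel monad morphisms. -/
@[ext]
structure MonadTrans (M : TwoCat.{u}) where
  dom : MonadMor M
  cod : MonadMor M
  ω : M.Two
  src_dom : dom.src = cod.src
  tgt_dom : dom.tgt = cod.tgt
  ω_is : M.Is₂ ω dom.f cod.f
  compat : (ω ∘ₕ M.id₂ dom.src.t) ∘ᵥ dom.φ = cod.φ ∘ᵥ (M.id₂ dom.tgt.t ∘ₕ ω)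

attribute [simp] MonadTrans.src_dom MonadTrans.tgt_dom

section
variable {M : TwoCat.{u}} (W : MonadTrans M)
@[simp] theorem MonadTrans.dom_ω : M.dom W.ω = W.dom.f := W.ω_is.1
@[simp] theorem MonadTrans.cod_ω : M.cod W.ω = W.cod.f := W.ω_is.2
end

def MonadTrans.id {M : TwoCat.{u}} (F : MonadMor M) : MonadTrans M where
  dom := F
  cod := F
  ω := M.id₂ F.f
  src_dom := rfl
  tgt_dom := rfl
  ω_is := by simp [Is₂]
  compat := by simp

def MonadTrans.vcomp {M : TwoCat.{u}} (V W : MonadTrans M) (h : W.cod = V.dom) :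
    MonadTrans M where
  dom := W.dom
  cod := V.cod
  ω := V.ω ∘ᵥ W.ω
  src_dom := by simp [h]
  tgt_dom := by simp [h]
  ω_is := by simp [Is₂, h]
  compat := by
    have h1 := W.compat
    have h2 := V.compat
    have hs := congrArg MonadMor.src h
    have ht := congrArg MonadMor.tgt h
    simp only [W.src_dom, W.tgt_dom, V.src_dom, V.tgt_dom] at h1 h2 hs ht ⊢
    calc _ = (V.ω ∘ₕ M.id₂ W.cod.src.t) ∘ᵥ ((W.ω ∘ₕ M.id₂ W.cod.src.t) ∘ᵥ W.dom.φ) := by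
            simp (maxDischargeDepth := 9) [h]
      _ = ((V.ω ∘ₕ M.id₂ V.cod.src.t) ∘ᵥ V.dom.φ) ∘ᵥ (M.id₂ V.cod.tgt.t ∘ₕ W.ω) := by
            rw [h1]; simp (maxDischargeDepth := 9) [h]
      _ = _ := by rw [h2]; simp (maxDischargeDepth := 9) [h]

def MonadTrans.hcomp {M : TwoCat.{u}} (V W : MonadTrans M) (h : W.cod.tgt = V.cod.src) :
    MonadTrans M where
  dom := V.dom.comp W.dom (by simp [h])
  cod := V.cod.comp W.cod h
  ω := V.ω ∘ₕ W.ω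
  src_dom := by simp [MonadMor.comp]
  tgt_dom := by simp [MonadMor.comp]
  ω_is := by simp [Is₂, h, MonadMor.comp]
  compat := by
    have h1 := W.compat
    have h2 := V.compat
    simp only [W.src_dom, W.tgt_dom, V.src_dom, V.tgt_dom, h] at h1 h2
    simp only [MonadMor.comp, W.src_dom, V.tgt_dom]
    calc _ = (V.ω ∘ₕ M.id₂ (W.cod.f ∘₁ W.cod.src.t)) ∘ᵥ
              (M.id₂ V.dom.f ∘ₕ ((W.ω ∘ₕ M.id₂ W.cod.src.t) ∘ᵥ W.dom.φ)) ∘ᵥ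
              (V.dom.φ ∘ₕ M.id₂ W.dom.f) := by
            rw [← exch₁ (β := V.ω) (α := W.ω) rfl rfl] <;> simp (maxDischargeDepth := 9) [h]
      _ = (V.ω ∘ₕ M.id₂ (W.cod.f ∘₁ W.cod.src.t)) ∘ᵥ
              (M.id₂ V.dom.f ∘ₕ (W.cod.φ ∘ᵥ (M.id₂ V.cod.src.t ∘ₕ W.ω))) ∘ᵥ
              (V.dom.φ ∘ₕ M.id₂ W.dom.f) := by rw [h1]
      _ = ((V.ω ∘ₕ M.id₂ (W.cod.f ∘₁ W.cod.src.t)) ∘ᵥ (M.id₂ V.dom.f ∘ₕ W.cod.φ)) ∘ᵥ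
              ((M.id₂ (V.dom.f ∘₁ V.cod.src.t) ∘ₕ W.ω) ∘ᵥ (V.dom.φ ∘ₕ M.id₂ W.dom.f)) := by
            simp (maxDischargeDepth := 9) [h]
      _ = ((M.id₂ V.cod.f ∘ₕ W.cod.φ) ∘ᵥ (V.ω ∘ₕ M.id₂ (V.cod.src.t ∘₁ W.cod.f))) ∘ᵥ
              ((V.dom.φ ∘ₕ M.id₂ W.cod.f) ∘ᵥ (M.id₂ (V.cod.tgt.t ∘₁ V.dom.f) ∘ₕ W.ω)) := by
            rw [exch (β := V.ω) (α := W.cod.φ) (a' := V.cod.f) (b' := V.cod.src.t ∘₁ W.cod.f),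
              exch (β := V.dom.φ) (α := W.ω) (a' := V.dom.f ∘₁ V.cod.src.t) (b' := W.dom.f)] <;>
            simp (maxDischargeDepth := 9) [h]
      _ = (M.id₂ V.cod.f ∘ₕ W.cod.φ) ∘ᵥ (((V.ω ∘ₕ M.id₂ V.cod.src.t) ∘ᵥ V.dom.φ) ∘ₕ M.id₂ W.cod.f) ∘ᵥ
              (M.id₂ (V.cod.tgt.t ∘₁ V.dom.f) ∘ₕ W.ω) := by simp (maxDischargeDepth := 9) [h]
      _ = _ := by
        rw [h2, ← exch₁ (β := V.ω) (α := W.ω) rfl rfl] <;> simp (maxDischargeDepth := 9) [h]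

open Classical in
/-- The 2-category of monads, monad morphisms and monad transformations in `M`. -/
noncomputable def mnd (M : TwoCat.{u}) : TwoCat.{u} where
  Obj := Monad M
  One := MonadMor M
  Two := MonadTrans M
  src := MonadMor.src
  tgt := MonadMor.tgt
  dom := MonadTrans.dom
  cod := MonadTrans.cod
  id₁ := MonadMor.id
  id₂ := MonadTrans.id
  comp G F := if h : F.tgt = G.src then G.comp F h else G
  vcomp V W := if h : W.cod = V.dom then V.vcomp W h else V
  hcomp V W := if h : W.cod.tgt = V.cod.src then V.hcomp W h else V
  src_dom := MonadTrans.src_dom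
  tgt_dom := MonadTrans.tgt_dom
  src_id₁ _ := rfl
  tgt_id₁ _ := rfl
  dom_id₂ _ := rfl
  cod_id₂ _ := rfl
  src_comp G F h := by simp [h, MonadMor.comp]
  tgt_comp G F h := by simp [h, MonadMor.comp]
  dom_vcomp V W h := by simp [h, MonadTrans.vcomp]
  cod_vcomp V W h := by simp [h, MonadTrans.vcomp]
  dom_hcomp V W h := by simp at h; simp [h, MonadTrans.hcomp]
  cod_hcomp V W h := by simp at h; simp [h, MonadTrans.hcomp]
  comp_assoc K G F h h' := by
    apply MonadMor.ext <;> simp (maxDischargeDepth := 9) [h, h', MonadMor.comp]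
  id₁_comp F := by
    apply MonadMor.ext <;> simp (maxDischargeDepth := 9) [MonadMor.id, MonadMor.comp]
  comp_id₁ F := by
    apply MonadMor.ext <;> simp (maxDischargeDepth := 9) [MonadMor.id, MonadMor.comp]
  vcomp_assoc U V W h h' := by
    apply MonadTrans.ext <;> simp (maxDischargeDepth := 9) [h, h', MonadTrans.vcomp]
  id₂_vcomp W := by
    apply MonadTrans.ext <;> simp (maxDischargeDepth := 9) [MonadTrans.vcomp, MonadTrans.id]
  vcomp_id₂ W := by
    apply MonadTrans.ext <;> simp (maxDischargeDepth := 9) [MonadTrans.vcomp, MonadTrans.id]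
  hcomp_assoc U V W h h' := by
    simp at h h'
    apply MonadTrans.ext <;>
      simp (maxDischargeDepth := 9) [h, h', MonadTrans.hcomp, MonadMor.comp]
  id₂_hcomp W := by
    apply MonadTrans.ext <;>
      simp (maxDischargeDepth := 9) [MonadTrans.hcomp, MonadTrans.id, MonadMor.comp, MonadMor.id]
    exact MonadMor.ext W.src_dom.symm W.tgt_dom.symm rfl rfl
  hcomp_id₂ W := by
    apply MonadTrans.ext <;>
      simp (maxDischargeDepth := 9) [MonadTrans.hcomp, MonadTrans.id, MonadMor.comp, MonadMor.id]
    exact MonadMor.ext W.src_dom.symm W.tgt_dom.symm rfl rfl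
  id₂_comp G F h := by
    apply MonadTrans.ext <;>
      simp (maxDischargeDepth := 9) [h, MonadTrans.hcomp, MonadTrans.id, MonadMor.comp]
  interchange V' V W' W h h' h'' := by
    simp at h''
    have h3 : W'.cod.tgt = V'.cod.src := by
      rw [← W'.tgt_dom, ← h, h'', h', V'.src_dom]
    apply MonadTrans.ext <;>
      simp (maxDischargeDepth := 9) [h, h', h3, MonadTrans.hcomp, MonadTrans.vcomp,
        MonadMor.comp, M.interchange]

/-- A (strict) 2-functor. -/
structure TwoFunctor (M N : TwoCat.{u}) where
  obj : M.Obj → N.Obj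
  map₁ : M.One → N.One
  map₂ : M.Two → N.Two
  src_map₁ : ∀ f, N.src (map₁ f) = obj (M.src f)
  tgt_map₁ : ∀ f, N.tgt (map₁ f) = obj (M.tgt f)
  dom_map₂ : ∀ α, N.dom (map₂ α) = map₁ (M.dom α)
  cod_map₂ : ∀ α, N.cod (map₂ α) = map₁ (M.cod α)
  map_id₁ : ∀ A, map₁ (M.id₁ A) = N.id₁ (obj A)
  map_id₂ : ∀ f, map₂ (M.id₂ f) = N.id₂ (map₁ f)
  map_comp : ∀ g f, M.tgt f = M.src g → map₁ (g ∘₁ f) = map₁ g ∘₁ map₁ f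
  map_vcomp : ∀ β α, M.cod α = M.dom β → map₂ (β ∘ᵥ α) = map₂ β ∘ᵥ map₂ α
  map_hcomp : ∀ β α, M.tgt (M.dom α) = M.src (M.dom β) →
    map₂ (β ∘ₕ α) = map₂ β ∘ₕ map₂ α

attribute [simp] TwoFunctor.src_map₁ TwoFunctor.tgt_map₁ TwoFunctor.dom_map₂
  TwoFunctor.cod_map₂ TwoFunctor.map_id₁ TwoFunctor.map_id₂ TwoFunctor.map_comp
  TwoFunctor.map_vcomp TwoFunctor.map_hcomp

def TwoFunctor.id (M : TwoCat.{u}) : TwoFunctor M M where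
  obj A := A
  map₁ f := f
  map₂ α := α
  src_map₁ _ := rfl
  tgt_map₁ _ := rfl
  dom_map₂ _ := rfl
  cod_map₂ _ := rfl
  map_id₁ _ := rfl
  map_id₂ _ := rfl
  map_comp _ _ _ := rfl
  map_vcomp _ _ _ := rfl
  map_hcomp _ _ _ := rfl

def TwoFunctor.comp {L M N : TwoCat.{u}} (G : TwoFunctor M N) (F : TwoFunctor L M) :
    TwoFunctor L N where
  obj A := G.obj (F.obj A)
  map₁ f := G.map₁ (F.map₁ f)
  map₂ α := G.map₂ (F.map₂ α)
  src_map₁ _ := by simp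
  tgt_map₁ _ := by simp
  dom_map₂ _ := by simp
  cod_map₂ _ := by simp
  map_id₁ _ := by simp
  map_id₂ _ := by simp
  map_comp _ _ h := by simp [h]
  map_vcomp _ _ h := by simp [h]
  map_hcomp _ _ h := by simp at h; simp [h]

/-- A (strict) 2-natural transformation. -/
structure TwoNatTrans {M N : TwoCat.{u}} (F G : TwoFunctor M N) where
  app : M.Obj → N.One
  app_is : ∀ A, N.Is₁ (app A) (F.obj A) (G.obj A)
  naturality₁ : ∀ f, app (M.tgt f) ∘₁ F.map₁ f = G.map₁ f ∘₁ app (M.src f)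
  naturality₂ : ∀ α, N.id₂ (app (M.tgt (M.dom α))) ∘ₕ F.map₂ α =
    G.map₂ α ∘ₕ N.id₂ (app (M.src (M.dom α)))

/-- A 2-adjunction `L ⊣ R`: 2-natural unit and counit satisfying the triangle equations. -/
structure TwoAdjunction {M N : TwoCat.{u}} (L : TwoFunctor M N) (R : TwoFunctor N M) where
  unit : TwoNatTrans (TwoFunctor.id M) (R.comp L)
  counit : TwoNatTrans (L.comp R) (TwoFunctor.id N)
  left_triangle : ∀ A, counit.app (L.obj A) ∘₁ L.map₁ (unit.app A) = N.id₁ (L.obj A)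
  right_triangle : ∀ B, R.map₁ (counit.app B) ∘₁ unit.app (R.obj B) = M.id₁ (R.obj B)

/-- The identity monad on a 0-cell. -/
def idMonad {M : TwoCat.{u}} (A : M.Obj) : Monad M where
  A := A
  t := M.id₁ A
  μ := M.id₂ (M.id₁ A)
  η := M.id₂ (M.id₁ A)
  t_is := by simp [Is₁]
  μ_is := by simp [Is₂]
  η_is := by simp [Is₂]
  assoc := by simp
  left_unit := by simp
  right_unit := by simp

/-- The inclusion 2-functor of `M` into the 2-category of monads in `M`. -/
noncomputable def incl (M : TwoCat.{u}) : TwoFunctor M M.mnd where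
  obj A := idMonad A
  map₁ f :=
    { src := idMonad (M.src f)
      tgt := idMonad (M.tgt f)
      f := f
      φ := M.id₂ f
      f_is := by simp [Is₁, idMonad]
      φ_is := by simp [Is₂, idMonad]
      mul := by simp [idMonad]
      unit := by simp [idMonad] }
  map₂ α :=
    { dom :=
      { src := idMonad (M.src (M.dom α))
        tgt := idMonad (M.tgt (M.dom α))
        f := M.dom α
        φ := M.id₂ (M.dom α)
        f_is := by simp [Is₁, idMonad]
        φ_is := by simp [Is₂, idMonad]
        mul := by simp [idMonad]
        unit := by simp [idMonad] }
      cod :=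
      { src := idMonad (M.src (M.cod α))
        tgt := idMonad (M.tgt (M.cod α))
        f := M.cod α
        φ := M.id₂ (M.cod α)
        f_is := by simp [Is₁, idMonad]
        φ_is := by simp [Is₂, idMonad]
        mul := by simp [idMonad]
        unit := by simp [idMonad] }
      ω := α
      src_dom := by simp
      tgt_dom := by simp
      ω_is := ⟨rfl, rfl⟩
      compat := by simp [idMonad] }
  src_map₁ _ := rfl
  tgt_map₁ _ := rfl
  dom_map₂ _ := rfl
  cod_map₂ _ := rfl
  map_id₁ A := by apply MonadMor.ext <;> simp [mnd, MonadMor.id, idMonad]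
  map_id₂ f := by apply MonadTrans.ext <;> simp [mnd, MonadTrans.id]
  map_comp g f h := by apply MonadMor.ext <;> simp [mnd, h, MonadMor.comp]
  map_vcomp β α h := by apply MonadTrans.ext <;> simp [mnd, h, MonadTrans.vcomp]
  map_hcomp β α h := by
    simp at h
    apply MonadTrans.ext <;> simp [mnd, h, MonadTrans.hcomp, MonadMor.comp]

/-- The monad morphism `(t, μ) : (A, 1) ⟶ (A, t)`. -/
def Monad.freeMor {M : TwoCat.{u}} (T : Monad M) : MonadMor M where
  src := idMonad T.A
  tgt := T
  f := T.t
  φ := T.μ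
  f_is := by simp [Is₁, idMonad]
  φ_is := by simp [Is₂, idMonad]
  mul := by simp (maxDischargeDepth := 9) [idMonad, T.assoc]
  unit := by simp [idMonad, T.left_unit]

/-- An Eilenberg-Moore construction on `M`: a right 2-adjoint `H` of the inclusion of `M` into the
2-category of monads in `M`. The Eilenberg-Moore object of a monad `T` is `H.obj T`. -/
structure EilenbergMoore (M : TwoCat.{u}) where
  H : TwoFunctor M.mnd M
  adj : TwoAdjunction M.incl H

namespace EilenbergMoore
variable {M : TwoCat.{u}} (E : M.EilenbergMoore) (T : Monad M)
/-- The component of the counit at `T`: a monad morphism `(Aᵗ, 1) ⟶ (A, t)` whose 1-cell part is the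
forgetful 1-cell `u` and whose 2-cell part is the action `t.u ⟶ u`. -/
def counit : MonadMor M := E.adj.counit.app T
/-- The forgetful 1-cell from the Eilenberg-Moore object of `T` to the base object of `T`. -/
def u : M.One := (E.counit T).f
/-- The left adjoint of the forgetful 1-cell: the 1-cell from the base object to the Eilenberg-Moore
object that corresponds under the 2-adjunction to the monad morphism `(t, μ) : (A, 1) ⟶ (A, t)`. -/
def f : M.One := E.H.map₁ T.freeMor ∘₁ E.adj.unit.app T.A
end EilenbergMoore

/-- The image of a monad under a 2-functor. -/
def TwoFunctor.mapMonad {M N : TwoCat.{u}} (F : TwoFunctor M N) (T : Monad M) : Monad N where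
  A := F.obj T.A
  t := F.map₁ T.t
  μ := F.map₂ T.μ
  η := F.map₂ T.η
  t_is := by simp [Is₁]
  μ_is := by simp [Is₂]
  η_is := by simp [Is₂]
  assoc := by simpa (maxDischargeDepth := 9) using congrArg F.map₂ T.assoc
  left_unit := by simpa (maxDischargeDepth := 9) using congrArg F.map₂ T.left_unit
  right_unit := by simpa (maxDischargeDepth := 9) using congrArg F.map₂ T.right_unit

/-- The image of a monad morphism under a 2-functor. -/
def TwoFunctor.mapMonadMor {M N : TwoCat.{u}} (F : TwoFunctor M N) (G : MonadMor M) :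
    MonadMor N where
  src := F.mapMonad G.src
  tgt := F.mapMonad G.tgt
  f := F.map₁ G.f
  φ := F.map₂ G.φ
  f_is := by simp [Is₁, mapMonad]
  φ_is := by simp [Is₂, mapMonad]
  mul := by simpa (maxDischargeDepth := 9) [mapMonad] using congrArg F.map₂ G.mul
  unit := by simpa (maxDischargeDepth := 9) [mapMonad] using congrArg F.map₂ G.unit

end TwoCat

/-- A strict monoidal 2-category: a monoid with respect to the Cartesian product of 2-categories. -/
structure StrictMonTwoCat extends TwoCat.{u} where
  I : Obj
  tensor₀ : Obj → Obj → Obj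
  tensor₁ : One → One → One
  tensor₂ : Two → Two → Two
  src_tensor : ∀ f g, src (tensor₁ f g) = tensor₀ (src f) (src g)
  tgt_tensor : ∀ f g, tgt (tensor₁ f g) = tensor₀ (tgt f) (tgt g)
  dom_tensor : ∀ α β, dom (tensor₂ α β) = tensor₁ (dom α) (dom β)
  cod_tensor : ∀ α β, cod (tensor₂ α β) = tensor₁ (cod α) (cod β)
  tensor_id₁ : ∀ A B, tensor₁ (id₁ A) (id₁ B) = id₁ (tensor₀ A B)
  tensor_id₂ : ∀ f g, tensor₂ (id₂ f) (id₂ g) = id₂ (tensor₁ f g)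
  tensor_comp : ∀ g f g' f', tgt f = src g → tgt f' = src g' →
    tensor₁ (comp g f) (comp g' f') = comp (tensor₁ g g') (tensor₁ f f')
  tensor_vcomp : ∀ β α β' α', cod α = dom β → cod α' = dom β' →
    tensor₂ (vcomp β α) (vcomp β' α') = vcomp (tensor₂ β β') (tensor₂ α α')
  tensor_hcomp : ∀ β α β' α', tgt (dom α) = src (dom β) → tgt (dom α') = src (dom β') →
    tensor₂ (hcomp β α) (hcomp β' α') = hcomp (tensor₂ β β') (tensor₂ α α')
  assoc₀ : ∀ A B C, tensor₀ (tensor₀ A B) C = tensor₀ A (tensor₀ B C)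
  assoc₁ : ∀ f g h, tensor₁ (tensor₁ f g) h = tensor₁ f (tensor₁ g h)
  assoc₂ : ∀ α β γ, tensor₂ (tensor₂ α β) γ = tensor₂ α (tensor₂ β γ)
  unit_tensor₀ : ∀ A, tensor₀ I A = A
  unit_tensor₁ : ∀ f, tensor₁ (id₁ I) f = f
  unit_tensor₂ : ∀ α, tensor₂ (id₂ (id₁ I)) α = α
  tensor_unit₀ : ∀ A, tensor₀ A I = A
  tensor_unit₁ : ∀ f, tensor₁ f (id₁ I) = f
  tensor_unit₂ : ∀ α, tensor₂ α (id₂ (id₁ I)) = α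

infixr:90 " ⊗₀ " => StrictMonTwoCat.tensor₀ _
infixr:90 " ⊗₁ " => StrictMonTwoCat.tensor₁ _
infixr:90 " ⊗₂ " => StrictMonTwoCat.tensor₂ _

/-- A symmetric strict monoidal 2-category: a strict monoidal 2-category with a 2-natural symmetry
`σ`, of square identity and satisfying the hexagon condition. -/
structure SymStrictMonTwoCat extends StrictMonTwoCat.{u} where
  σ : Obj → Obj → One
  src_σ : ∀ A B, src (σ A B) = tensor₀ A B
  tgt_σ : ∀ A B, tgt (σ A B) = tensor₀ B A
  σ_naturality₁ : ∀ f g, comp (σ (tgt f) (tgt g)) (tensor₁ f g) =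
    comp (tensor₁ g f) (σ (src f) (src g))
  σ_naturality₂ : ∀ α β,
    hcomp (id₂ (σ (tgt (dom α)) (tgt (dom β)))) (tensor₂ α β) =
      hcomp (tensor₂ β α) (id₂ (σ (src (dom α)) (src (dom β))))
  σ_σ : ∀ A B, comp (σ B A) (σ A B) = id₁ (tensor₀ A B)
  σ_hexagon : ∀ A B C, σ A (tensor₀ B C) =
    comp (tensor₁ (id₁ B) (σ A C)) (tensor₁ (σ A B) (id₁ C))

namespace StrictMonTwoCat
open TwoCat SymStrictMonTwoCat

attribute [simp] src_tensor tgt_tensor dom_tensor cod_tensor tensor_id₁ tensor_id₂ assoc₀ assoc₁ assoc₂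
  unit_tensor₀ unit_tensor₁ unit_tensor₂ tensor_unit₀ tensor_unit₁ tensor_unit₂

section
variable {M : StrictMonTwoCat.{u}}

@[simp] theorem id₁_tensor_assoc (A B : M.Obj) (f : M.One) :
    M.id₁ A ⊗₁ M.id₁ B ⊗₁ f = M.id₁ (A ⊗₀ B) ⊗₁ f := by
  rw [← M.assoc₁, M.tensor_id₁]
@[simp] theorem id₂_tensor_assoc (f g : M.One) (α : M.Two) :
    M.id₂ f ⊗₂ M.id₂ g ⊗₂ α = M.id₂ (f ⊗₁ g) ⊗₂ α := by
  rw [← M.assoc₂, M.tensor_id₂]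

/-- merging -/
@[simp] theorem merge {g g' f f' : M.One} (h : M.tgt f = M.src g) (h' : M.tgt f' = M.src g') :
    (g ⊗₁ g') ∘₁ (f ⊗₁ f') = (g ∘₁ f) ⊗₁ (g' ∘₁ f') := (M.tensor_comp _ _ _ _ h h').symm
@[simp] theorem merge_assoc {g g' f f' e : M.One} (h : M.tgt f = M.src g)
    (h' : M.tgt f' = M.src g') (h'' : M.tgt e = M.src f ⊗₀ M.src f') :
    (g ⊗₁ g') ∘₁ (f ⊗₁ f') ∘₁ e = ((g ∘₁ f) ⊗₁ (g' ∘₁ f')) ∘₁ e := by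
  rw [← merge h h', M.comp_assoc] <;> simp [*]
@[simp] theorem merge₃ {g g' f₁ f₂ f' : M.One} (h : M.tgt f₁ ⊗₀ M.tgt f₂ = M.src g)
    (h' : M.tgt f' = M.src g') :
    (g ⊗₁ g') ∘₁ (f₁ ⊗₁ f₂ ⊗₁ f') = (g ∘₁ (f₁ ⊗₁ f₂)) ⊗₁ (g' ∘₁ f') := by
  rw [← M.assoc₁, merge] <;> simp [*]
@[simp] theorem merge_id_right {g g' f : M.One} {A B : M.Obj} (h : M.tgt f ⊗₀ A = M.src g)
    (h' : B = M.src g') :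
    (g ⊗₁ g') ∘₁ (f ⊗₁ M.id₁ (A ⊗₀ B)) = (g ∘₁ (f ⊗₁ M.id₁ A)) ⊗₁ g' := by
  rw [← M.tensor_id₁, ← M.assoc₁, merge] <;> simp [*]
@[simp] theorem merge_id_left {g g' f : M.One} {A B : M.Obj} (h : B ⊗₀ M.tgt f = M.src g')
    (h' : A = M.src g) :
    (g ⊗₁ g') ∘₁ (M.id₁ (A ⊗₀ B) ⊗₁ f) = g ⊗₁ (g' ∘₁ (M.id₁ B ⊗₁ f)) := by
  rw [← M.tensor_id₁, M.assoc₁, merge] <;> simp [*]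

@[simp] theorem merge_unit_left {g g' f : M.One} (h : M.src g = M.I) (h' : M.tgt f = M.src g') :
    (g ⊗₁ g') ∘₁ f = g ⊗₁ (g' ∘₁ f) := by
  conv_lhs => rw [← M.unit_tensor₁ f]
  rw [merge] <;> simp [*]
@[simp] theorem merge_unit_right {g g' f : M.One} (h : M.src g' = M.I) (h' : M.tgt f = M.src g) :
    (g ⊗₁ g') ∘₁ f = (g ∘₁ f) ⊗₁ g' := by
  conv_lhs => rw [← M.tensor_unit₁ f]
  rw [merge] <;> simp [*]
@[simp] theorem vcomp_tensor_id₂ {β α : M.Two} {f : M.One} (h : M.cod α = M.dom β) :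
    (β ∘ᵥ α) ⊗₂ M.id₂ f = (β ⊗₂ M.id₂ f) ∘ᵥ (α ⊗₂ M.id₂ f) := by
  rw [← M.tensor_vcomp] <;> simp [*]
@[simp] theorem id₂_tensor_vcomp {β α : M.Two} {f : M.One} (h : M.cod α = M.dom β) :
    M.id₂ f ⊗₂ (β ∘ᵥ α) = (M.id₂ f ⊗₂ β) ∘ᵥ (M.id₂ f ⊗₂ α) := by
  rw [← M.tensor_vcomp] <;> simp [*]
end

/-- The 2-cell `α` is invertible (for vertical composition). -/
def IsInv (M : TwoCat.{u}) (α : M.Two) : Prop :=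
  ∃ β, M.Is₂ β (M.cod α) (M.dom α) ∧ β ∘ᵥ α = M.id₂ (M.dom α) ∧ α ∘ᵥ β = M.id₂ (M.cod α)

/-- A pseudomonoid: an object `A` with multiplication `m`, unit `u`, and invertible associativity and
unit 2-cells `α`, `lam`, `rho` obeying the pentagon and triangle conditions. -/
@[ext]
structure Pseudomonoid (M : StrictMonTwoCat.{u}) where
  A : M.Obj
  m : M.One
  u : M.One
  α : M.Two
  lam : M.Two
  rho : M.Two
  m_is : M.Is₁ m (A ⊗₀ A) A
  u_is : M.Is₁ u M.I A
  α_is : M.Is₂ α (m ∘₁ (m ⊗₁ M.id₁ A)) (m ∘₁ (M.id₁ A ⊗₁ m))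
  lam_is : M.Is₂ lam (m ∘₁ (u ⊗₁ M.id₁ A)) (M.id₁ A)
  rho_is : M.Is₂ rho (m ∘₁ (M.id₁ A ⊗₁ u)) (M.id₁ A)
  α_inv : IsInv M.toTwoCat α
  lam_inv : IsInv M.toTwoCat lam
  rho_inv : IsInv M.toTwoCat rho
  pentagon :
    (α ∘ₕ M.id₂ (M.id₁ A ⊗₁ M.id₁ A ⊗₁ m)) ∘ᵥ (α ∘ₕ M.id₂ (m ⊗₁ M.id₁ A ⊗₁ M.id₁ A)) =
      (M.id₂ m ∘ₕ (M.id₂ (M.id₁ A) ⊗₂ α)) ∘ᵥ (α ∘ₕ M.id₂ (M.id₁ A ⊗₁ m ⊗₁ M.id₁ A)) ∘ᵥ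
        (M.id₂ m ∘ₕ (α ⊗₂ M.id₂ (M.id₁ A)))
  triangle :
    (M.id₂ m ∘ₕ (M.id₂ (M.id₁ A) ⊗₂ lam)) ∘ᵥ (α ∘ₕ M.id₂ (M.id₁ A ⊗₁ u ⊗₁ M.id₁ A)) =
      M.id₂ m ∘ₕ (rho ⊗₂ M.id₂ (M.id₁ A))

/-- An opmonoidal 1-cell between pseudomonoids. -/
@[ext]
structure OpmonOne (M : StrictMonTwoCat.{u}) where
  src : Pseudomonoid M
  tgt : Pseudomonoid M
  f : M.One
  φ₂ : M.Two
  φ₀ : M.Two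
  f_is : M.Is₁ f src.A tgt.A
  φ₂_is : M.Is₂ φ₂ (f ∘₁ src.m) (tgt.m ∘₁ (f ⊗₁ f))
  φ₀_is : M.Is₂ φ₀ (f ∘₁ src.u) tgt.u
  coassoc :
    (tgt.α ∘ₕ M.id₂ (f ⊗₁ f ⊗₁ f)) ∘ᵥ (M.id₂ tgt.m ∘ₕ (φ₂ ⊗₂ M.id₂ f)) ∘ᵥ
        (φ₂ ∘ₕ M.id₂ (src.m ⊗₁ M.id₁ src.A)) =
      (M.id₂ tgt.m ∘ₕ (M.id₂ f ⊗₂ φ₂)) ∘ᵥ (φ₂ ∘ₕ M.id₂ (M.id₁ src.A ⊗₁ src.m)) ∘ᵥ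
        (M.id₂ f ∘ₕ src.α)
  counit_left :
    (tgt.lam ∘ₕ M.id₂ f) ∘ᵥ (M.id₂ tgt.m ∘ₕ (φ₀ ⊗₂ M.id₂ f)) ∘ᵥ
        (φ₂ ∘ₕ M.id₂ (src.u ⊗₁ M.id₁ src.A)) = M.id₂ f ∘ₕ src.lam
  counit_right :
    (tgt.rho ∘ₕ M.id₂ f) ∘ᵥ (M.id₂ tgt.m ∘ₕ (M.id₂ f ⊗₂ φ₀)) ∘ᵥ
        (φ₂ ∘ₕ M.id₂ (M.id₁ src.A ⊗₁ src.u)) = M.id₂ f ∘ₕ src.rho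

/-- An opmonoidal 2-cell. -/
@[ext]
structure OpmonTwo (M : StrictMonTwoCat.{u}) where
  dom : OpmonOne M
  cod : OpmonOne M
  ω : M.Two
  src_dom : dom.src = cod.src
  tgt_dom : dom.tgt = cod.tgt
  ω_is : M.Is₂ ω dom.f cod.f
  compat₂ : (M.id₂ dom.tgt.m ∘ₕ (ω ⊗₂ ω)) ∘ᵥ dom.φ₂ = cod.φ₂ ∘ᵥ (ω ∘ₕ M.id₂ dom.src.m)
  compat₀ : dom.φ₀ = cod.φ₀ ∘ᵥ (ω ∘ₕ M.id₂ dom.src.u)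

attribute [simp] OpmonTwo.src_dom OpmonTwo.tgt_dom

section
variable {M : StrictMonTwoCat.{u}} (P : Pseudomonoid M) (F : OpmonOne M) (W : OpmonTwo M)
@[simp] theorem Pseudomonoid.src_m : M.src P.m = P.A ⊗₀ P.A := P.m_is.1
@[simp] theorem Pseudomonoid.tgt_m : M.tgt P.m = P.A := P.m_is.2
@[simp] theorem Pseudomonoid.src_u : M.src P.u = M.I := P.u_is.1
@[simp] theorem Pseudomonoid.tgt_u : M.tgt P.u = P.A := P.u_is.2
@[simp] theorem Pseudomonoid.dom_α : M.dom P.α = P.m ∘₁ (P.m ⊗₁ M.id₁ P.A) := P.α_is.1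
@[simp] theorem Pseudomonoid.cod_α : M.cod P.α = P.m ∘₁ (M.id₁ P.A ⊗₁ P.m) := P.α_is.2
@[simp] theorem Pseudomonoid.dom_lam : M.dom P.lam = P.m ∘₁ (P.u ⊗₁ M.id₁ P.A) := P.lam_is.1
@[simp] theorem Pseudomonoid.cod_lam : M.cod P.lam = M.id₁ P.A := P.lam_is.2
@[simp] theorem Pseudomonoid.dom_rho : M.dom P.rho = P.m ∘₁ (M.id₁ P.A ⊗₁ P.u) := P.rho_is.1
@[simp] theorem Pseudomonoid.cod_rho : M.cod P.rho = M.id₁ P.A := P.rho_is.2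
@[simp] theorem OpmonOne.src_f : M.src F.f = F.src.A := F.f_is.1
@[simp] theorem OpmonOne.tgt_f : M.tgt F.f = F.tgt.A := F.f_is.2
@[simp] theorem OpmonOne.dom_φ₂ : M.dom F.φ₂ = F.f ∘₁ F.src.m := F.φ₂_is.1
@[simp] theorem OpmonOne.cod_φ₂ : M.cod F.φ₂ = F.tgt.m ∘₁ (F.f ⊗₁ F.f) := F.φ₂_is.2
@[simp] theorem OpmonOne.dom_φ₀ : M.dom F.φ₀ = F.f ∘₁ F.src.u := F.φ₀_is.1
@[simp] theorem OpmonOne.cod_φ₀ : M.cod F.φ₀ = F.tgt.u := F.φ₀_is.2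
@[simp] theorem OpmonTwo.dom_ω : M.dom W.ω = W.dom.f := W.ω_is.1
@[simp] theorem OpmonTwo.cod_ω : M.cod W.ω = W.cod.f := W.ω_is.2
end

def OpmonOne.id {M : StrictMonTwoCat.{u}} (P : Pseudomonoid M) : OpmonOne M where
  src := P
  tgt := P
  f := M.id₁ P.A
  φ₂ := M.id₂ P.m
  φ₀ := M.id₂ P.u
  f_is := by simp [Is₁]
  φ₂_is := by simp [Is₂]
  φ₀_is := by simp [Is₂]
  coassoc := by simp (maxDischargeDepth := 9)
  counit_left := by simp (maxDischargeDepth := 9)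
  counit_right := by simp (maxDischargeDepth := 9)

section comp
variable {M : StrictMonTwoCat.{u}}
theorem comp_tensor_left (G F : OpmonOne M) (h : F.tgt = G.src) :
    ((G.φ₂ ∘ₕ M.id₂ (F.f ⊗₁ F.f)) ∘ᵥ (M.id₂ G.f ∘ₕ F.φ₂)) ⊗₂ M.id₂ (G.f ∘₁ F.f) =
    ((G.φ₂ ⊗₂ M.id₂ G.f) ∘ₕ M.id₂ (F.f ⊗₁ F.f ⊗₁ F.f)) ∘ᵥ
      (M.id₂ (G.f ⊗₁ G.f) ∘ₕ (F.φ₂ ⊗₂ M.id₂ F.f)) := by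
  rw [vcomp_tensor_id₂, ← M.id₂_comp, M.tensor_hcomp, M.tensor_hcomp] <;>
    simp (maxDischargeDepth := 9) [h]

theorem comp_tensor_right (G F : OpmonOne M) (h : F.tgt = G.src) :
    M.id₂ (G.f ∘₁ F.f) ⊗₂ ((G.φ₂ ∘ₕ M.id₂ (F.f ⊗₁ F.f)) ∘ᵥ (M.id₂ G.f ∘ₕ F.φ₂)) =
    ((M.id₂ G.f ⊗₂ G.φ₂) ∘ₕ M.id₂ (F.f ⊗₁ F.f ⊗₁ F.f)) ∘ᵥ
      (M.id₂ (G.f ⊗₁ G.f) ∘ₕ (M.id₂ F.f ⊗₂ F.φ₂)) := by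
  rw [id₂_tensor_vcomp, ← M.id₂_comp, M.tensor_hcomp, M.tensor_hcomp] <;>
    simp (maxDischargeDepth := 9) [h]

theorem comp_tensor_left₀ (G F : OpmonOne M) (h : F.tgt = G.src) :
    (G.φ₀ ∘ᵥ (M.id₂ G.f ∘ₕ F.φ₀)) ⊗₂ M.id₂ (G.f ∘₁ F.f) =
    ((G.φ₀ ⊗₂ M.id₂ G.f) ∘ₕ M.id₂ F.f) ∘ᵥ (M.id₂ (G.f ⊗₁ G.f) ∘ₕ (F.φ₀ ⊗₂ M.id₂ F.f)) := by
  have e : G.φ₀ ⊗₂ M.id₂ (G.f ∘₁ F.f) = (G.φ₀ ⊗₂ M.id₂ G.f) ∘ₕ M.id₂ F.f := by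
    conv_rhs => rw [← M.unit_tensor₂ (M.id₂ F.f)]
    rw [← M.tensor_hcomp] <;> simp (maxDischargeDepth := 9) [h]
  rw [vcomp_tensor_id₂, e, ← M.id₂_comp, M.tensor_hcomp] <;>
    simp (maxDischargeDepth := 9) [h]
theorem comp_tensor_right₀ (G F : OpmonOne M) (h : F.tgt = G.src) :
    M.id₂ (G.f ∘₁ F.f) ⊗₂ (G.φ₀ ∘ᵥ (M.id₂ G.f ∘ₕ F.φ₀)) =
    ((M.id₂ G.f ⊗₂ G.φ₀) ∘ₕ M.id₂ F.f) ∘ᵥ (M.id₂ (G.f ⊗₁ G.f) ∘ₕ (M.id₂ F.f ⊗₂ F.φ₀)) := by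
  have e : M.id₂ (G.f ∘₁ F.f) ⊗₂ G.φ₀ = (M.id₂ G.f ⊗₂ G.φ₀) ∘ₕ M.id₂ F.f := by
    conv_rhs => rw [← M.tensor_unit₂ (M.id₂ F.f)]
    rw [← M.tensor_hcomp] <;> simp (maxDischargeDepth := 9) [h]
  rw [id₂_tensor_vcomp, e, ← M.id₂_comp, M.tensor_hcomp] <;>
    simp (maxDischargeDepth := 9) [h]

end comp

def OpmonOne.comp {M : StrictMonTwoCat.{u}} (G F : OpmonOne M) (h : F.tgt = G.src) :
    OpmonOne M where
  src := F.src
  tgt := G.tgt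
  f := G.f ∘₁ F.f
  φ₂ := (G.φ₂ ∘ₕ M.id₂ (F.f ⊗₁ F.f)) ∘ᵥ (M.id₂ G.f ∘ₕ F.φ₂)
  φ₀ := G.φ₀ ∘ᵥ (M.id₂ G.f ∘ₕ F.φ₀)
  f_is := by simp [Is₁, h]
  φ₂_is := by simp (maxDischargeDepth := 9) [Is₂, h]
  φ₀_is := by simp (maxDischargeDepth := 9) [Is₂, h]
  coassoc := by
    have h1 := F.coassoc
    have h2 := G.coassoc
    simp only [h] at h1
    rw [comp_tensor_left G F h, comp_tensor_right G F h]
    calc _ = (((G.tgt.α ∘ₕ M.id₂ (G.f ⊗₁ G.f ⊗₁ G.f)) ∘ᵥ (M.id₂ G.tgt.m ∘ₕ (G.φ₂ ⊗₂ M.id₂ G.f))) ∘ₕ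
              M.id₂ (F.f ⊗₁ F.f ⊗₁ F.f)) ∘ᵥ
              ((M.id₂ (G.tgt.m ∘₁ (G.f ⊗₁ G.f)) ∘ₕ (F.φ₂ ⊗₂ M.id₂ F.f)) ∘ᵥ
                (G.φ₂ ∘ₕ M.id₂ ((F.f ∘₁ F.src.m) ⊗₁ F.f))) ∘ᵥ
              (M.id₂ G.f ∘ₕ F.φ₂ ∘ₕ M.id₂ (F.src.m ⊗₁ M.id₁ F.src.A)) := by
            simp (maxDischargeDepth := 9) [h]
      _ = (((G.tgt.α ∘ₕ M.id₂ (G.f ⊗₁ G.f ⊗₁ G.f)) ∘ᵥ (M.id₂ G.tgt.m ∘ₕ (G.φ₂ ⊗₂ M.id₂ G.f)) ∘ᵥ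
              (G.φ₂ ∘ₕ M.id₂ (G.src.m ⊗₁ M.id₁ G.src.A))) ∘ₕ M.id₂ (F.f ⊗₁ F.f ⊗₁ F.f)) ∘ᵥ
              (M.id₂ G.f ∘ₕ ((M.id₂ G.src.m ∘ₕ (F.φ₂ ⊗₂ M.id₂ F.f)) ∘ᵥ
                (F.φ₂ ∘ₕ M.id₂ (F.src.m ⊗₁ M.id₁ F.src.A)))) := by
            rw [← exch (β := G.φ₂) (α := F.φ₂ ⊗₂ M.id₂ F.f) (a := G.f ∘₁ G.src.m)
              (b := (G.src.m ∘₁ (F.f ⊗₁ F.f)) ⊗₁ F.f)] <;>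
            simp (maxDischargeDepth := 9) [h]
      _ = (((M.id₂ G.tgt.m ∘ₕ (M.id₂ G.f ⊗₂ G.φ₂)) ∘ᵥ
              (G.φ₂ ∘ₕ M.id₂ (M.id₁ G.src.A ⊗₁ G.src.m))) ∘ₕ M.id₂ (F.f ⊗₁ F.f ⊗₁ F.f)) ∘ᵥ
              (M.id₂ G.f ∘ₕ ((G.src.α ∘ₕ M.id₂ (F.f ⊗₁ F.f ⊗₁ F.f)) ∘ᵥ
                (M.id₂ G.src.m ∘ₕ (F.φ₂ ⊗₂ M.id₂ F.f)) ∘ᵥ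
                (F.φ₂ ∘ₕ M.id₂ (F.src.m ⊗₁ M.id₁ F.src.A)))) := by
            rw [h2]; simp (maxDischargeDepth := 9) [h]
      _ = ((M.id₂ G.tgt.m ∘ₕ (M.id₂ G.f ⊗₂ G.φ₂)) ∘ₕ M.id₂ (F.f ⊗₁ F.f ⊗₁ F.f)) ∘ᵥ
              ((G.φ₂ ∘ₕ M.id₂ (F.f ⊗₁ (G.src.m ∘₁ (F.f ⊗₁ F.f)))) ∘ᵥ
                (M.id₂ (G.f ∘₁ G.src.m) ∘ₕ (M.id₂ F.f ⊗₂ F.φ₂))) ∘ᵥ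
              (M.id₂ G.f ∘ₕ ((F.φ₂ ∘ₕ M.id₂ (M.id₁ F.src.A ⊗₁ F.src.m)) ∘ᵥ
                (M.id₂ F.f ∘ₕ F.src.α))) := by
            rw [h1]; simp (maxDischargeDepth := 9) [h]
      _ = _ := by
            rw [exch (β := G.φ₂) (α := M.id₂ F.f ⊗₂ F.φ₂) (a' := G.tgt.m ∘₁ (G.f ⊗₁ G.f))
              (b' := F.f ⊗₁ (F.f ∘₁ F.src.m))] <;>
            simp (maxDischargeDepth := 9) [h]
  counit_left := by
    have h1 := F.counit_left
    have h2 := G.counit_left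
    simp only [h] at h1
    rw [comp_tensor_left₀ G F h]
    calc _ = (((G.tgt.lam ∘ₕ M.id₂ G.f) ∘ᵥ (M.id₂ G.tgt.m ∘ₕ (G.φ₀ ⊗₂ M.id₂ G.f))) ∘ₕ
              M.id₂ F.f) ∘ᵥ
              ((M.id₂ (G.tgt.m ∘₁ (G.f ⊗₁ G.f)) ∘ₕ (F.φ₀ ⊗₂ M.id₂ F.f)) ∘ᵥ
                (G.φ₂ ∘ₕ M.id₂ ((F.f ∘₁ F.src.u) ⊗₁ F.f))) ∘ᵥ
              (M.id₂ G.f ∘ₕ F.φ₂ ∘ₕ M.id₂ (F.src.u ⊗₁ M.id₁ F.src.A)) := by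
            simp (maxDischargeDepth := 9) [h]
      _ = (((G.tgt.lam ∘ₕ M.id₂ G.f) ∘ᵥ (M.id₂ G.tgt.m ∘ₕ (G.φ₀ ⊗₂ M.id₂ G.f)) ∘ᵥ
              (G.φ₂ ∘ₕ M.id₂ (G.src.u ⊗₁ M.id₁ G.src.A))) ∘ₕ M.id₂ F.f) ∘ᵥ
              (M.id₂ G.f ∘ₕ ((M.id₂ G.src.m ∘ₕ (F.φ₀ ⊗₂ M.id₂ F.f)) ∘ᵥ
                (F.φ₂ ∘ₕ M.id₂ (F.src.u ⊗₁ M.id₁ F.src.A)))) := by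
            rw [← exch (β := G.φ₂) (α := F.φ₀ ⊗₂ M.id₂ F.f) (a := G.f ∘₁ G.src.m)
              (b := G.src.u ⊗₁ F.f)] <;>
            simp (maxDischargeDepth := 9) [h]
      _ = M.id₂ G.f ∘ₕ ((G.src.lam ∘ₕ M.id₂ F.f) ∘ᵥ
              (M.id₂ G.src.m ∘ₕ (F.φ₀ ⊗₂ M.id₂ F.f)) ∘ᵥ
                (F.φ₂ ∘ₕ M.id₂ (F.src.u ⊗₁ M.id₁ F.src.A))) := by
            rw [h2]; simp (maxDischargeDepth := 9) [h]
      _ = _ := by rw [h1]; simp (maxDischargeDepth := 9) [h]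
  counit_right := by
    have h1 := F.counit_right
    have h2 := G.counit_right
    simp only [h] at h1
    rw [comp_tensor_right₀ G F h]
    calc _ = (((G.tgt.rho ∘ₕ M.id₂ G.f) ∘ᵥ (M.id₂ G.tgt.m ∘ₕ (M.id₂ G.f ⊗₂ G.φ₀))) ∘ₕ
              M.id₂ F.f) ∘ᵥ
              ((M.id₂ (G.tgt.m ∘₁ (G.f ⊗₁ G.f)) ∘ₕ (M.id₂ F.f ⊗₂ F.φ₀)) ∘ᵥ
                (G.φ₂ ∘ₕ M.id₂ (F.f ⊗₁ (F.f ∘₁ F.src.u)))) ∘ᵥ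
              (M.id₂ G.f ∘ₕ F.φ₂ ∘ₕ M.id₂ (M.id₁ F.src.A ⊗₁ F.src.u)) := by
            simp (maxDischargeDepth := 9) [h]
      _ = (((G.tgt.rho ∘ₕ M.id₂ G.f) ∘ᵥ (M.id₂ G.tgt.m ∘ₕ (M.id₂ G.f ⊗₂ G.φ₀)) ∘ᵥ
              (G.φ₂ ∘ₕ M.id₂ (M.id₁ G.src.A ⊗₁ G.src.u))) ∘ₕ M.id₂ F.f) ∘ᵥ
              (M.id₂ G.f ∘ₕ ((M.id₂ G.src.m ∘ₕ (M.id₂ F.f ⊗₂ F.φ₀)) ∘ᵥ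
                (F.φ₂ ∘ₕ M.id₂ (M.id₁ F.src.A ⊗₁ F.src.u)))) := by
            rw [← exch (β := G.φ₂) (α := M.id₂ F.f ⊗₂ F.φ₀) (a := G.f ∘₁ G.src.m)
              (b := F.f ⊗₁ G.src.u)] <;>
            simp (maxDischargeDepth := 9) [h]
      _ = M.id₂ G.f ∘ₕ ((G.src.rho ∘ₕ M.id₂ F.f) ∘ᵥ
              (M.id₂ G.src.m ∘ₕ (M.id₂ F.f ⊗₂ F.φ₀)) ∘ᵥ
                (F.φ₂ ∘ₕ M.id₂ (M.id₁ F.src.A ⊗₁ F.src.u))) := by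
            rw [h2]; simp (maxDischargeDepth := 9) [h]
      _ = _ := by rw [h1]; simp (maxDischargeDepth := 9) [h]
end StrictMonTwoCat

namespace StrictMonTwoCat
open TwoCat SymStrictMonTwoCat

def OpmonTwo.id {M : StrictMonTwoCat.{u}} (F : OpmonOne M) : OpmonTwo M where
  dom := F
  cod := F
  ω := M.id₂ F.f
  src_dom := rfl
  tgt_dom := rfl
  ω_is := by simp [Is₂]
  compat₂ := by simp
  compat₀ := by simp

def OpmonTwo.vcomp {M : StrictMonTwoCat.{u}} (V W : OpmonTwo M) (h : W.cod = V.dom) :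
    OpmonTwo M where
  dom := W.dom
  cod := V.cod
  ω := V.ω ∘ᵥ W.ω
  src_dom := by simp [h]
  tgt_dom := by simp [h]
  ω_is := by simp [Is₂, h]
  compat₂ := by
    have h1 := W.compat₂
    have h2 := V.compat₂
    simp only [W.src_dom, W.tgt_dom, V.src_dom, V.tgt_dom, h] at h1 h2 ⊢
    rw [M.tensor_vcomp _ _ _ _ (by simp [h]) (by simp [h])]
    calc _ = (M.id₂ V.cod.tgt.m ∘ₕ (V.ω ⊗₂ V.ω)) ∘ᵥ
              ((M.id₂ V.cod.tgt.m ∘ₕ (W.ω ⊗₂ W.ω)) ∘ᵥ W.dom.φ₂) := by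
            simp (maxDischargeDepth := 9) [h]
      _ = ((M.id₂ V.cod.tgt.m ∘ₕ (V.ω ⊗₂ V.ω)) ∘ᵥ V.dom.φ₂) ∘ᵥ (W.ω ∘ₕ M.id₂ V.cod.src.m) := by
            rw [h1]; simp (maxDischargeDepth := 9) [h]
      _ = _ := by rw [h2]; simp (maxDischargeDepth := 9) [h]
  compat₀ := by
    have h1 := W.compat₀
    have h2 := V.compat₀
    simp only [W.src_dom, V.src_dom, h] at h1 h2 ⊢
    rw [h1, h2]
    simp (maxDischargeDepth := 9) [h]

def OpmonTwo.hcomp {M : StrictMonTwoCat.{u}} (V W : OpmonTwo M) (h : W.cod.tgt = V.cod.src) :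
    OpmonTwo M where
  dom := V.dom.comp W.dom (by simp [h])
  cod := V.cod.comp W.cod h
  ω := V.ω ∘ₕ W.ω
  src_dom := by simp [OpmonOne.comp]
  tgt_dom := by simp [OpmonOne.comp]
  ω_is := by simp [Is₂, h, OpmonOne.comp]
  compat₂ := by
    have h1 := W.compat₂
    have h2 := V.compat₂
    simp only [W.src_dom, W.tgt_dom, V.src_dom, V.tgt_dom, h] at h1 h2
    simp only [OpmonOne.comp, W.src_dom, V.tgt_dom]
    rw [M.tensor_hcomp _ _ _ _ (by simp [h]) (by simp [h])]
    calc _ = ((M.id₂ V.cod.tgt.m ∘ₕ (V.ω ⊗₂ V.ω)) ∘ₕ M.id₂ (W.cod.f ⊗₁ W.cod.f)) ∘ᵥ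
              ((M.id₂ (V.cod.tgt.m ∘₁ (V.dom.f ⊗₁ V.dom.f)) ∘ₕ (W.ω ⊗₂ W.ω)) ∘ᵥ
                (V.dom.φ₂ ∘ₕ M.id₂ (W.dom.f ⊗₁ W.dom.f))) ∘ᵥ (M.id₂ V.dom.f ∘ₕ W.dom.φ₂) := by
            rw [← exch₁ (β := V.ω ⊗₂ V.ω) (α := W.ω ⊗₂ W.ω) rfl rfl] <;>
            simp (maxDischargeDepth := 9) [h]
      _ = (((M.id₂ V.cod.tgt.m ∘ₕ (V.ω ⊗₂ V.ω)) ∘ᵥ V.dom.φ₂) ∘ₕ M.id₂ (W.cod.f ⊗₁ W.cod.f)) ∘ᵥ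
              (M.id₂ V.dom.f ∘ₕ ((M.id₂ V.cod.src.m ∘ₕ (W.ω ⊗₂ W.ω)) ∘ᵥ W.dom.φ₂)) := by
            rw [← exch (β := V.dom.φ₂) (α := W.ω ⊗₂ W.ω) (a := V.dom.f ∘₁ V.cod.src.m)
              (b := W.cod.f ⊗₁ W.cod.f)] <;>
            simp (maxDischargeDepth := 9) [h]
      _ = (V.cod.φ₂ ∘ₕ M.id₂ (W.cod.f ⊗₁ W.cod.f)) ∘ᵥ
              ((V.ω ∘ₕ M.id₂ (V.cod.src.m ∘₁ (W.cod.f ⊗₁ W.cod.f))) ∘ᵥ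
                (M.id₂ V.dom.f ∘ₕ W.cod.φ₂)) ∘ᵥ (M.id₂ V.dom.f ∘ₕ W.ω ∘ₕ M.id₂ W.cod.src.m) := by
            rw [h1, h2]; simp (maxDischargeDepth := 9) [h]
      _ = (V.cod.φ₂ ∘ₕ M.id₂ (W.cod.f ⊗₁ W.cod.f)) ∘ᵥ (M.id₂ V.cod.f ∘ₕ W.cod.φ₂) ∘ᵥ
            (((V.ω ∘ₕ M.id₂ W.cod.f) ∘ᵥ (M.id₂ V.dom.f ∘ₕ W.ω)) ∘ₕ M.id₂ W.cod.src.m) := by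
            rw [exch (β := V.ω) (α := W.cod.φ₂) (a' := V.cod.f) (b' := W.cod.f ∘₁ W.cod.src.m)] <;>
            simp (maxDischargeDepth := 9) [h]
      _ = _ := by
            rw [exch₁ (β := V.ω) (α := W.ω)] <;> simp (maxDischargeDepth := 9) [h]
  compat₀ := by
    have h1 := W.compat₀
    have h2 := V.compat₀
    simp only [W.src_dom, V.src_dom] at h1 h2
    simp only [OpmonOne.comp, W.src_dom]
    calc _ = V.cod.φ₀ ∘ᵥ ((V.ω ∘ₕ M.id₂ V.cod.src.u) ∘ᵥ (M.id₂ V.dom.f ∘ₕ W.cod.φ₀)) ∘ᵥ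
            (M.id₂ V.dom.f ∘ₕ W.ω ∘ₕ M.id₂ W.cod.src.u) := by
            rw [h1, h2]; simp (maxDischargeDepth := 9) [h]
      _ = V.cod.φ₀ ∘ᵥ (M.id₂ V.cod.f ∘ₕ W.cod.φ₀) ∘ᵥ
            (((V.ω ∘ₕ M.id₂ W.cod.f) ∘ᵥ (M.id₂ V.dom.f ∘ₕ W.ω)) ∘ₕ M.id₂ W.cod.src.u) := by
            rw [exch (β := V.ω) (α := W.cod.φ₀) (a' := V.cod.f) (b' := W.cod.f ∘₁ W.cod.src.u)] <;>
            simp (maxDischargeDepth := 9) [h]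
      _ = _ := by
            rw [exch₁ (β := V.ω) (α := W.ω)] <;> simp (maxDischargeDepth := 9) [h]

open Classical in
/-- The 2-category of pseudomonoids, opmonoidal 1-cells and opmonoidal 2-cells. -/
noncomputable def opmTwoCat (M : StrictMonTwoCat.{u}) : TwoCat.{u} where
  Obj := Pseudomonoid M
  One := OpmonOne M
  Two := OpmonTwo M
  src := OpmonOne.src
  tgt := OpmonOne.tgt
  dom := OpmonTwo.dom
  cod := OpmonTwo.cod
  id₁ := OpmonOne.id
  id₂ := OpmonTwo.id
  comp G F := if h : F.tgt = G.src then G.comp F h else G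
  vcomp V W := if h : W.cod = V.dom then V.vcomp W h else V
  hcomp V W := if h : W.cod.tgt = V.cod.src then V.hcomp W h else V
  src_dom := OpmonTwo.src_dom
  tgt_dom := OpmonTwo.tgt_dom
  src_id₁ _ := rfl
  tgt_id₁ _ := rfl
  dom_id₂ _ := rfl
  cod_id₂ _ := rfl
  src_comp G F h := by simp [h, OpmonOne.comp]
  tgt_comp G F h := by simp [h, OpmonOne.comp]
  dom_vcomp V W h := by simp [h, OpmonTwo.vcomp]
  cod_vcomp V W h := by simp [h, OpmonTwo.vcomp]
  dom_hcomp V W h := by simp at h; simp [h, OpmonTwo.hcomp]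
  cod_hcomp V W h := by simp at h; simp [h, OpmonTwo.hcomp]
  comp_assoc K G F h h' := by
    apply OpmonOne.ext <;> simp (maxDischargeDepth := 9) [h, h', OpmonOne.comp]
  id₁_comp F := by
    apply OpmonOne.ext <;> simp (maxDischargeDepth := 9) [OpmonOne.id, OpmonOne.comp]
  comp_id₁ F := by
    apply OpmonOne.ext <;> simp (maxDischargeDepth := 9) [OpmonOne.id, OpmonOne.comp]
  vcomp_assoc U V W h h' := by
    apply OpmonTwo.ext <;> simp (maxDischargeDepth := 9) [h, h', OpmonTwo.vcomp]
  id₂_vcomp W := by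
    apply OpmonTwo.ext <;> simp (maxDischargeDepth := 9) [OpmonTwo.vcomp, OpmonTwo.id]
  vcomp_id₂ W := by
    apply OpmonTwo.ext <;> simp (maxDischargeDepth := 9) [OpmonTwo.vcomp, OpmonTwo.id]
  hcomp_assoc U V W h h' := by
    simp at h h'
    apply OpmonTwo.ext <;>
      simp (maxDischargeDepth := 9) [h, h', OpmonTwo.hcomp, OpmonOne.comp]
  id₂_hcomp W := by
    apply OpmonTwo.ext <;>
      simp (maxDischargeDepth := 9) [OpmonTwo.hcomp, OpmonTwo.id, OpmonOne.comp, OpmonOne.id]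
    exact OpmonOne.ext W.src_dom.symm W.tgt_dom.symm rfl rfl rfl
  hcomp_id₂ W := by
    apply OpmonTwo.ext <;>
      simp (maxDischargeDepth := 9) [OpmonTwo.hcomp, OpmonTwo.id, OpmonOne.comp, OpmonOne.id]
    exact OpmonOne.ext W.src_dom.symm W.tgt_dom.symm rfl rfl rfl
  id₂_comp G F h := by
    apply OpmonTwo.ext <;>
      simp (maxDischargeDepth := 9) [h, OpmonTwo.hcomp, OpmonTwo.id, OpmonOne.comp]
  interchange V' V W' W h h' h'' := by
    simp at h''
    have h3 : W'.cod.tgt = V'.cod.src := by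
      rw [← W'.tgt_dom, ← h, h'', h', V'.src_dom]
    apply OpmonTwo.ext <;>
      simp (maxDischargeDepth := 9) [h, h', h3, OpmonTwo.hcomp, OpmonTwo.vcomp,
        OpmonOne.comp, M.interchange]
end StrictMonTwoCat

namespace SymStrictMonTwoCat
open TwoCat StrictMonTwoCat

attribute [simp] src_σ tgt_σ σ_σ

/-- The middle four interchange `1 σ 1 : A B C D ⟶ A C B D`. -/
def mid (M : SymStrictMonTwoCat.{u}) (A B C D : M.Obj) : M.One :=
  M.id₁ A ⊗₁ M.σ B C ⊗₁ M.id₁ D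

/-- The shuffle `A₁ B₁ A₂ B₂ A₃ B₃ ⟶ A₁ A₂ A₃ B₁ B₂ B₃`. -/
def shuf (M : SymStrictMonTwoCat.{u}) (A B A' B' A'' B'' : M.Obj) : M.One :=
  M.mid (A ⊗₀ A') (B ⊗₀ B') A'' B'' ∘₁ (M.mid A B A' B' ⊗₁ M.id₁ (A'' ⊗₀ B''))

section
variable {M : SymStrictMonTwoCat.{u}}
@[simp] theorem src_mid (A B C D : M.Obj) : M.src (M.mid A B C D) = A ⊗₀ B ⊗₀ C ⊗₀ D := by
  simp [mid]
@[simp] theorem tgt_mid (A B C D : M.Obj) : M.tgt (M.mid A B C D) = A ⊗₀ C ⊗₀ B ⊗₀ D := by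
  simp [mid]
@[simp] theorem src_shuf (A B A' B' A'' B'' : M.Obj) :
    M.src (M.shuf A B A' B' A'' B'') = A ⊗₀ B ⊗₀ A' ⊗₀ B' ⊗₀ A'' ⊗₀ B'' := by
  simp [shuf]
@[simp] theorem tgt_shuf (A B A' B' A'' B'' : M.Obj) :
    M.tgt (M.shuf A B A' B' A'' B'') = A ⊗₀ A' ⊗₀ A'' ⊗₀ B ⊗₀ B' ⊗₀ B'' := by
  simp [shuf]

theorem σ_nat₁ {f g : M.One} {A B A' B' : M.Obj} (hf : M.Is₁ f A B) (hg : M.Is₁ g A' B') :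
    M.σ B B' ∘₁ (f ⊗₁ g) = (g ⊗₁ f) ∘₁ M.σ A A' := by
  obtain ⟨rfl, rfl⟩ := hf
  obtain ⟨rfl, rfl⟩ := hg
  exact M.σ_naturality₁ f g
theorem σ_nat₂ {α β : M.Two} {A B A' B' : M.Obj} (hf : M.Is₁ (M.cod α) A B)
    (hg : M.Is₁ (M.cod β) A' B') :
    M.id₂ (M.σ B B') ∘ₕ (α ⊗₂ β) = (β ⊗₂ α) ∘ₕ M.id₂ (M.σ A A') := by
  obtain ⟨rfl, rfl⟩ := hf
  obtain ⟨rfl, rfl⟩ := hg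
  simp only [← src_dom, ← tgt_dom]
  exact M.σ_naturality₂ α β

theorem mid_nat₁ {x y c d : M.One} {A B C D A' B' C' D' : M.Obj} (hx : M.Is₁ x A' A)
    (hy : M.Is₁ y B' B) (hc : M.Is₁ c C' C) (hd : M.Is₁ d D' D) :
    M.mid A B C D ∘₁ (x ⊗₁ y ⊗₁ c ⊗₁ d) = (x ⊗₁ c ⊗₁ y ⊗₁ d) ∘₁ M.mid A' B' C' D' := by
  have e := σ_nat₁ hy hc
  obtain ⟨rfl, rfl⟩ := hx
  obtain ⟨rfl, rfl⟩ := hy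
  obtain ⟨rfl, rfl⟩ := hc
  obtain ⟨rfl, rfl⟩ := hd
  rw [← M.assoc₁ y c d, ← M.assoc₁ c y d, mid, mid, ← M.tensor_comp, ← M.tensor_comp,
    ← M.tensor_comp, ← M.tensor_comp, e] <;> simp

theorem mid_nat₂ {x y c d : M.Two} {A B C D A' B' C' D' : M.Obj} (hx : M.Is₁ (M.cod x) A' A)
    (hy : M.Is₁ (M.cod y) B' B) (hc : M.Is₁ (M.cod c) C' C) (hd : M.Is₁ (M.cod d) D' D) :
    M.id₂ (M.mid A B C D) ∘ₕ (x ⊗₂ y ⊗₂ c ⊗₂ d) =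
      (x ⊗₂ c ⊗₂ y ⊗₂ d) ∘ₕ M.id₂ (M.mid A' B' C' D') := by
  have e := σ_nat₂ hy hc
  obtain ⟨rfl, rfl⟩ := hx
  obtain ⟨rfl, rfl⟩ := hy
  obtain ⟨rfl, rfl⟩ := hc
  obtain ⟨rfl, rfl⟩ := hd
  rw [← M.assoc₂ y c d, ← M.assoc₂ c y d, mid, mid, ← M.tensor_id₂, ← M.tensor_id₂,
    ← M.tensor_id₂, ← M.tensor_id₂, ← M.tensor_hcomp, ← M.tensor_hcomp,
    ← M.tensor_hcomp, ← M.tensor_hcomp, e] <;> simp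

theorem σ_hexagon' (A B C : M.Obj) : M.σ (A ⊗₀ B) C =
    (M.σ A C ⊗₁ M.id₁ B) ∘₁ (M.id₁ A ⊗₁ M.σ B C) := by
  have h1 : (M.id₁ A ⊗₁ M.σ C B) ∘₁ (M.σ C A ⊗₁ M.id₁ B) = M.σ C (A ⊗₀ B) :=
    (M.σ_hexagon C A B).symm
  have h2 : ((M.σ A C ⊗₁ M.id₁ B) ∘₁ (M.id₁ A ⊗₁ M.σ B C)) ∘₁
      ((M.id₁ A ⊗₁ M.σ C B) ∘₁ (M.σ C A ⊗₁ M.id₁ B)) = M.id₁ (C ⊗₀ A ⊗₀ B) := by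
    calc _ = (M.σ A C ⊗₁ M.id₁ B) ∘₁ ((M.id₁ A ⊗₁ M.σ B C) ∘₁
      (M.id₁ A ⊗₁ M.σ C B)) ∘₁ (M.σ C A ⊗₁ M.id₁ B) := by
          simp (maxDischargeDepth := 9) [-merge, -merge_assoc, -merge₃, -merge_id_right, -merge_id_left]
      _ = (M.σ A C ⊗₁ M.id₁ B) ∘₁ (M.σ C A ⊗₁ M.id₁ B) := by
          rw [merge] <;> simp
      _ = _ := by rw [merge] <;> simp
  calc M.σ (A ⊗₀ B) C = M.id₁ (C ⊗₀ A ⊗₀ B) ∘₁ M.σ (A ⊗₀ B) C := by simp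
    _ = _ := by
      rw [← h2, h1, M.comp_assoc, M.σ_σ] <;> simp

theorem wR₁ {g f : M.One} (K : M.Obj) (h : M.tgt f = M.src g) :
    (g ∘₁ f) ⊗₁ M.id₁ K = (g ⊗₁ M.id₁ K) ∘₁ (f ⊗₁ M.id₁ K) := by
  rw [merge] <;> simp [h]
theorem wL₁ {g f : M.One} (K : M.Obj) (h : M.tgt f = M.src g) :
    M.id₁ K ⊗₁ (g ∘₁ f) = (M.id₁ K ⊗₁ g) ∘₁ (M.id₁ K ⊗₁ f) := by
  rw [merge] <;> simp [h]

theorem mid_assoc (A B A' B' A'' B'' : M.Obj) :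
    M.mid (A ⊗₀ A') (B ⊗₀ B') A'' B'' ∘₁ (M.mid A B A' B' ⊗₁ M.id₁ (A'' ⊗₀ B'')) =
    M.mid A B (A' ⊗₀ A'') (B' ⊗₀ B'') ∘₁ (M.id₁ (A ⊗₀ B) ⊗₁ M.mid A' B' A'' B'') := by
  have e : (M.id₁ A' ⊗₁ M.σ (B ⊗₀ B') A'') ∘₁ (M.σ B A' ⊗₁ M.id₁ (B' ⊗₀ A'')) =
    (M.σ B (A' ⊗₀ A'') ⊗₁ M.id₁ B') ∘₁ (M.id₁ (B ⊗₀ A') ⊗₁ M.σ B' A'') := by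
    have hex : M.σ B (A' ⊗₀ A'') = (M.id₁ A' ⊗₁ M.σ B A'') ∘₁ (M.σ B A' ⊗₁ M.id₁ A'') :=
      M.σ_hexagon B A' A''
    have h1 : M.id₁ A' ⊗₁ M.σ (B ⊗₀ B') A'' =
        (M.id₁ A' ⊗₁ M.σ B A'' ⊗₁ M.id₁ B') ∘₁ (M.id₁ (A' ⊗₀ B) ⊗₁ M.σ B' A'') := by
      rw [σ_hexagon', wL₁ _ (by simp)]; simp only [M.assoc₁, M.tensor_id₁, id₁_tensor_assoc]
    have h2 : M.σ B (A' ⊗₀ A'') ⊗₁ M.id₁ B' =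
        (M.id₁ A' ⊗₁ M.σ B A'' ⊗₁ M.id₁ B') ∘₁ (M.σ B A' ⊗₁ M.id₁ (A'' ⊗₀ B')) := by
      rw [hex, wR₁ _ (by simp)]; simp only [M.assoc₁, M.tensor_id₁, id₁_tensor_assoc]
    have a : (M.id₁ (A' ⊗₀ B) ⊗₁ M.σ B' A'') ∘₁ (M.σ B A' ⊗₁ M.id₁ (B' ⊗₀ A'')) =
        M.σ B A' ⊗₁ M.σ B' A'' := by rw [merge] <;> simp
    have b : (M.σ B A' ⊗₁ M.id₁ (A'' ⊗₀ B')) ∘₁ (M.id₁ (B ⊗₀ A') ⊗₁ M.σ B' A'') =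
        M.σ B A' ⊗₁ M.σ B' A'' := by rw [merge] <;> simp
    rw [h1, h2, M.comp_assoc, M.comp_assoc, a, b] <;> simp
  have h1 : M.mid (A ⊗₀ A') (B ⊗₀ B') A'' B'' =
      M.id₁ A ⊗₁ (M.id₁ A' ⊗₁ M.σ (B ⊗₀ B') A'') ⊗₁ M.id₁ B'' := by simp [mid]
  have h2 : M.mid A B A' B' ⊗₁ M.id₁ (A'' ⊗₀ B'') =
      M.id₁ A ⊗₁ (M.σ B A' ⊗₁ M.id₁ (B' ⊗₀ A'')) ⊗₁ M.id₁ B'' := by simp [mid]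
  have h3 : M.mid A B (A' ⊗₀ A'') (B' ⊗₀ B'') =
      M.id₁ A ⊗₁ (M.σ B (A' ⊗₀ A'') ⊗₁ M.id₁ B') ⊗₁ M.id₁ B'' := by simp [mid]
  have h4 : M.id₁ (A ⊗₀ B) ⊗₁ M.mid A' B' A'' B'' =
      M.id₁ A ⊗₁ (M.id₁ (B ⊗₀ A') ⊗₁ M.σ B' A'') ⊗₁ M.id₁ B'' := by simp [mid]
  rw [h1, h2, h3, h4, ← wL₁, ← wL₁, ← wR₁, ← wR₁, e] <;> simp

theorem shuf_eq (A B A' B' A'' B'' : M.Obj) : M.shuf A B A' B' A'' B'' =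
    M.mid A B (A' ⊗₀ A'') (B' ⊗₀ B'') ∘₁ (M.id₁ (A ⊗₀ B) ⊗₁ M.mid A' B' A'' B'') :=
  mid_assoc ..

/-- dual coherence -/
theorem mid_mid (A B C A' B' C' : M.Obj) :
    (M.mid A B A' B' ⊗₁ M.id₁ (C ⊗₀ C')) ∘₁ M.mid (A ⊗₀ B) C (A' ⊗₀ B') C' =
    (M.id₁ (A ⊗₀ A') ⊗₁ M.mid B C B' C') ∘₁ M.mid A (B ⊗₀ C) A' (B' ⊗₀ C') := by
  have e : (M.σ B A' ⊗₁ M.id₁ (B' ⊗₀ C)) ∘₁ (M.id₁ B ⊗₁ M.σ C (A' ⊗₀ B')) =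
    (M.id₁ (A' ⊗₀ B) ⊗₁ M.σ C B') ∘₁ (M.σ (B ⊗₀ C) A' ⊗₁ M.id₁ B') := by
    have hex : M.σ C (A' ⊗₀ B') = (M.id₁ A' ⊗₁ M.σ C B') ∘₁ (M.σ C A' ⊗₁ M.id₁ B') :=
      M.σ_hexagon C A' B'
    have h1 : M.σ (B ⊗₀ C) A' ⊗₁ M.id₁ B' =
        (M.σ B A' ⊗₁ M.id₁ (C ⊗₀ B')) ∘₁ (M.id₁ B ⊗₁ M.σ C A' ⊗₁ M.id₁ B') := by
      rw [σ_hexagon', wR₁ _ (by simp)]; simp only [M.assoc₁, M.tensor_id₁, id₁_tensor_assoc]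
    have h2 : M.id₁ B ⊗₁ M.σ C (A' ⊗₀ B') =
        (M.id₁ (B ⊗₀ A') ⊗₁ M.σ C B') ∘₁ (M.id₁ B ⊗₁ M.σ C A' ⊗₁ M.id₁ B') := by
      rw [hex, wL₁ _ (by simp)]; simp only [M.assoc₁, M.tensor_id₁, id₁_tensor_assoc]
    have a : (M.σ B A' ⊗₁ M.id₁ (B' ⊗₀ C)) ∘₁ (M.id₁ (B ⊗₀ A') ⊗₁ M.σ C B') =
        M.σ B A' ⊗₁ M.σ C B' := by rw [merge] <;> simp
    have b : (M.id₁ (A' ⊗₀ B) ⊗₁ M.σ C B') ∘₁ (M.σ B A' ⊗₁ M.id₁ (C ⊗₀ B')) =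
        M.σ B A' ⊗₁ M.σ C B' := by rw [merge] <;> simp
    rw [h1, h2, ← M.comp_assoc, ← M.comp_assoc, a, b] <;> simp
  have h1 : M.mid A B A' B' ⊗₁ M.id₁ (C ⊗₀ C') =
      M.id₁ A ⊗₁ (M.σ B A' ⊗₁ M.id₁ (B' ⊗₀ C)) ⊗₁ M.id₁ C' := by simp [mid]
  have h2 : M.mid (A ⊗₀ B) C (A' ⊗₀ B') C' =
      M.id₁ A ⊗₁ (M.id₁ B ⊗₁ M.σ C (A' ⊗₀ B')) ⊗₁ M.id₁ C' := by simp [mid]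
  have h3 : M.id₁ (A ⊗₀ A') ⊗₁ M.mid B C B' C' =
      M.id₁ A ⊗₁ (M.id₁ (A' ⊗₀ B) ⊗₁ M.σ C B') ⊗₁ M.id₁ C' := by simp [mid]
  have h4 : M.mid A (B ⊗₀ C) A' (B' ⊗₀ C') =
      M.id₁ A ⊗₁ (M.σ (B ⊗₀ C) A' ⊗₁ M.id₁ B') ⊗₁ M.id₁ C' := by simp [mid]
  rw [h1, h2, h3, h4, ← wL₁, ← wL₁, ← wR₁, ← wR₁, e] <;> simp
end
end SymStrictMonTwoCat

namespace SymStrictMonTwoCat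
open TwoCat StrictMonTwoCat
variable {M : SymStrictMonTwoCat.{u}}

theorem σ_unit_right (A : M.Obj) : M.σ A M.I = M.id₁ A := by
  have h : M.σ A M.I = M.σ A M.I ∘₁ M.σ A M.I := by
    have e := M.σ_hexagon A M.I M.I
    change M.σ A (M.I ⊗₀ M.I) = (M.id₁ M.I ⊗₁ M.σ A M.I) ∘₁ (M.σ A M.I ⊗₁ M.id₁ M.I) at e
    simpa only [M.unit_tensor₀, M.unit_tensor₁, M.tensor_unit₁] using e
  have h2 : M.σ M.I A ∘₁ M.σ A M.I = M.id₁ A := by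
    simp [M.σ_σ A M.I]
  have h3 : M.σ M.I A ∘₁ (M.σ A M.I ∘₁ M.σ A M.I) = M.id₁ A := by rw [← h, h2]
  rwa [← M.comp_assoc _ _ _ (by simp) (by simp), h2, id₁_comp' (by simp)] at h3
theorem σ_unit_left (A : M.Obj) : M.σ M.I A = M.id₁ A := by
  have h := M.σ_σ A M.I
  change M.σ M.I A ∘₁ M.σ A M.I = _ at h
  rw [σ_unit_right, comp_id₁' (by simp)] at h
  simpa using h
theorem mid_unit_left (C D : M.Obj) : M.mid M.I M.I C D = M.id₁ (C ⊗₀ D) := by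
  simp [mid, σ_unit_left]
theorem mid_unit_right (A B : M.Obj) : M.mid A B M.I M.I = M.id₁ (A ⊗₀ B) := by
  simp [mid, σ_unit_right]
@[simp] theorem mid_unit_middle (A B : M.Obj) : M.mid A M.I M.I B = M.id₁ (A ⊗₀ B) := by
  simp [mid, σ_unit_right]

/-- horizontal naturality -/
theorem J₂ {z w x y c d : M.Two} {r s : M.One} {A B C D X Y C' D' : M.Obj}
    (hz : M.src (M.cod z) = A ⊗₀ C) (hw : M.src (M.cod w) = B ⊗₀ D)
    (hx : M.Is₁ (M.cod x) X A) (hy : M.Is₁ (M.cod y) Y B)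
    (hc : M.Is₁ (M.cod c) C' C) (hd : M.Is₁ (M.cod d) D' D)
    (hr : M.tgt r = X ⊗₀ Y) (hs : M.tgt s = C' ⊗₀ D') :
    ((z ⊗₂ w) ∘ₕ M.id₂ (M.mid A B C D)) ∘ₕ
        (((x ⊗₂ y) ∘ₕ M.id₂ r) ⊗₂ ((c ⊗₂ d) ∘ₕ M.id₂ s)) =
      ((z ∘ₕ (x ⊗₂ c)) ⊗₂ (w ∘ₕ (y ⊗₂ d))) ∘ₕ M.id₂ (M.mid X Y C' D' ∘₁ (r ⊗₁ s)) := by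
  have e := mid_nat₂ hx hy hc hd
  obtain ⟨hx1, hx2⟩ := hx
  obtain ⟨hy1, hy2⟩ := hy
  obtain ⟨hc1, hc2⟩ := hc
  obtain ⟨hd1, hd2⟩ := hd
  calc _ = (z ⊗₂ w) ∘ₕ (M.id₂ (M.mid A B C D) ∘ₕ (x ⊗₂ y ⊗₂ c ⊗₂ d)) ∘ₕ M.id₂ (r ⊗₁ s) := by
        rw [M.tensor_hcomp, M.tensor_id₂, M.hcomp_assoc, ← M.hcomp_assoc (M.id₂ (M.mid A B C D)),
          M.assoc₂] <;> simp [*]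
    _ = ((z ⊗₂ w) ∘ₕ ((x ⊗₂ c) ⊗₂ (y ⊗₂ d))) ∘ₕ M.id₂ (M.mid X Y C' D' ∘₁ (r ⊗₁ s)) := by
        rw [e, M.hcomp_assoc, M.hcomp_assoc, M.id₂_comp, M.assoc₂] <;> simp [*]
    _ = _ := by rw [M.tensor_hcomp] <;> simp [*]

theorem J₃ {z w x y x' y' x'' y'' : M.Two} {r r' r'' : M.One}
    {A B A' B' A'' B'' X Y X' Y' X'' Y'' : M.Obj}
    (hz : M.src (M.cod z) = A ⊗₀ A' ⊗₀ A'') (hw : M.src (M.cod w) = B ⊗₀ B' ⊗₀ B'')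
    (hx : M.Is₁ (M.cod x) X A) (hy : M.Is₁ (M.cod y) Y B)
    (hx' : M.Is₁ (M.cod x') X' A') (hy' : M.Is₁ (M.cod y') Y' B')
    (hx'' : M.Is₁ (M.cod x'') X'' A'') (hy'' : M.Is₁ (M.cod y'') Y'' B'')
    (hr : M.tgt r = X ⊗₀ Y) (hr' : M.tgt r' = X' ⊗₀ Y') (hr'' : M.tgt r'' = X'' ⊗₀ Y'') :
    ((z ⊗₂ w) ∘ₕ M.id₂ (M.shuf A B A' B' A'' B'')) ∘ₕ
        (((x ⊗₂ y) ∘ₕ M.id₂ r) ⊗₂ ((x' ⊗₂ y') ∘ₕ M.id₂ r') ⊗₂ ((x'' ⊗₂ y'') ∘ₕ M.id₂ r'')) =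
      ((z ∘ₕ (x ⊗₂ x' ⊗₂ x'')) ⊗₂ (w ∘ₕ (y ⊗₂ y' ⊗₂ y''))) ∘ₕ
        M.id₂ (M.shuf X Y X' Y' X'' Y'' ∘₁ (r ⊗₁ r' ⊗₁ r'')) := by
  have e := J₂ (z := M.id₂ (M.id₁ (A ⊗₀ A'))) (w := M.id₂ (M.id₁ (B ⊗₀ B'))) (r := r) (s := r')
    (by simp) (by simp) hx hy hx' hy' hr hr'
  have hx0 := hx; have hy0 := hy; have hx0' := hx'; have hy0' := hy'
  obtain ⟨hx1, hx2⟩ := hx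
  obtain ⟨hy1, hy2⟩ := hy
  obtain ⟨hx1', hx2'⟩ := hx'
  obtain ⟨hy1', hy2'⟩ := hy'
  have e' := J₂ (z := z) (w := w) (x := x ⊗₂ x') (y := y ⊗₂ y') (c := x'') (d := y'')
    (r := M.mid X Y X' Y' ∘₁ (r ⊗₁ r')) (s := r'')
    (A := A ⊗₀ A') (B := B ⊗₀ B') (C := A'') (D := B'')
    (X := X ⊗₀ X') (Y := Y ⊗₀ Y') (C' := X'') (D' := Y'')
    (by simp [hz]) (by simp [hw]) ⟨by simp [*], by simp [*]⟩ ⟨by simp [*], by simp [*]⟩ hx'' hy''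
    (by simp [*]) hr''
  obtain ⟨hx1'', hx2''⟩ := hx''
  obtain ⟨hy1'', hy2''⟩ := hy''
  have e1 : M.id₂ (M.mid A B A' B') ∘ₕ (((x ⊗₂ y) ∘ₕ M.id₂ r) ⊗₂ ((x' ⊗₂ y') ∘ₕ M.id₂ r')) =
      (((x ⊗₂ x') ⊗₂ (y ⊗₂ y')) ∘ₕ M.id₂ (M.mid X Y X' Y' ∘₁ (r ⊗₁ r'))) := by
    rw [M.tensor_id₂, M.tensor_id₁, id₂_hcomp' (by simp), id₂_hcomp' (by simp [*]),
      id₂_hcomp' (by simp [*])] at e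
    exact e
  have e2 : M.id₂ (M.mid A B A' B' ⊗₁ M.id₁ (A'' ⊗₀ B'')) ∘ₕ
      (((x ⊗₂ y) ∘ₕ M.id₂ r) ⊗₂ ((x' ⊗₂ y') ∘ₕ M.id₂ r') ⊗₂ ((x'' ⊗₂ y'') ∘ₕ M.id₂ r'')) =
      (((x ⊗₂ x') ⊗₂ (y ⊗₂ y')) ∘ₕ M.id₂ (M.mid X Y X' Y' ∘₁ (r ⊗₁ r'))) ⊗₂
        ((x'' ⊗₂ y'') ∘ₕ M.id₂ r'') := by
    rw [← M.tensor_id₂, ← M.assoc₂, ← M.tensor_hcomp, e1, id₂_hcomp'] <;> simp [*]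
  have e3 : M.shuf X Y X' Y' X'' Y'' ∘₁ (r ⊗₁ r' ⊗₁ r'') =
      M.mid (X ⊗₀ X') (Y ⊗₀ Y') X'' Y'' ∘₁ ((M.mid X Y X' Y' ∘₁ (r ⊗₁ r')) ⊗₁ r'') := by
    rw [shuf, M.comp_assoc, ← M.assoc₁, ← M.tensor_comp, id₁_comp'] <;> simp [*]
  rw [e3, ← M.assoc₂ x, ← M.assoc₂ y, ← e', ← e2, shuf, ← M.id₂_comp, ← M.hcomp_assoc,
    ← M.hcomp_assoc] <;> simp [*]

theorem Jv {X Y X' Y' : M.Two} {q : M.One} (h : M.cod X' = M.dom X) (h' : M.cod Y' = M.dom Y)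
    (hq : M.tgt q = M.src (M.cod X) ⊗₀ M.src (M.cod Y)) :
    ((X ⊗₂ Y) ∘ₕ M.id₂ q) ∘ᵥ ((X' ⊗₂ Y') ∘ₕ M.id₂ q) =
      ((X ∘ᵥ X') ⊗₂ (Y ∘ᵥ Y')) ∘ₕ M.id₂ q := by
  rw [M.tensor_vcomp, wr] <;> simp [*]

theorem IsInv.tensor {α β : M.Two} (hα : IsInv M.toTwoCat α) (hβ : IsInv M.toTwoCat β) :
    IsInv M.toTwoCat (α ⊗₂ β) := by
  obtain ⟨α', ⟨h1, h2⟩, h3, h4⟩ := hα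
  obtain ⟨β', ⟨h5, h6⟩, h7, h8⟩ := hβ
  refine ⟨α' ⊗₂ β', ⟨by simp [*], by simp [*]⟩, ?_, ?_⟩
  · rw [← M.tensor_vcomp, h3, h7] <;> simp [*]
  · rw [← M.tensor_vcomp, h4, h8] <;> simp [*]
theorem IsInv.whisker {α : M.Two} {q : M.One} (hα : IsInv M.toTwoCat α)
    (h : M.tgt q = M.src (M.cod α)) : IsInv M.toTwoCat (α ∘ₕ M.id₂ q) := by
  obtain ⟨α', ⟨h1, h2⟩, h3, h4⟩ := hα
  have h' : M.tgt q = M.src (M.cod α') := by rw [h, h2, ← src_dom]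
  refine ⟨α' ∘ₕ M.id₂ q, ⟨by simp [*], by simp [*]⟩, ?_, ?_⟩
  · rw [← wr, h3] <;> simp [*]
  · rw [← wr, h4] <;> simp [*]
end SymStrictMonTwoCat

namespace SymStrictMonTwoCat
open TwoCat StrictMonTwoCat
variable {M : SymStrictMonTwoCat.{u}}

theorem J₁ {z w x y c d r s : M.One} {A B C D X Y C' D' : M.Obj}
    (hz : M.src z = A ⊗₀ C) (hw : M.src w = B ⊗₀ D)
    (hx : M.Is₁ x X A) (hy : M.Is₁ y Y B) (hc : M.Is₁ c C' C) (hd : M.Is₁ d D' D)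
    (hr : M.tgt r = X ⊗₀ Y) (hs : M.tgt s = C' ⊗₀ D') :
    ((z ⊗₁ w) ∘₁ M.mid A B C D) ∘₁ (((x ⊗₁ y) ∘₁ r) ⊗₁ ((c ⊗₁ d) ∘₁ s)) =
      ((z ∘₁ (x ⊗₁ c)) ⊗₁ (w ∘₁ (y ⊗₁ d))) ∘₁ (M.mid X Y C' D' ∘₁ (r ⊗₁ s)) := by
  have e := J₂ (z := M.id₂ z) (w := M.id₂ w) (x := M.id₂ x) (y := M.id₂ y) (c := M.id₂ c)
    (d := M.id₂ d) (r := r) (s := s) (by simpa using hz) (by simpa using hw) (by simpa using hx)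
    (by simpa using hy) (by simpa using hc) (by simpa using hd) hr hs
  have e' := congrArg M.dom e
  obtain ⟨hx1, hx2⟩ := hx
  obtain ⟨hy1, hy2⟩ := hy
  obtain ⟨hc1, hc2⟩ := hc
  obtain ⟨hd1, hd2⟩ := hd
  rw [M.dom_hcomp, M.dom_hcomp, M.dom_tensor, M.dom_tensor, M.dom_hcomp, M.dom_hcomp,
    M.dom_hcomp, M.dom_tensor, M.dom_tensor, M.dom_tensor, M.dom_hcomp, M.dom_hcomp,
    M.dom_tensor, M.dom_tensor] at e'
  · simpa only [M.dom_id₂] using e'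
  all_goals simp [*]

section coh
variable (A B A' B' A'' B'' X Y : M.Obj)
/-- The shuffle on four pairs of objects. -/
def shuf₄ (M : SymStrictMonTwoCat.{u}) (A B A' B' A'' B'' X Y : M.Obj) : M.One :=
  M.mid A B (A' ⊗₀ A'' ⊗₀ X) (B' ⊗₀ B'' ⊗₀ Y) ∘₁ (M.id₁ (A ⊗₀ B) ⊗₁ M.shuf A' B' A'' B'' X Y)
@[simp] theorem src_shuf₄ : M.src (M.shuf₄ A B A' B' A'' B'' X Y) =
    A ⊗₀ B ⊗₀ A' ⊗₀ B' ⊗₀ A'' ⊗₀ B'' ⊗₀ X ⊗₀ Y := by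
  simp [shuf₄]
@[simp] theorem tgt_shuf₄ : M.tgt (M.shuf₄ A B A' B' A'' B'' X Y) =
    A ⊗₀ A' ⊗₀ A'' ⊗₀ X ⊗₀ B ⊗₀ B' ⊗₀ B'' ⊗₀ Y := by
  simp [shuf₄]

theorem c_right : M.shuf A B A' B' (A'' ⊗₀ X) (B'' ⊗₀ Y) ∘₁
    (M.id₁ (A ⊗₀ B) ⊗₁ M.id₁ (A' ⊗₀ B') ⊗₁ M.mid A'' B'' X Y) =
      M.shuf₄ A B A' B' A'' B'' X Y := by
  rw [shuf_eq, shuf₄, shuf_eq, M.comp_assoc, wL₁] <;> simp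
theorem c_mid : M.shuf A B (A' ⊗₀ A'') (B' ⊗₀ B'') X Y ∘₁
    (M.id₁ (A ⊗₀ B) ⊗₁ M.mid A' B' A'' B'' ⊗₁ M.id₁ (X ⊗₀ Y)) =
      M.shuf₄ A B A' B' A'' B'' X Y := by
  rw [shuf_eq, shuf₄, shuf, M.comp_assoc, wL₁] <;> simp
theorem c_mid' : M.shuf A B (A' ⊗₀ A'') (B' ⊗₀ B'') X Y ∘₁
    (M.id₁ (A ⊗₀ B) ⊗₁ M.mid A' B' A'' B'' ⊗₁ M.id₁ (X ⊗₀ Y)) =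
      M.mid (A ⊗₀ A' ⊗₀ A'') (B ⊗₀ B' ⊗₀ B'') X Y ∘₁
        (M.shuf A B A' B' A'' B'' ⊗₁ M.id₁ (X ⊗₀ Y)) := by
  rw [shuf, shuf_eq, M.comp_assoc, wR₁, M.assoc₁] <;> simp
theorem c_outer : M.mid (A ⊗₀ A' ⊗₀ A'') (B ⊗₀ B' ⊗₀ B'') X Y ∘₁
        (M.shuf A B A' B' A'' B'' ⊗₁ M.id₁ (X ⊗₀ Y)) = M.shuf₄ A B A' B' A'' B'' X Y := by
  rw [← c_mid', c_mid]
theorem c_left : M.shuf (A ⊗₀ A') (B ⊗₀ B') A'' B'' X Y ∘₁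
    (M.mid A B A' B' ⊗₁ M.id₁ (A'' ⊗₀ B'') ⊗₁ M.id₁ (X ⊗₀ Y)) =
      M.shuf₄ A B A' B' A'' B'' X Y := by
  rw [← c_outer, shuf, shuf, M.comp_assoc, wR₁, M.assoc₁, M.tensor_id₁] <;> simp
end coh

end SymStrictMonTwoCat
namespace StrictMonTwoCat
open TwoCat SymStrictMonTwoCat
/-- The product pseudomonoid, with multiplication `A B A B ⟶ A A B B ⟶ A B`. -/
def Pseudomonoid.tensor {M : SymStrictMonTwoCat.{u}}
    (P Q : Pseudomonoid M.toStrictMonTwoCat) : Pseudomonoid M.toStrictMonTwoCat where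
  A := P.A ⊗₀ Q.A
  m := (P.m ⊗₁ Q.m) ∘₁ M.mid P.A Q.A P.A Q.A
  u := P.u ⊗₁ Q.u
  α := (P.α ⊗₂ Q.α) ∘ₕ M.id₂ (M.shuf P.A Q.A P.A Q.A P.A Q.A)
  lam := P.lam ⊗₂ Q.lam
  rho := P.rho ⊗₂ Q.rho
  m_is := by simp [Is₁]
  u_is := by simp [Is₁]
  α_is := by
    constructor
    · have e := J₁ (z := P.m) (w := Q.m) (x := P.m) (y := Q.m) (c := M.id₁ P.A) (d := M.id₁ Q.A)
        (r := M.mid P.A Q.A P.A Q.A) (s := M.id₁ (P.A ⊗₀ Q.A)) (A := P.A) (B := Q.A) (C := P.A)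
        (D := Q.A) (X := P.A ⊗₀ P.A) (Y := Q.A ⊗₀ Q.A) (C' := P.A) (D' := Q.A)
        (by simp) (by simp) (by simp [Is₁])
        (by simp [Is₁]) (by simp [Is₁]) (by simp [Is₁]) (by simp) (by simp)
      rw [M.tensor_id₁, M.id₁_comp' (by simp)] at e
      rw [e, M.dom_hcomp _ _ (by simp)]; simp [shuf]
    · have e := J₁ (z := P.m) (w := Q.m) (c := P.m) (d := Q.m) (x := M.id₁ P.A) (y := M.id₁ Q.A)
        (s := M.mid P.A Q.A P.A Q.A) (r := M.id₁ (P.A ⊗₀ Q.A)) (A := P.A) (B := Q.A) (C := P.A)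
        (D := Q.A) (X := P.A) (Y := Q.A) (C' := P.A ⊗₀ P.A) (D' := Q.A ⊗₀ Q.A)
        (by simp) (by simp) (by simp [Is₁])
        (by simp [Is₁]) (by simp [Is₁]) (by simp [Is₁]) (by simp) (by simp)
      rw [M.tensor_id₁, M.id₁_comp' (by simp)] at e
      rw [e, M.cod_hcomp _ _ (by simp)]; simp [shuf_eq]
  lam_is := by
    constructor
    · have e := J₁ (z := P.m) (w := Q.m) (x := P.u) (y := Q.u) (c := M.id₁ P.A) (d := M.id₁ Q.A)
        (r := M.id₁ (M.I ⊗₀ M.I)) (s := M.id₁ (P.A ⊗₀ Q.A)) (A := P.A) (B := Q.A) (C := P.A)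
        (D := Q.A) (X := M.I) (Y := M.I) (C' := P.A) (D' := Q.A)
        (by simp) (by simp) (by simp [Is₁])
        (by simp [Is₁]) (by simp [Is₁]) (by simp [Is₁]) (by simp) (by simp)
      rw [M.tensor_id₁, M.id₁_comp' (by simp), mid_unit_left, comp_id₁' (by simp)] at e
      rw [e]; simp 
    · simp
  rho_is := by
    constructor
    · have e := J₁ (z := P.m) (w := Q.m) (c := P.u) (d := Q.u) (x := M.id₁ P.A) (y := M.id₁ Q.A)
        (s := M.id₁ (M.I ⊗₀ M.I)) (r := M.id₁ (P.A ⊗₀ Q.A)) (A := P.A) (B := Q.A) (C := P.A)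
        (D := Q.A) (X := P.A) (Y := Q.A) (C' := M.I) (D' := M.I)
        (by simp) (by simp) (by simp [Is₁])
        (by simp [Is₁]) (by simp [Is₁]) (by simp [Is₁]) (by simp) (by simp)
      rw [M.tensor_id₁, M.id₁_comp' (by simp), mid_unit_right, comp_id₁' (by simp)] at e
      rw [e]; simp 
    · simp
  α_inv := SymStrictMonTwoCat.IsInv.whisker (SymStrictMonTwoCat.IsInv.tensor P.α_inv Q.α_inv) (by simp)
  lam_inv := SymStrictMonTwoCat.IsInv.tensor P.lam_inv Q.lam_inv
  rho_inv := SymStrictMonTwoCat.IsInv.tensor P.rho_inv Q.rho_inv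
  pentagon := by
    have t1 := J₃ (z := P.α) (w := Q.α) (A := P.A) (B := Q.A) (A' := P.A) (B' := Q.A)
      (A'' := P.A) (B'' := Q.A) (x := M.id₂ (M.id₁ P.A)) (y := M.id₂ (M.id₁ Q.A))
      (x' := M.id₂ (M.id₁ P.A)) (y' := M.id₂ (M.id₁ Q.A)) (x'' := M.id₂ P.m) (y'' := M.id₂ Q.m)
      (r := M.id₁ (P.A ⊗₀ Q.A)) (r' := M.id₁ (P.A ⊗₀ Q.A)) (r'' := M.mid P.A Q.A P.A Q.A)
      (X := P.A) (Y := Q.A) (X' := P.A) (Y' := Q.A) (X'' := P.A ⊗₀ P.A) (Y'' := Q.A ⊗₀ Q.A)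
      (by simp) (by simp) (by simp [Is₁]) (by simp [Is₁]) (by simp [Is₁]) (by simp [Is₁])
      (by simp [Is₁]) (by simp [Is₁]) (by simp) (by simp) (by simp)
    have t2 := J₃ (z := P.α) (w := Q.α) (A := P.A) (B := Q.A) (A' := P.A) (B' := Q.A)
      (A'' := P.A) (B'' := Q.A) (x'' := M.id₂ (M.id₁ P.A)) (y'' := M.id₂ (M.id₁ Q.A))
      (x' := M.id₂ (M.id₁ P.A)) (y' := M.id₂ (M.id₁ Q.A)) (x := M.id₂ P.m) (y := M.id₂ Q.m)
      (r'' := M.id₁ (P.A ⊗₀ Q.A)) (r' := M.id₁ (P.A ⊗₀ Q.A)) (r := M.mid P.A Q.A P.A Q.A)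
      (X'' := P.A) (Y'' := Q.A) (X' := P.A) (Y' := Q.A) (X := P.A ⊗₀ P.A) (Y := Q.A ⊗₀ Q.A)
      (by simp) (by simp) (by simp [Is₁]) (by simp [Is₁]) (by simp [Is₁]) (by simp [Is₁])
      (by simp [Is₁]) (by simp [Is₁]) (by simp) (by simp) (by simp)
    have t4 := J₃ (z := P.α) (w := Q.α) (A := P.A) (B := Q.A) (A' := P.A) (B' := Q.A)
      (A'' := P.A) (B'' := Q.A) (x'' := M.id₂ (M.id₁ P.A)) (y'' := M.id₂ (M.id₁ Q.A))
      (x := M.id₂ (M.id₁ P.A)) (y := M.id₂ (M.id₁ Q.A)) (x' := M.id₂ P.m) (y' := M.id₂ Q.m)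
      (r'' := M.id₁ (P.A ⊗₀ Q.A)) (r := M.id₁ (P.A ⊗₀ Q.A)) (r' := M.mid P.A Q.A P.A Q.A)
      (X'' := P.A) (Y'' := Q.A) (X := P.A) (Y := Q.A) (X' := P.A ⊗₀ P.A) (Y' := Q.A ⊗₀ Q.A)
      (by simp) (by simp) (by simp [Is₁]) (by simp [Is₁]) (by simp [Is₁]) (by simp [Is₁])
      (by simp [Is₁]) (by simp [Is₁]) (by simp) (by simp) (by simp)
    have t3 := J₂ (z := M.id₂ P.m) (w := M.id₂ Q.m) (A := P.A) (B := Q.A) (C := P.A) (D := Q.A)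
      (x := M.id₂ (M.id₁ P.A)) (y := M.id₂ (M.id₁ Q.A)) (c := P.α) (d := Q.α)
      (r := M.id₁ (P.A ⊗₀ Q.A)) (s := M.shuf P.A Q.A P.A Q.A P.A Q.A)
      (X := P.A) (Y := Q.A) (C' := P.A ⊗₀ P.A ⊗₀ P.A) (D' := Q.A ⊗₀ Q.A ⊗₀ Q.A)
      (by simp) (by simp) (by simp [Is₁]) (by simp [Is₁]) (by simp [Is₁]) (by simp [Is₁])
      (by simp) (by simp)
    have t5 := J₂ (z := M.id₂ P.m) (w := M.id₂ Q.m) (A := P.A) (B := Q.A) (C := P.A) (D := Q.A)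
      (c := M.id₂ (M.id₁ P.A)) (d := M.id₂ (M.id₁ Q.A)) (x := P.α) (y := Q.α)
      (s := M.id₁ (P.A ⊗₀ Q.A)) (r := M.shuf P.A Q.A P.A Q.A P.A Q.A)
      (C' := P.A) (D' := Q.A) (X := P.A ⊗₀ P.A ⊗₀ P.A) (Y := Q.A ⊗₀ Q.A ⊗₀ Q.A)
      (by simp) (by simp) (by simp [Is₁]) (by simp [Is₁]) (by simp [Is₁]) (by simp [Is₁])
      (by simp) (by simp)
    rw [c_right, M.tensor_id₂, M.tensor_id₁, M.tensor_id₂, id₂_comp _ _ _ (by simp),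
      id₂_comp _ _ _ (by simp), id₁_comp' (by simp)] at t1
    rw [c_left, M.tensor_id₂, M.tensor_id₂, M.tensor_id₁, id₂_comp _ _ _ (by simp),
      id₂_comp _ _ _ (by simp), id₁_comp' (by simp)] at t2
    rw [c_mid, M.tensor_id₂, M.tensor_id₂, M.tensor_id₁, id₂_comp _ _ _ (by simp),
      id₂_comp _ _ _ (by simp), id₁_comp' (by simp)] at t4
    rw [M.tensor_id₂, M.tensor_id₂, M.tensor_id₁, id₂_comp _ _ _ (by simp),
      id₂_comp _ _ _ (by simp), id₁_comp' (by simp)] at t3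
    rw [c_outer, M.tensor_id₂, M.tensor_id₂, M.tensor_id₁, id₂_comp _ _ _ (by simp),
      id₂_comp _ _ _ (by simp), id₁_comp' (by simp)] at t5
    simp only [M.tensor_id₂] at t1 t2 t3 t4 t5 ⊢
    rw [t1, t2, t4, t5]
    erw [t3]
    rw [← shuf₄, Jv, Jv, Jv, P.pentagon, Q.pentagon] <;> simp (maxDischargeDepth := 9)
  triangle := by
    have t1 := J₂ (z := M.id₂ P.m) (w := M.id₂ Q.m) (A := P.A) (B := Q.A) (C := P.A) (D := Q.A)
      (x := M.id₂ (M.id₁ P.A)) (y := M.id₂ (M.id₁ Q.A)) (c := P.lam) (d := Q.lam)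
      (r := M.id₁ (P.A ⊗₀ Q.A)) (s := M.id₁ (P.A ⊗₀ Q.A))
      (X := P.A) (Y := Q.A) (C' := P.A) (D' := Q.A)
      (by simp) (by simp) (by simp [Is₁]) (by simp [Is₁]) (by simp [Is₁]) (by simp [Is₁])
      (by simp) (by simp)
    have t3 := J₂ (z := M.id₂ P.m) (w := M.id₂ Q.m) (A := P.A) (B := Q.A) (C := P.A) (D := Q.A)
      (x := P.rho) (y := Q.rho) (c := M.id₂ (M.id₁ P.A)) (d := M.id₂ (M.id₁ Q.A))
      (r := M.id₁ (P.A ⊗₀ Q.A)) (s := M.id₁ (P.A ⊗₀ Q.A))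
      (X := P.A) (Y := Q.A) (C' := P.A) (D' := Q.A)
      (by simp) (by simp) (by simp [Is₁]) (by simp [Is₁]) (by simp [Is₁]) (by simp [Is₁])
      (by simp) (by simp)
    have t2 := J₃ (z := P.α) (w := Q.α) (A := P.A) (B := Q.A) (A' := P.A) (B' := Q.A)
      (A'' := P.A) (B'' := Q.A) (x'' := M.id₂ (M.id₁ P.A)) (y'' := M.id₂ (M.id₁ Q.A))
      (x := M.id₂ (M.id₁ P.A)) (y := M.id₂ (M.id₁ Q.A)) (x' := M.id₂ P.u) (y' := M.id₂ Q.u)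
      (r'' := M.id₁ (P.A ⊗₀ Q.A)) (r := M.id₁ (P.A ⊗₀ Q.A)) (r' := M.id₁ (M.I ⊗₀ M.I))
      (X'' := P.A) (Y'' := Q.A) (X := P.A) (Y := Q.A) (X' := M.I) (Y' := M.I)
      (by simp) (by simp) (by simp [Is₁]) (by simp [Is₁]) (by simp [Is₁]) (by simp [Is₁])
      (by simp [Is₁]) (by simp [Is₁]) (by simp) (by simp) (by simp)
    have hs : M.shuf P.A Q.A M.I M.I P.A Q.A = M.mid P.A Q.A P.A Q.A := by
      simp [shuf, mid_unit_right]
    simp only [M.tensor_id₂, M.tensor_id₁] at t1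
    rw [id₂_comp _ _ _ (by simp), id₂_hcomp' (by simp), hcomp_id₂' (by simp),
      comp_id₁' (by simp)] at t1
    simp only [M.tensor_id₂, M.tensor_id₁] at t3
    rw [id₂_comp _ _ _ (by simp), id₂_hcomp' (by simp), hcomp_id₂' (by simp),
      comp_id₁' (by simp)] at t3
    simp only [hs, M.tensor_id₂, M.tensor_id₁] at t2
    rw [id₂_comp _ _ _ (by simp), id₂_comp _ _ _ (by simp),
      id₁_comp' (by simp), comp_id₁' (by simp), comp_id₁' (by simp)] at t2
    simp only [M.tensor_id₂] at t1 t2 t3 ⊢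
    rw [t2]
    erw [t1, t3]
    rw [Jv, P.triangle, Q.triangle] <;> simp (maxDischargeDepth := 9)
end StrictMonTwoCat

namespace StrictMonTwoCat
open TwoCat SymStrictMonTwoCat

/-- The product of opmonoidal 1-cells. -/
def OpmonOne.tensor {M : SymStrictMonTwoCat.{u}}
    (F G : OpmonOne M.toStrictMonTwoCat) : OpmonOne M.toStrictMonTwoCat where
  src := F.src.tensor G.src
  tgt := F.tgt.tensor G.tgt
  f := F.f ⊗₁ G.f
  φ₂ := (F.φ₂ ⊗₂ G.φ₂) ∘ₕ M.id₂ (M.mid F.src.A G.src.A F.src.A G.src.A)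
  φ₀ := F.φ₀ ⊗₂ G.φ₀
  f_is := by simp [Is₁, Pseudomonoid.tensor]
  φ₂_is := by
    constructor
    · rw [M.dom_hcomp _ _ (by simp)]
      simp [Pseudomonoid.tensor, ← M.comp_assoc]
    · have e := J₁ (z := F.tgt.m) (w := G.tgt.m) (x := F.f) (y := G.f) (c := F.f) (d := G.f)
        (r := M.id₁ (F.src.A ⊗₀ G.src.A)) (s := M.id₁ (F.src.A ⊗₀ G.src.A))
        (A := F.tgt.A) (B := G.tgt.A) (C := F.tgt.A) (D := G.tgt.A)
        (X := F.src.A) (Y := G.src.A) (C' := F.src.A) (D' := G.src.A)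
        (by simp) (by simp) (by simp [Is₁])
        (by simp [Is₁]) (by simp [Is₁]) (by simp [Is₁]) (by simp) (by simp)
      rw [comp_id₁' (by simp), M.tensor_id₁, comp_id₁' (by simp)] at e
      rw [M.cod_hcomp _ _ (by simp)]
      simp only [Pseudomonoid.tensor]
      erw [e]; simp
  φ₀_is := by
    constructor
    · simp [Pseudomonoid.tensor]
    · simp [Pseudomonoid.tensor]
  coassoc := by
    have s1 := J₃ (z := F.tgt.α) (w := G.tgt.α) (A := F.tgt.A) (B := G.tgt.A) (A' := F.tgt.A)
      (B' := G.tgt.A) (A'' := F.tgt.A) (B'' := G.tgt.A) (x := M.id₂ F.f) (y := M.id₂ G.f)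
      (x' := M.id₂ F.f) (y' := M.id₂ G.f) (x'' := M.id₂ F.f) (y'' := M.id₂ G.f)
      (r := M.id₁ (F.src.A ⊗₀ G.src.A)) (r' := M.id₁ (F.src.A ⊗₀ G.src.A))
      (r'' := M.id₁ (F.src.A ⊗₀ G.src.A))
      (X := F.src.A) (Y := G.src.A) (X' := F.src.A) (Y' := G.src.A) (X'' := F.src.A)
      (Y'' := G.src.A)
      (by simp) (by simp) (by simp [Is₁]) (by simp [Is₁]) (by simp [Is₁]) (by simp [Is₁])
      (by simp [Is₁]) (by simp [Is₁]) (by simp) (by simp) (by simp)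
    have s2 := J₂ (z := M.id₂ F.tgt.m) (w := M.id₂ G.tgt.m) (A := F.tgt.A) (B := G.tgt.A)
      (C := F.tgt.A) (D := G.tgt.A) (x := F.φ₂) (y := G.φ₂) (c := M.id₂ F.f) (d := M.id₂ G.f)
      (r := M.mid F.src.A G.src.A F.src.A G.src.A) (s := M.id₁ (F.src.A ⊗₀ G.src.A))
      (X := F.src.A ⊗₀ F.src.A) (Y := G.src.A ⊗₀ G.src.A) (C' := F.src.A) (D' := G.src.A)
      (by simp) (by simp) (by simp [Is₁]) (by simp [Is₁]) (by simp [Is₁]) (by simp [Is₁])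
      (by simp) (by simp)
    have s3 := J₂ (z := F.φ₂) (w := G.φ₂) (A := F.src.A) (B := G.src.A)
      (C := F.src.A) (D := G.src.A) (x := M.id₂ F.src.m) (y := M.id₂ G.src.m)
      (c := M.id₂ (M.id₁ F.src.A)) (d := M.id₂ (M.id₁ G.src.A))
      (r := M.mid F.src.A G.src.A F.src.A G.src.A) (s := M.id₁ (F.src.A ⊗₀ G.src.A))
      (X := F.src.A ⊗₀ F.src.A) (Y := G.src.A ⊗₀ G.src.A) (C' := F.src.A) (D' := G.src.A)
      (by simp) (by simp) (by simp [Is₁]) (by simp [Is₁]) (by simp [Is₁]) (by simp [Is₁])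
      (by simp) (by simp)
    have s4 := J₂ (z := M.id₂ F.tgt.m) (w := M.id₂ G.tgt.m) (A := F.tgt.A) (B := G.tgt.A)
      (C := F.tgt.A) (D := G.tgt.A) (c := F.φ₂) (d := G.φ₂) (x := M.id₂ F.f) (y := M.id₂ G.f)
      (s := M.mid F.src.A G.src.A F.src.A G.src.A) (r := M.id₁ (F.src.A ⊗₀ G.src.A))
      (C' := F.src.A ⊗₀ F.src.A) (D' := G.src.A ⊗₀ G.src.A) (X := F.src.A) (Y := G.src.A)
      (by simp) (by simp) (by simp [Is₁]) (by simp [Is₁]) (by simp [Is₁]) (by simp [Is₁])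
      (by simp) (by simp)
    have s5 := J₂ (z := F.φ₂) (w := G.φ₂) (A := F.src.A) (B := G.src.A)
      (C := F.src.A) (D := G.src.A) (c := M.id₂ F.src.m) (d := M.id₂ G.src.m)
      (x := M.id₂ (M.id₁ F.src.A)) (y := M.id₂ (M.id₁ G.src.A))
      (s := M.mid F.src.A G.src.A F.src.A G.src.A) (r := M.id₁ (F.src.A ⊗₀ G.src.A))
      (C' := F.src.A ⊗₀ F.src.A) (D' := G.src.A ⊗₀ G.src.A) (X := F.src.A) (Y := G.src.A)
      (by simp) (by simp) (by simp [Is₁]) (by simp [Is₁]) (by simp [Is₁]) (by simp [Is₁])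
      (by simp) (by simp)
    have s6 : M.id₂ (F.f ⊗₁ G.f) ∘ₕ ((F.src.α ⊗₂ G.src.α) ∘ₕ M.id₂ (M.shuf F.src.A G.src.A
        F.src.A G.src.A F.src.A G.src.A)) = ((M.id₂ F.f ∘ₕ F.src.α) ⊗₂ (M.id₂ G.f ∘ₕ G.src.α)) ∘ₕ
        M.id₂ (M.shuf F.src.A G.src.A F.src.A G.src.A F.src.A G.src.A) := by
      rw [M.tensor_hcomp, M.tensor_id₂, M.hcomp_assoc] <;> simp
    have hs := M.shuf_eq F.src.A G.src.A F.src.A G.src.A F.src.A G.src.A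
    simp only [M.tensor_id₂, M.tensor_id₁] at s1 s2 s3 s4 s5
    rw [id₂_comp _ _ _ (by simp), comp_id₁' (by simp), comp_id₁' (by simp)] at s1
    rw [id₂_comp _ _ _ (by simp), id₂_comp _ _ _ (by simp), comp_id₁' (by simp), ← shuf] at s2 
    rw [id₂_comp _ _ _ (by simp), id₂_comp _ _ _ (by simp), comp_id₁' (by simp), ← shuf] at s3
    rw [id₂_comp _ _ _ (by simp), id₂_comp _ _ _ (by simp), comp_id₁' (by simp), ← hs] at s4
    rw [id₂_comp _ _ _ (by simp), id₂_comp _ _ _ (by simp), comp_id₁' (by simp), ← hs] at s5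
    simp only [M.tensor_id₂] at s1 s3 s5
    simp only [Pseudomonoid.tensor]
    erw [s1, s2, s3, s4, s5, s6]
    rw [Jv, Jv, Jv, Jv, F.coassoc, G.coassoc] <;> simp (maxDischargeDepth := 9)
  counit_left := by
    have s1 : (F.tgt.lam ⊗₂ G.tgt.lam) ∘ₕ M.id₂ (F.f ⊗₁ G.f) =
        ((F.tgt.lam ∘ₕ M.id₂ F.f) ⊗₂ (G.tgt.lam ∘ₕ M.id₂ G.f)) := by
      rw [M.tensor_hcomp, M.tensor_id₂] <;> simp
    have s2 := J₂ (z := M.id₂ F.tgt.m) (w := M.id₂ G.tgt.m) (A := F.tgt.A) (B := G.tgt.A)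
      (C := F.tgt.A) (D := G.tgt.A) (x := F.φ₀) (y := G.φ₀) (c := M.id₂ F.f) (d := M.id₂ G.f)
      (r := M.id₁ (M.I ⊗₀ M.I)) (s := M.id₁ (F.src.A ⊗₀ G.src.A))
      (X := M.I) (Y := M.I) (C' := F.src.A) (D' := G.src.A)
      (by simp) (by simp) (by simp [Is₁]) (by simp [Is₁]) (by simp [Is₁]) (by simp [Is₁])
      (by simp) (by simp)
    have s3 := J₂ (z := F.φ₂) (w := G.φ₂) (A := F.src.A) (B := G.src.A)
      (C := F.src.A) (D := G.src.A) (x := M.id₂ F.src.u) (y := M.id₂ G.src.u)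
      (c := M.id₂ (M.id₁ F.src.A)) (d := M.id₂ (M.id₁ G.src.A))
      (r := M.id₁ (M.I ⊗₀ M.I)) (s := M.id₁ (F.src.A ⊗₀ G.src.A))
      (X := M.I) (Y := M.I) (C' := F.src.A) (D' := G.src.A)
      (by simp) (by simp) (by simp [Is₁]) (by simp [Is₁]) (by simp [Is₁]) (by simp [Is₁])
      (by simp) (by simp)
    have s6 : M.id₂ (F.f ⊗₁ G.f) ∘ₕ (F.src.lam ⊗₂ G.src.lam) =
        ((M.id₂ F.f ∘ₕ F.src.lam) ⊗₂ (M.id₂ G.f ∘ₕ G.src.lam)) := by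
      rw [M.tensor_hcomp, M.tensor_id₂] <;> simp
    simp only [M.tensor_id₂, M.tensor_id₁, mid_unit_left] at s2 s3
    rw [id₂_comp _ _ _ (by simp), id₂_comp _ _ _ (by simp), comp_id₁' (by simp),
      comp_id₁' (by simp), hcomp_id₂' (by simp), hcomp_id₂' (by simp)] at s2
    rw [id₂_comp _ _ _ (by simp), id₂_comp _ _ _ (by simp), comp_id₁' (by simp),
      comp_id₁' (by simp), comp_id₁' (by simp), hcomp_id₂' (by simp)] at s3
    simp only [M.tensor_id₂] at s3
    simp only [Pseudomonoid.tensor]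
    erw [s1, s2, s3, s6]
    rw [← M.tensor_vcomp, ← M.tensor_vcomp, F.counit_left, G.counit_left] <;> simp (maxDischargeDepth := 9)
  counit_right := by
    have s1 : (F.tgt.rho ⊗₂ G.tgt.rho) ∘ₕ M.id₂ (F.f ⊗₁ G.f) =
        ((F.tgt.rho ∘ₕ M.id₂ F.f) ⊗₂ (G.tgt.rho ∘ₕ M.id₂ G.f)) := by
      rw [M.tensor_hcomp, M.tensor_id₂] <;> simp
    have s2 := J₂ (z := M.id₂ F.tgt.m) (w := M.id₂ G.tgt.m) (A := F.tgt.A) (B := G.tgt.A)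
      (C := F.tgt.A) (D := G.tgt.A) (c := F.φ₀) (d := G.φ₀) (x := M.id₂ F.f) (y := M.id₂ G.f)
      (s := M.id₁ (M.I ⊗₀ M.I)) (r := M.id₁ (F.src.A ⊗₀ G.src.A))
      (C' := M.I) (D' := M.I) (X := F.src.A) (Y := G.src.A)
      (by simp) (by simp) (by simp [Is₁]) (by simp [Is₁]) (by simp [Is₁]) (by simp [Is₁])
      (by simp) (by simp)
    have s3 := J₂ (z := F.φ₂) (w := G.φ₂) (A := F.src.A) (B := G.src.A)
      (C := F.src.A) (D := G.src.A) (c := M.id₂ F.src.u) (d := M.id₂ G.src.u)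
      (x := M.id₂ (M.id₁ F.src.A)) (y := M.id₂ (M.id₁ G.src.A))
      (s := M.id₁ (M.I ⊗₀ M.I)) (r := M.id₁ (F.src.A ⊗₀ G.src.A))
      (C' := M.I) (D' := M.I) (X := F.src.A) (Y := G.src.A)
      (by simp) (by simp) (by simp [Is₁]) (by simp [Is₁]) (by simp [Is₁]) (by simp [Is₁])
      (by simp) (by simp)
    have s6 : M.id₂ (F.f ⊗₁ G.f) ∘ₕ (F.src.rho ⊗₂ G.src.rho) =
        ((M.id₂ F.f ∘ₕ F.src.rho) ⊗₂ (M.id₂ G.f ∘ₕ G.src.rho)) := by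
      rw [M.tensor_hcomp, M.tensor_id₂] <;> simp
    simp only [M.tensor_id₂, M.tensor_id₁, mid_unit_right] at s2 s3
    rw [id₂_comp _ _ _ (by simp), id₂_comp _ _ _ (by simp), comp_id₁' (by simp),
      comp_id₁' (by simp), hcomp_id₂' (by simp), hcomp_id₂' (by simp)] at s2
    rw [id₂_comp _ _ _ (by simp), id₂_comp _ _ _ (by simp), comp_id₁' (by simp),
      comp_id₁' (by simp), comp_id₁' (by simp), hcomp_id₂' (by simp)] at s3
    simp only [M.tensor_id₂] at s3
    simp only [Pseudomonoid.tensor]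
    erw [s1, s2, s3, s6]
    rw [← M.tensor_vcomp, ← M.tensor_vcomp, F.counit_right, G.counit_right] <;> simp (maxDischargeDepth := 9)
end StrictMonTwoCat

namespace SymStrictMonTwoCat
open TwoCat StrictMonTwoCat
section
variable {M : SymStrictMonTwoCat.{u}}
@[simp] theorem mid_unit_odd (A B : M.Obj) : M.mid M.I A M.I B = M.id₁ (A ⊗₀ B) := by
  simp [mid, σ_unit_right]
@[simp] theorem mid_unit_even (A B : M.Obj) : M.mid A M.I B M.I = M.id₁ (A ⊗₀ B) := by
  simp [mid, σ_unit_left]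
end
section
variable {M : SymStrictMonTwoCat.{u}} (A B C A' B' C' A'' B'' C'' : M.Obj)

theorem σ_mid : M.σ (A ⊗₀ A') (B ⊗₀ B') ∘₁ M.mid A B A' B' =
    M.mid B A B' A' ∘₁ (M.σ A B ⊗₁ M.σ A' B') := by
  have h1 : M.σ (A ⊗₀ A') (B ⊗₀ B') =
      (M.id₁ B ⊗₁ M.σ (A ⊗₀ A') B') ∘₁ (M.σ (A ⊗₀ A') B ⊗₁ M.id₁ B') := M.σ_hexagon _ _ _
  have h2 : M.σ (A ⊗₀ A') B ⊗₁ M.id₁ B' =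
      (M.σ A B ⊗₁ M.id₁ (A' ⊗₀ B')) ∘₁ (M.id₁ A ⊗₁ M.σ A' B ⊗₁ M.id₁ B') := by
    rw [σ_hexagon', wR₁ _ (by simp)]; simp only [M.assoc₁, M.tensor_id₁]
  have h3 : (M.id₁ A ⊗₁ M.σ A' B ⊗₁ M.id₁ B') ∘₁ M.mid A B A' B' =
      M.id₁ (A ⊗₀ B ⊗₀ A' ⊗₀ B') := by
    rw [mid, ← wL₁ _ (by simp), ← wR₁ _ (by simp), M.σ_σ]; simp
  have h4 : M.id₁ B ⊗₁ M.σ (A ⊗₀ A') B' =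
      M.mid B A B' A' ∘₁ (M.id₁ (B ⊗₀ A) ⊗₁ M.σ A' B') := by
    rw [σ_hexagon', wL₁ _ (by simp)]; simp only [id₁_tensor_assoc, mid]
  have h5 : (M.id₁ (B ⊗₀ A) ⊗₁ M.σ A' B') ∘₁ (M.σ A B ⊗₁ M.id₁ (A' ⊗₀ B')) =
      M.σ A B ⊗₁ M.σ A' B' := by rw [merge] <;> simp
  rw [h1, h2, M.comp_assoc, M.comp_assoc, h3, h4, comp_id₁', M.comp_assoc, h5] <;> simp

theorem σ_shuf : M.σ (A ⊗₀ A' ⊗₀ A'') (B ⊗₀ B' ⊗₀ B'') ∘₁ M.shuf A B A' B' A'' B'' =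
    M.shuf B A B' A' B'' A'' ∘₁ (M.σ A B ⊗₁ M.σ A' B' ⊗₁ M.σ A'' B'') := by
  have h1 := σ_mid (A ⊗₀ A') (B ⊗₀ B') A'' B''
  have h2 := σ_mid A B A' B'
  simp only [M.assoc₀] at h1
  rw [shuf, ← M.comp_assoc, h1, M.comp_assoc, ← M.tensor_comp, h2, shuf, M.comp_assoc,
    ← M.assoc₁, ← M.tensor_comp, id₁_comp', comp_id₁'] <;> simp

theorem shuf_shuf :
    (M.shuf A B A' B' A'' B'' ⊗₁ M.id₁ (C ⊗₀ C' ⊗₀ C'')) ∘₁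
        M.shuf (A ⊗₀ B) C (A' ⊗₀ B') C' (A'' ⊗₀ B'') C'' =
      (M.id₁ (A ⊗₀ A' ⊗₀ A'') ⊗₁ M.shuf B C B' C' B'' C'') ∘₁
        M.shuf A (B ⊗₀ C) A' (B' ⊗₀ C') A'' (B'' ⊗₀ C'') := by
  have n1 := mid_nat₁ (x := M.mid A B A' B') (y := M.id₁ (C ⊗₀ C')) (c := M.id₁ (A'' ⊗₀ B''))
    (d := M.id₁ C'') ⟨rfl, rfl⟩ ⟨rfl, rfl⟩ ⟨rfl, rfl⟩ ⟨rfl, rfl⟩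
  have n2 := mid_nat₁ (x := M.id₁ (A ⊗₀ A')) (y := M.mid B C B' C') (c := M.id₁ A'')
    (d := M.id₁ (B'' ⊗₀ C'')) ⟨rfl, rfl⟩ ⟨rfl, rfl⟩ ⟨rfl, rfl⟩ ⟨rfl, rfl⟩
  have m1 := mid_mid (A ⊗₀ A') (B ⊗₀ B') (C ⊗₀ C') A'' B'' C''
  have m2 := mid_mid A B C A' B' C'
  simp only [src_mid, tgt_mid, M.src_id₁, M.tgt_id₁, M.tensor_id₁, M.assoc₀] at n1 n2 m1
  have m2' : (M.mid A B A' B' ⊗₁ M.id₁ (C ⊗₀ C' ⊗₀ A'' ⊗₀ B'' ⊗₀ C'')) ∘₁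
      (M.mid (A ⊗₀ B) C (A' ⊗₀ B') C' ⊗₁ M.id₁ (A'' ⊗₀ B'' ⊗₀ C'')) =
      (M.id₁ (A ⊗₀ A') ⊗₁ M.mid B C B' C' ⊗₁ M.id₁ (A'' ⊗₀ B'' ⊗₀ C'')) ∘₁
      (M.mid A (B ⊗₀ C) A' (B' ⊗₀ C') ⊗₁ M.id₁ (A'' ⊗₀ B'' ⊗₀ C'')) := by
    have := congrArg (fun f => f ⊗₁ M.id₁ (A'' ⊗₀ B'' ⊗₀ C'')) m2
    simp only [wR₁ _ (show M.tgt (M.mid (A ⊗₀ B) C (A' ⊗₀ B') C') =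
      M.src (M.mid A B A' B' ⊗₁ M.id₁ (C ⊗₀ C')) by simp),
      wR₁ _ (show M.tgt (M.mid A (B ⊗₀ C) A' (B' ⊗₀ C')) =
      M.src (M.id₁ (A ⊗₀ A') ⊗₁ M.mid B C B' C') by simp), M.assoc₁, M.tensor_id₁, M.assoc₀] at this
    exact this
  calc _ = (M.mid (A ⊗₀ A') (B ⊗₀ B') A'' B'' ⊗₁ M.id₁ (C ⊗₀ C' ⊗₀ C'')) ∘₁
        ((M.mid A B A' B' ⊗₁ M.id₁ (A'' ⊗₀ B'' ⊗₀ C ⊗₀ C' ⊗₀ C'')) ∘₁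
        M.mid (A ⊗₀ B ⊗₀ A' ⊗₀ B') (C ⊗₀ C') (A'' ⊗₀ B'') C'') ∘₁
        (M.mid (A ⊗₀ B) C (A' ⊗₀ B') C' ⊗₁ M.id₁ (A'' ⊗₀ B'' ⊗₀ C'')) := by
        rw [shuf, shuf, wR₁ _ (by simp), M.comp_assoc, M.comp_assoc, M.assoc₁, M.tensor_id₁]
        · simp only [M.assoc₀]
        all_goals simp
    _ = ((M.id₁ (A ⊗₀ A' ⊗₀ A'') ⊗₁ M.mid (B ⊗₀ B') (C ⊗₀ C') B'' C'') ∘₁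
        M.mid (A ⊗₀ A') (B ⊗₀ B' ⊗₀ C ⊗₀ C') A'' (B'' ⊗₀ C'')) ∘₁
        ((M.id₁ (A ⊗₀ A') ⊗₁ M.mid B C B' C' ⊗₁ M.id₁ (A'' ⊗₀ B'' ⊗₀ C'')) ∘₁
        (M.mid A (B ⊗₀ C) A' (B' ⊗₀ C') ⊗₁ M.id₁ (A'' ⊗₀ B'' ⊗₀ C''))) := by
        rw [← n1, ← m2', ← m1]
        rw [M.comp_assoc, M.comp_assoc] <;> simp
    _ = (M.id₁ (A ⊗₀ A' ⊗₀ A'') ⊗₁ M.mid (B ⊗₀ B') (C ⊗₀ C') B'' C'') ∘₁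
        ((M.id₁ (A ⊗₀ A' ⊗₀ A'') ⊗₁ M.mid B C B' C' ⊗₁ M.id₁ (B'' ⊗₀ C'')) ∘₁
        M.mid (A ⊗₀ A') (B ⊗₀ C ⊗₀ B' ⊗₀ C') A'' (B'' ⊗₀ C'')) ∘₁
        (M.mid A (B ⊗₀ C) A' (B' ⊗₀ C') ⊗₁ M.id₁ (A'' ⊗₀ B'' ⊗₀ C'')) := by
        simp only [id₁_tensor_assoc, M.assoc₀] at n2
        rw [← n2, M.comp_assoc, M.comp_assoc] <;> simp
    _ = _ := by
        rw [shuf, shuf, wL₁ _ (by simp), M.comp_assoc, M.comp_assoc]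
        · simp only [M.assoc₀]
        all_goals simp

variable {A B C}
theorem K₁ {x y z p q p' q' : M.One} (h : (p ⊗₁ M.id₁ (M.src z)) ∘₁ q = (M.id₁ (M.src x) ⊗₁ p') ∘₁ q')
    (hp : M.tgt p = M.src x ⊗₀ M.src y) (hp' : M.tgt p' = M.src y ⊗₀ M.src z)
    (hq : M.tgt q = M.src p ⊗₀ M.src z) (hq' : M.tgt q' = M.src x ⊗₀ M.src p') :
    (((x ⊗₁ y) ∘₁ p) ⊗₁ z) ∘₁ q = (x ⊗₁ ((y ⊗₁ z) ∘₁ p')) ∘₁ q' := by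
  have h1 : ((x ⊗₁ y) ∘₁ p) ⊗₁ z = (x ⊗₁ y ⊗₁ z) ∘₁ (p ⊗₁ M.id₁ (M.src z)) := by
    rw [← M.assoc₁, ← M.tensor_comp, comp_id₁'] <;> simp [*]
  have h2 : x ⊗₁ ((y ⊗₁ z) ∘₁ p') = (x ⊗₁ y ⊗₁ z) ∘₁ (M.id₁ (M.src x) ⊗₁ p') := by
    rw [← M.tensor_comp, comp_id₁'] <;> simp [*]
  rw [h1, h2, M.comp_assoc, h, M.comp_assoc] <;> simp [*]
theorem K₂ {x y z : M.Two} {p q p' q' : M.One} (hx : M.src (M.cod x) = A)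
    (hy : M.src (M.cod y) = B) (hz : M.src (M.cod z) = C)
    (h : (p ⊗₁ M.id₁ C) ∘₁ q = (M.id₁ A ⊗₁ p') ∘₁ q')
    (hp : M.tgt p = A ⊗₀ B) (hp' : M.tgt p' = B ⊗₀ C)
    (hq : M.tgt q = M.src p ⊗₀ C) (hq' : M.tgt q' = A ⊗₀ M.src p') :
    (((x ⊗₂ y) ∘ₕ M.id₂ p) ⊗₂ z) ∘ₕ M.id₂ q =
      (x ⊗₂ ((y ⊗₂ z) ∘ₕ M.id₂ p')) ∘ₕ M.id₂ q' := by
  have h1 : ((x ⊗₂ y) ∘ₕ M.id₂ p) ⊗₂ z = (x ⊗₂ y ⊗₂ z) ∘ₕ M.id₂ (p ⊗₁ M.id₁ C) := by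
    rw [← M.tensor_id₂, ← M.assoc₂, ← M.tensor_hcomp, hcomp_id₂'] <;> simp [*]
  have h2 : x ⊗₂ ((y ⊗₂ z) ∘ₕ M.id₂ p') = (x ⊗₂ y ⊗₂ z) ∘ₕ M.id₂ (M.id₁ A ⊗₁ p') := by
    rw [← M.tensor_id₂, ← M.tensor_hcomp, hcomp_id₂'] <;> simp [*]
  rw [h1, h2, M.hcomp_assoc, M.id₂_comp, h, M.hcomp_assoc, M.id₂_comp] <;> simp [*]
end
end SymStrictMonTwoCat

namespace StrictMonTwoCat
open TwoCat SymStrictMonTwoCat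

/-- The monoidal unit, as a pseudomonoid. -/
def Pseudomonoid.unit (M : StrictMonTwoCat.{u}) : Pseudomonoid M where
  A := M.I
  m := M.id₁ M.I
  u := M.id₁ M.I
  α := M.id₂ (M.id₁ M.I)
  lam := M.id₂ (M.id₁ M.I)
  rho := M.id₂ (M.id₁ M.I)
  m_is := by simp [Is₁]
  u_is := by simp [Is₁]
  α_is := by simp [Is₂]
  lam_is := by simp [Is₂]
  rho_is := by simp [Is₂]
  α_inv := ⟨M.id₂ (M.id₁ M.I), by simp [Is₂]⟩
  lam_inv := ⟨M.id₂ (M.id₁ M.I), by simp [Is₂]⟩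
  rho_inv := ⟨M.id₂ (M.id₁ M.I), by simp [Is₂]⟩
  pentagon := by simp
  triangle := by simp

variable {M : SymStrictMonTwoCat.{u}}

theorem Pseudomonoid.tensor_assoc (P Q R : Pseudomonoid M.toStrictMonTwoCat) :
    (P.tensor Q).tensor R = P.tensor (Q.tensor R) := by
  apply Pseudomonoid.ext
  · exact M.assoc₀ _ _ _
  · exact K₁ (by simpa [tensor] using mid_mid ..) (by simp) (by simp) (by simp [tensor]) (by simp [tensor])
  · exact M.assoc₁ _ _ _
  · exact K₂ rfl rfl rfl (by simpa [tensor] using shuf_shuf ..) (by simp) (by simp) (by simp [tensor]) (by simp [tensor])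
  · exact M.assoc₂ _ _ _
  · exact M.assoc₂ _ _ _

theorem Pseudomonoid.unit_tensor (P : Pseudomonoid M.toStrictMonTwoCat) :
    (Pseudomonoid.unit M.toStrictMonTwoCat).tensor P = P := by
  apply Pseudomonoid.ext
  · exact M.unit_tensor₀ _
  · simp [Pseudomonoid.tensor, Pseudomonoid.unit]
  · exact M.unit_tensor₁ _
  · simp [Pseudomonoid.tensor, Pseudomonoid.unit, shuf]
  · exact M.unit_tensor₂ _
  · exact M.unit_tensor₂ _
theorem Pseudomonoid.tensor_unit (P : Pseudomonoid M.toStrictMonTwoCat) :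
    P.tensor (Pseudomonoid.unit M.toStrictMonTwoCat) = P := by
  apply Pseudomonoid.ext
  · exact M.tensor_unit₀ _
  · simp [Pseudomonoid.tensor, Pseudomonoid.unit]
  · exact M.tensor_unit₁ _
  · simp [Pseudomonoid.tensor, Pseudomonoid.unit, shuf]
  · exact M.tensor_unit₂ _
  · exact M.tensor_unit₂ _
theorem OpmonOne.tensor_assoc (P Q R : OpmonOne M.toStrictMonTwoCat) :
    (P.tensor Q).tensor R = P.tensor (Q.tensor R) := by
  apply OpmonOne.ext
  · exact Pseudomonoid.tensor_assoc _ _ _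
  · exact Pseudomonoid.tensor_assoc _ _ _
  · exact M.assoc₁ _ _ _
  · exact K₂ rfl rfl rfl (by simpa [OpmonOne.tensor, Pseudomonoid.tensor] using mid_mid ..) (by simp) (by simp)
      (by simp [OpmonOne.tensor, Pseudomonoid.tensor]) (by simp [OpmonOne.tensor, Pseudomonoid.tensor])
  · exact M.assoc₂ _ _ _
theorem OpmonOne.unit_tensor (P : OpmonOne M.toStrictMonTwoCat) :
    (OpmonOne.id (Pseudomonoid.unit M.toStrictMonTwoCat)).tensor P = P := by
  apply OpmonOne.ext
  · exact Pseudomonoid.unit_tensor _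
  · exact Pseudomonoid.unit_tensor _
  · exact M.unit_tensor₁ _
  · simp [OpmonOne.tensor, OpmonOne.id, Pseudomonoid.unit]
  · exact M.unit_tensor₂ _
theorem OpmonOne.tensor_unit (P : OpmonOne M.toStrictMonTwoCat) :
    P.tensor (OpmonOne.id (Pseudomonoid.unit M.toStrictMonTwoCat)) = P := by
  apply OpmonOne.ext
  · exact Pseudomonoid.tensor_unit _
  · exact Pseudomonoid.tensor_unit _
  · exact M.tensor_unit₁ _
  · simp [OpmonOne.tensor, OpmonOne.id, Pseudomonoid.unit]
  · exact M.tensor_unit₂ _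

theorem OpmonOne.tensor_id (P Q : Pseudomonoid M.toStrictMonTwoCat) :
    (OpmonOne.id P).tensor (OpmonOne.id Q) = OpmonOne.id (P.tensor Q) := by
  apply OpmonOne.ext <;> simp [OpmonOne.tensor, OpmonOne.id, Pseudomonoid.tensor]

theorem OpmonOne.tensor_comp (G F G' F' : OpmonOne M.toStrictMonTwoCat) (h : F.tgt = G.src)
    (hh : F'.tgt = G'.src) : (G.comp F h).tensor (G'.comp F' hh) =
      (G.tensor G').comp (F.tensor F') (by simp [OpmonOne.tensor, h, hh]) := by
  apply OpmonOne.ext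
  · rfl
  · rfl
  · exact M.tensor_comp _ _ _ _ (by simp [h]) (by simp [hh])
  · have s1 := J₂ (z := G.φ₂) (w := G'.φ₂) (x := M.id₂ F.f) (y := M.id₂ F'.f) (c := M.id₂ F.f)
      (d := M.id₂ F'.f) (r := M.id₁ (F.src.A ⊗₀ F'.src.A)) (s := M.id₁ (F.src.A ⊗₀ F'.src.A))
      (A := G.src.A) (B := G'.src.A) (C := G.src.A) (D := G'.src.A) (X := F.src.A)
      (Y := F'.src.A) (C' := F.src.A) (D' := F'.src.A) (by simp) (by simp) (by simp [Is₁, h])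
      (by simp [Is₁, hh]) (by simp [Is₁, h]) (by simp [Is₁, hh]) (by simp) (by simp)
    simp only [M.tensor_id₂, M.tensor_id₁] at s1
    rw [id₂_comp _ _ _ (by simp), comp_id₁' (by simp), comp_id₁' (by simp)] at s1
    simp only [M.tensor_id₂] at s1
    have s2 : M.id₂ (G.f ⊗₁ G'.f) ∘ₕ ((F.φ₂ ⊗₂ F'.φ₂) ∘ₕ M.id₂ (M.mid F.src.A F'.src.A
        F.src.A F'.src.A)) = ((M.id₂ G.f ∘ₕ F.φ₂) ⊗₂ (M.id₂ G'.f ∘ₕ F'.φ₂)) ∘ₕ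
        M.id₂ (M.mid F.src.A F'.src.A F.src.A F'.src.A) := by
      rw [M.tensor_hcomp, M.tensor_id₂, M.hcomp_assoc] <;> simp [h, hh]
    simp only [OpmonOne.comp, OpmonOne.tensor]
    erw [s1, s2]
    rw [Jv] <;> simp (maxDischargeDepth := 9) [h, hh]
  · simp only [OpmonOne.comp, OpmonOne.tensor]
    rw [M.tensor_vcomp, M.tensor_hcomp, M.tensor_id₂] <;> simp [h, hh]

/-- The product of opmonoidal 2-cells. -/
def OpmonTwo.tensor (V W : OpmonTwo M.toStrictMonTwoCat) : OpmonTwo M.toStrictMonTwoCat where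
  dom := V.dom.tensor W.dom
  cod := V.cod.tensor W.cod
  ω := V.ω ⊗₂ W.ω
  src_dom := by simp [OpmonOne.tensor]
  tgt_dom := by simp [OpmonOne.tensor]
  ω_is := by simp [Is₂, OpmonOne.tensor]
  compat₂ := by
    have s1 := J₂ (z := M.id₂ V.dom.tgt.m) (w := M.id₂ W.dom.tgt.m) (x := V.ω) (y := W.ω)
      (c := V.ω) (d := W.ω) (r := M.id₁ (V.dom.src.A ⊗₀ W.dom.src.A))
      (s := M.id₁ (V.dom.src.A ⊗₀ W.dom.src.A))
      (A := V.dom.tgt.A) (B := W.dom.tgt.A) (C := V.dom.tgt.A) (D := W.dom.tgt.A)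
      (X := V.dom.src.A) (Y := W.dom.src.A) (C' := V.dom.src.A) (D' := W.dom.src.A)
      (by simp) (by simp) (by simp [Is₁])
      (by simp [Is₁]) (by simp [Is₁]) (by simp [Is₁]) (by simp) (by simp)
    simp only [M.tensor_id₂, M.tensor_id₁] at s1
    rw [id₂_comp _ _ _ (by simp), comp_id₁' (by simp), hcomp_id₂' (by simp)] at s1
    have s2 : (V.ω ⊗₂ W.ω) ∘ₕ M.id₂ ((V.dom.src.m ⊗₁ W.dom.src.m) ∘₁
          M.mid V.dom.src.A W.dom.src.A V.dom.src.A W.dom.src.A) =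
        ((V.ω ∘ₕ M.id₂ V.dom.src.m) ⊗₂ (W.ω ∘ₕ M.id₂ W.dom.src.m)) ∘ₕ
        M.id₂ (M.mid V.dom.src.A W.dom.src.A V.dom.src.A W.dom.src.A) := by
      rw [M.tensor_hcomp, M.tensor_id₂, M.hcomp_assoc, M.id₂_comp] <;> simp
    simp only [OpmonOne.tensor, Pseudomonoid.tensor, ← V.src_dom, ← W.src_dom]
    erw [s1, s2]
    rw [Jv, Jv, V.compat₂, W.compat₂] <;> simp (maxDischargeDepth := 9)
  compat₀ := by
    simp only [OpmonOne.tensor, Pseudomonoid.tensor]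
    rw [V.compat₀, W.compat₀, M.tensor_vcomp, M.tensor_hcomp, M.tensor_id₂] <;> simp

end StrictMonTwoCat

namespace StrictMonTwoCat
open TwoCat SymStrictMonTwoCat

/-- The opmonoidal 1-cell is strict: its two structure 2-cells are identities. -/
def OpmonOne.IsStrict {M : StrictMonTwoCat.{u}} (F : OpmonOne M) : Prop :=
  F.φ₂ = M.id₂ (F.f ∘₁ F.src.m) ∧ F.φ₀ = M.id₂ (F.f ∘₁ F.src.u)

section
variable {M : StrictMonTwoCat.{u}}
theorem OpmonOne.IsStrict.ext {F G : OpmonOne M} (hF : F.IsStrict) (hG : G.IsStrict)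
    (h : F.src = G.src) (h' : F.tgt = G.tgt) (h'' : F.f = G.f) : F = G := by
  apply OpmonOne.ext h h' h''
  · rw [hF.1, hG.1, h, h'']
  · rw [hF.2, hG.2, h, h'']
theorem OpmonOne.IsStrict.m {F : OpmonOne M} (hF : F.IsStrict) :
    F.f ∘₁ F.src.m = F.tgt.m ∘₁ (F.f ⊗₁ F.f) := by
  have := F.cod_φ₂
  rwa [hF.1, M.cod_id₂] at this
theorem OpmonOne.IsStrict.u {F : OpmonOne M} (hF : F.IsStrict) :
    F.f ∘₁ F.src.u = F.tgt.u := by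
  have := F.cod_φ₀
  rwa [hF.2, M.cod_id₂] at this
theorem OpmonOne.IsStrict.comp {F G : OpmonOne M} (hF : F.IsStrict) (hG : G.IsStrict)
    (h : F.tgt = G.src) : (G.comp F h).IsStrict := by
  have e1 := hF.m
  have e2 := hF.u
  have e3 := hG.m
  have e4 := hG.u
  simp only [h] at e1 e2
  constructor
  · simp only [OpmonOne.comp]
    rw [hF.1, hG.1, id₂_comp _ _ _ (by simp [h]), id₂_comp _ _ _ (by simp [h]), e1,
      M.comp_assoc, id₂_vcomp', M.comp_assoc, e1] <;> simp [h]
  · simp only [OpmonOne.comp]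
    rw [hF.2, hG.2, id₂_comp _ _ _ (by simp [h]), e2, id₂_vcomp', M.comp_assoc, e2] <;> simp [h]
theorem OpmonOne.IsStrict.id (P : Pseudomonoid M) : (OpmonOne.id P).IsStrict := by
  simp [IsStrict, OpmonOne.id]
end
variable {M : SymStrictMonTwoCat.{u}}
theorem OpmonOne.IsStrict.tensor {F G : OpmonOne M.toStrictMonTwoCat} (hF : F.IsStrict)
    (hG : G.IsStrict) : (F.tensor G).IsStrict := by
  constructor
  · simp only [OpmonOne.tensor, Pseudomonoid.tensor]
    rw [hF.1, hG.1, M.tensor_id₂, M.tensor_comp, id₂_comp, M.comp_assoc] <;> simp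
  · simp only [OpmonOne.tensor, Pseudomonoid.tensor]
    rw [hF.2, hG.2, M.tensor_id₂, M.tensor_comp]
    all_goals simp

theorem σ_mul (P Q : Pseudomonoid M.toStrictMonTwoCat) :
    M.σ P.A Q.A ∘₁ (P.tensor Q).m = (Q.tensor P).m ∘₁ (M.σ P.A Q.A ⊗₁ M.σ P.A Q.A) := by
  simp only [Pseudomonoid.tensor]
  have e := σ_nat₁ (f := P.m) (g := Q.m) P.m_is Q.m_is
  rw [← M.comp_assoc, e, M.comp_assoc, σ_mid, M.comp_assoc] <;> simp
theorem σ_unit (P Q : Pseudomonoid M.toStrictMonTwoCat) :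
    M.σ P.A Q.A ∘₁ (P.tensor Q).u = (Q.tensor P).u := by
  simp only [Pseudomonoid.tensor]
  have e := σ_nat₁ (f := P.u) (g := Q.u) P.u_is Q.u_is
  rw [e, σ_unit_right, comp_id₁']; simp

/-- The symmetry, as a strict opmonoidal 1-cell. -/
def OpmonOne.σ (P Q : Pseudomonoid M.toStrictMonTwoCat) : OpmonOne M.toStrictMonTwoCat where
  src := P.tensor Q
  tgt := Q.tensor P
  f := M.σ P.A Q.A
  φ₂ := M.id₂ (M.σ P.A Q.A ∘₁ (P.tensor Q).m)
  φ₀ := M.id₂ (M.σ P.A Q.A ∘₁ (P.tensor Q).u)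
  f_is := by simp [Is₁, Pseudomonoid.tensor]
  φ₂_is := by simp [Is₂, σ_mul]
  φ₀_is := by simp [Is₂, σ_unit]
  coassoc := by
    have e := σ_nat₂ (α := P.α) (β := Q.α) (A := P.A ⊗₀ P.A ⊗₀ P.A) (B := P.A)
      (A' := Q.A ⊗₀ Q.A ⊗₀ Q.A) (B' := Q.A) (by simp [Is₁]) (by simp [Is₁])
    have e' : ((Q.tensor P).α ∘ₕ M.id₂ (M.σ P.A Q.A ⊗₁ M.σ P.A Q.A ⊗₁ M.σ P.A Q.A)) =
        M.id₂ (M.σ P.A Q.A) ∘ₕ (P.tensor Q).α := by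
      simp only [Pseudomonoid.tensor]
      rw [← M.hcomp_assoc, e, M.hcomp_assoc, M.hcomp_assoc, M.id₂_comp, M.id₂_comp, σ_shuf] <;>
        simp
    have h1 : M.src (M.σ P.A Q.A) = (P.tensor Q).A := by simp [Pseudomonoid.tensor]
    have h2 : M.tgt (M.σ P.A Q.A) = (Q.tensor P).A := by simp [Pseudomonoid.tensor]
    have e1 := σ_mul P Q
    have hX : (Q.tensor P).m ∘₁ ((M.σ P.A Q.A ∘₁ (P.tensor Q).m) ⊗₁ M.σ P.A Q.A) =
        M.σ P.A Q.A ∘₁ (P.tensor Q).m ∘₁ ((P.tensor Q).m ⊗₁ M.id₁ (P.tensor Q).A) := by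
      symm
      calc _ = (M.σ P.A Q.A ∘₁ (P.tensor Q).m) ∘₁ ((P.tensor Q).m ⊗₁ M.id₁ (P.tensor Q).A) := by
            rw [M.comp_assoc] <;> simp [h1]
        _ = ((Q.tensor P).m ∘₁ (M.σ P.A Q.A ⊗₁ M.σ P.A Q.A)) ∘₁ ((P.tensor Q).m ⊗₁ M.id₁ (P.tensor Q).A) := by rw [e1]
        _ = _ := by
            rw [M.comp_assoc, ← M.tensor_comp, comp_id₁'] <;> simp [h1, h2]
    have hY : (Q.tensor P).m ∘₁ (M.σ P.A Q.A ⊗₁ (M.σ P.A Q.A ∘₁ (P.tensor Q).m)) =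
        M.σ P.A Q.A ∘₁ (P.tensor Q).m ∘₁ (M.id₁ (P.tensor Q).A ⊗₁ (P.tensor Q).m) := by
      symm
      calc _ = (M.σ P.A Q.A ∘₁ (P.tensor Q).m) ∘₁ (M.id₁ (P.tensor Q).A ⊗₁ (P.tensor Q).m) := by
            rw [M.comp_assoc] <;> simp [h1]
        _ = ((Q.tensor P).m ∘₁ (M.σ P.A Q.A ⊗₁ M.σ P.A Q.A)) ∘₁ (M.id₁ (P.tensor Q).A ⊗₁ (P.tensor Q).m) := by rw [e1]
        _ = _ := by
            rw [M.comp_assoc, ← M.tensor_comp, comp_id₁'] <;> simp [h1, h2]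
    rw [e', M.tensor_id₂, M.tensor_id₂, M.id₂_comp, M.id₂_comp, M.id₂_comp, M.id₂_comp, hX, hY,
      M.comp_assoc, M.comp_assoc, id₂_vcomp', vcomp_id₂', id₂_vcomp', id₂_vcomp'] <;> simp (maxDischargeDepth := 9) [h1, h2]
  counit_left := by
    have e := σ_nat₂ (α := P.lam) (β := Q.lam) (A := P.A) (B := P.A)
      (A' := Q.A) (B' := Q.A) (by simp [Is₁]) (by simp [Is₁])
    have e' : (Q.tensor P).lam ∘ₕ M.id₂ (M.σ P.A Q.A) = M.id₂ (M.σ P.A Q.A) ∘ₕ (P.tensor Q).lam := by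
      simp only [Pseudomonoid.tensor]
      rw [e]
    have h1 : M.src (M.σ P.A Q.A) = (P.tensor Q).A := by simp [Pseudomonoid.tensor]
    have h2 : M.tgt (M.σ P.A Q.A) = (Q.tensor P).A := by simp [Pseudomonoid.tensor]
    have e1 := σ_mul P Q
    have hX : (Q.tensor P).m ∘₁ ((M.σ P.A Q.A ∘₁ (P.tensor Q).u) ⊗₁ M.σ P.A Q.A) =
        M.σ P.A Q.A ∘₁ (P.tensor Q).m ∘₁ ((P.tensor Q).u ⊗₁ M.id₁ (P.tensor Q).A) := by
      rw [← M.comp_assoc (M.σ P.A Q.A), e1, M.comp_assoc, ← M.tensor_comp, comp_id₁'] <;>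
        simp [h1, h2]
    rw [e', M.tensor_id₂, M.id₂_comp, M.id₂_comp, hX, M.comp_assoc, id₂_vcomp', vcomp_id₂'] <;>
      simp [h1, h2]
  counit_right := by
    have e := σ_nat₂ (α := P.rho) (β := Q.rho) (A := P.A) (B := P.A)
      (A' := Q.A) (B' := Q.A) (by simp [Is₁]) (by simp [Is₁])
    have e' : (Q.tensor P).rho ∘ₕ M.id₂ (M.σ P.A Q.A) = M.id₂ (M.σ P.A Q.A) ∘ₕ (P.tensor Q).rho := by
      simp only [Pseudomonoid.tensor]
      rw [e]
    have h1 : M.src (M.σ P.A Q.A) = (P.tensor Q).A := by simp [Pseudomonoid.tensor]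
    have h2 : M.tgt (M.σ P.A Q.A) = (Q.tensor P).A := by simp [Pseudomonoid.tensor]
    have e1 := σ_mul P Q
    have hX : (Q.tensor P).m ∘₁ (M.σ P.A Q.A ⊗₁ (M.σ P.A Q.A ∘₁ (P.tensor Q).u)) =
        M.σ P.A Q.A ∘₁ (P.tensor Q).m ∘₁ (M.id₁ (P.tensor Q).A ⊗₁ (P.tensor Q).u) := by
      rw [← M.comp_assoc (M.σ P.A Q.A), e1, M.comp_assoc, ← M.tensor_comp, comp_id₁'] <;>
        simp [h1, h2]
    rw [e', M.tensor_id₂, M.id₂_comp, M.id₂_comp, hX, M.comp_assoc, id₂_vcomp', vcomp_id₂'] <;>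
      simp [h1, h2]

theorem OpmonOne.IsStrict.σ (P Q : Pseudomonoid M.toStrictMonTwoCat) :
    (OpmonOne.σ P Q).IsStrict := ⟨rfl, rfl⟩

theorem OpmonOne.σ_naturality (F G : OpmonOne M.toStrictMonTwoCat) :
    (OpmonOne.σ F.tgt G.tgt).comp (F.tensor G) rfl =
      (G.tensor F).comp (OpmonOne.σ F.src G.src) rfl := by
  apply OpmonOne.ext
  · rfl
  · rfl
  · exact σ_nat₁ F.f_is G.f_is
  · have e := σ_nat₂ (α := F.φ₂) (β := G.φ₂) (A := F.src.A ⊗₀ F.src.A) (B := F.tgt.A)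
      (A' := G.src.A ⊗₀ G.src.A) (B' := G.tgt.A) (by simp [Is₁]) (by simp [Is₁])
    have e' : M.id₂ (M.σ F.tgt.A G.tgt.A) ∘ₕ (F.tensor G).φ₂ = (G.tensor F).φ₂ ∘ₕ
        M.id₂ (M.σ F.src.A G.src.A ⊗₁ M.σ F.src.A G.src.A) := by
      simp only [OpmonOne.tensor]
      rw [← M.hcomp_assoc, e, M.hcomp_assoc, M.hcomp_assoc, M.id₂_comp, M.id₂_comp, σ_mid] <;>
        simp
    have h1 := (F.tensor G).cod_φ₂
    have h2 := (G.tensor F).dom_φ₂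
    have h3 : M.cod (M.id₂ (M.σ F.tgt.A G.tgt.A) ∘ₕ (F.tensor G).φ₂) =
        (M.σ F.tgt.A G.tgt.A ∘₁ (F.tgt.tensor G.tgt).m) ∘₁
          ((F.tensor G).f ⊗₁ (F.tensor G).f) := by
      rw [M.cod_hcomp, h1, M.cod_id₂, M.comp_assoc]
      · rfl
      all_goals simp [OpmonOne.tensor, Pseudomonoid.tensor]
    have h4 : M.dom ((G.tensor F).φ₂ ∘ₕ
        M.id₂ (M.σ F.src.A G.src.A ⊗₁ M.σ F.src.A G.src.A)) = (G.tensor F).f ∘₁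
          (M.σ F.src.A G.src.A ∘₁ (F.src.tensor G.src).m) := by
      rw [M.dom_hcomp, σ_mul, h2, M.dom_id₂, M.comp_assoc] <;> simp [OpmonOne.tensor, Pseudomonoid.tensor]
    simp only [OpmonOne.comp, OpmonOne.σ]
    rw [M.id₂_comp, M.id₂_comp, id₂_vcomp' h3, vcomp_id₂' h4, e'] <;>
      simp [OpmonOne.tensor, Pseudomonoid.tensor]
  · have e := σ_nat₂ (α := F.φ₀) (β := G.φ₀) (A := M.I) (B := F.tgt.A)
      (A' := M.I) (B' := G.tgt.A) (by simp [Is₁]) (by simp [Is₁])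
    rw [σ_unit_right, hcomp_id₂' (by simp)] at e
    have e0 := σ_unit F.tgt G.tgt
    simp only [Pseudomonoid.tensor] at e0
    simp only [OpmonOne.comp, OpmonOne.σ, OpmonOne.tensor]
    rw [σ_unit, σ_unit, id₂_vcomp', M.id₂_comp, vcomp_id₂', e] <;>
      simp [e0, Pseudomonoid.tensor]

end StrictMonTwoCat

namespace SymStrictMonTwoCat
open TwoCat StrictMonTwoCat

theorem opm_comp {M : StrictMonTwoCat.{u}} {G F : OpmonOne M} (h : F.tgt = G.src) :
    (opmTwoCat M).comp G F = G.comp F h := dif_pos h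
theorem opm_vcomp {M : StrictMonTwoCat.{u}} {V W : OpmonTwo M} (h : W.cod = V.dom) :
    (opmTwoCat M).vcomp V W = V.vcomp W h := dif_pos h
theorem opm_hcomp {M : StrictMonTwoCat.{u}} {V W : OpmonTwo M} (h : W.cod.tgt = V.cod.src) :
    (opmTwoCat M).hcomp V W = V.hcomp W h := dif_pos h

theorem _root_.StrictMonTwoCat.OpmonTwo.tensor_aux {M : StrictMonTwoCat.{u}} {V W : OpmonTwo M}
    (h : W.cod = V.dom) : M.cod W.ω = M.dom V.ω := by simp [h]
theorem _root_.StrictMonTwoCat.OpmonTwo.tensor_aux' {M : StrictMonTwoCat.{u}} {V W : OpmonTwo M}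
    (h : W.dom.tgt = V.dom.src) : M.tgt (M.dom W.ω) = M.src (M.dom V.ω) := by
  rw [W.dom_ω, V.dom_ω, W.dom.tgt_f, V.dom.src_f, h]
theorem _root_.StrictMonTwoCat.OpmonTwo.tgt_aux {M : StrictMonTwoCat.{u}} {V W : OpmonTwo M}
    (h : W.dom.tgt = V.dom.src) : W.cod.tgt = V.cod.src := by
  rw [← W.tgt_dom, h, V.src_dom]

theorem _root_.StrictMonTwoCat.OpmonTwo.σ_aux {M : SymStrictMonTwoCat.{u}}
    (V W : OpmonTwo M.toStrictMonTwoCat) :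
    (V.tensor W).cod.tgt = (OpmonTwo.id (OpmonOne.σ V.dom.tgt W.dom.tgt)).cod.src := by
  change V.cod.tgt.tensor W.cod.tgt = V.dom.tgt.tensor W.dom.tgt
  simp
theorem _root_.StrictMonTwoCat.OpmonTwo.σ_aux' {M : SymStrictMonTwoCat.{u}}
    (V W : OpmonTwo M.toStrictMonTwoCat) :
    (OpmonTwo.id (OpmonOne.σ V.dom.src W.dom.src)).cod.tgt = (W.tensor V).cod.src := by
  change W.dom.src.tensor V.dom.src = W.cod.src.tensor V.cod.src
  simp
theorem _root_.StrictMonTwoCat.OpmonTwo.σ_naturality {M : SymStrictMonTwoCat.{u}}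
    (V W : OpmonTwo M.toStrictMonTwoCat) :
    (OpmonTwo.id (OpmonOne.σ V.dom.tgt W.dom.tgt)).hcomp (V.tensor W) (OpmonTwo.σ_aux V W) =
      (W.tensor V).hcomp (OpmonTwo.id (OpmonOne.σ V.dom.src W.dom.src)) (OpmonTwo.σ_aux' V W) := by
  apply OpmonTwo.ext
  · exact OpmonOne.σ_naturality V.dom W.dom
  · have := OpmonOne.σ_naturality V.cod W.cod
    simp only [OpmonTwo.hcomp, OpmonTwo.id, V.tgt_dom, W.tgt_dom, V.src_dom, W.src_dom]
    exact this
  · exact σ_nat₂ (by simp [Is₁]) (by simp [Is₁])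

theorem _root_.StrictMonTwoCat.OpmonTwo.tensor_vaux {M : SymStrictMonTwoCat.{u}}
    {V W V' W' : OpmonTwo M.toStrictMonTwoCat} (h : W.cod = V.dom) (h' : W'.cod = V'.dom) :
    (W.tensor W').cod = (V.tensor V').dom := congrArg₂ OpmonOne.tensor h h'
theorem _root_.StrictMonTwoCat.OpmonTwo.tensor_haux {M : SymStrictMonTwoCat.{u}}
    {V W V' W' : OpmonTwo M.toStrictMonTwoCat} (h : W.dom.tgt = V.dom.src)
    (h' : W'.dom.tgt = V'.dom.src) : (W.tensor W').cod.tgt = (V.tensor V').cod.src :=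
  congrArg₂ Pseudomonoid.tensor (OpmonTwo.tgt_aux h) (OpmonTwo.tgt_aux h')
theorem _root_.StrictMonTwoCat.OpmonTwo.tensor_vcomp {M : SymStrictMonTwoCat.{u}}
    (V W V' W' : OpmonTwo M.toStrictMonTwoCat) (h : W.cod = V.dom) (h' : W'.cod = V'.dom) :
    (V.vcomp W h).tensor (V'.vcomp W' h') =
      (V.tensor V').vcomp (W.tensor W') (OpmonTwo.tensor_vaux h h') :=
  OpmonTwo.ext rfl rfl
    (M.tensor_vcomp _ _ _ _ (OpmonTwo.tensor_aux h) (OpmonTwo.tensor_aux h'))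
theorem _root_.StrictMonTwoCat.OpmonTwo.tensor_hcomp {M : SymStrictMonTwoCat.{u}}
    (V W V' W' : OpmonTwo M.toStrictMonTwoCat) (h : W.dom.tgt = V.dom.src)
    (hh : W'.dom.tgt = V'.dom.src) :
    (V.hcomp W (OpmonTwo.tgt_aux h)).tensor (V'.hcomp W' (OpmonTwo.tgt_aux hh)) =
      (V.tensor V').hcomp (W.tensor W') (OpmonTwo.tensor_haux h hh) :=
  OpmonTwo.ext (OpmonOne.tensor_comp V.dom W.dom V'.dom W'.dom h hh)
    (OpmonOne.tensor_comp V.cod W.cod V'.cod W'.cod (OpmonTwo.tgt_aux h) (OpmonTwo.tgt_aux hh))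
    (M.tensor_hcomp _ _ _ _ (OpmonTwo.tensor_aux' h) (OpmonTwo.tensor_aux' hh))

/-- The symmetric strict monoidal 2-category of pseudomonoids, opmonoidal 1-cells and opmonoidal
2-cells in `M`. -/
noncomputable def opm (M : SymStrictMonTwoCat.{u}) : SymStrictMonTwoCat.{u} where
  toTwoCat := opmTwoCat M.toStrictMonTwoCat
  I := Pseudomonoid.unit M.toStrictMonTwoCat
  tensor₀ := Pseudomonoid.tensor
  tensor₁ := OpmonOne.tensor
  tensor₂ := OpmonTwo.tensor
  src_tensor _ _ := rfl
  tgt_tensor _ _ := rfl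
  dom_tensor _ _ := rfl
  cod_tensor _ _ := rfl
  tensor_id₁ := OpmonOne.tensor_id
  tensor_id₂ F G := by
    apply OpmonTwo.ext
    · rfl
    · rfl
    · exact M.tensor_id₂ _ _
  tensor_comp G F G' F' h h' :=
    (congrArg₂ OpmonOne.tensor (opm_comp h) (opm_comp h')).trans
      ((OpmonOne.tensor_comp G F G' F' h h').trans
        (opm_comp (congrArg₂ Pseudomonoid.tensor h h')).symm)
  tensor_vcomp V W V' W' h h' :=
    (congrArg₂ OpmonTwo.tensor (opm_vcomp h) (opm_vcomp h')).trans
      ((OpmonTwo.tensor_vcomp V W V' W' h h').trans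
        (opm_vcomp (OpmonTwo.tensor_vaux h h')).symm)
  tensor_hcomp V W V' W' h h' :=
    (congrArg₂ OpmonTwo.tensor (opm_hcomp (OpmonTwo.tgt_aux h))
      (opm_hcomp (OpmonTwo.tgt_aux h'))).trans
      ((OpmonTwo.tensor_hcomp V W V' W' h h').trans
        (opm_hcomp (OpmonTwo.tensor_haux h h')).symm)
  assoc₀ := Pseudomonoid.tensor_assoc
  assoc₁ := OpmonOne.tensor_assoc
  assoc₂ U V W := OpmonTwo.ext (OpmonOne.tensor_assoc ..) (OpmonOne.tensor_assoc ..)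
    (M.assoc₂ _ _ _)
  unit_tensor₀ := Pseudomonoid.unit_tensor
  unit_tensor₁ := OpmonOne.unit_tensor
  unit_tensor₂ W := OpmonTwo.ext (OpmonOne.unit_tensor _) (OpmonOne.unit_tensor _)
    (M.unit_tensor₂ _)
  tensor_unit₀ := Pseudomonoid.tensor_unit
  tensor_unit₁ := OpmonOne.tensor_unit
  tensor_unit₂ W := OpmonTwo.ext (OpmonOne.tensor_unit _) (OpmonOne.tensor_unit _)
    (M.tensor_unit₂ _)
  σ := OpmonOne.σ
  src_σ _ _ := rfl
  tgt_σ _ _ := rfl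
  σ_naturality₁ F G :=
    (opm_comp rfl).trans ((OpmonOne.σ_naturality F G).trans (opm_comp rfl).symm)
  σ_naturality₂ V W :=
    (opm_hcomp (OpmonTwo.σ_aux V W)).trans
      ((OpmonTwo.σ_naturality V W).trans (opm_hcomp (OpmonTwo.σ_aux' V W)).symm)
  σ_σ P Q := (opm_comp rfl).trans
    (OpmonOne.IsStrict.ext (.comp (.σ _ _) (.σ _ _) rfl) (.id _) rfl rfl (M.σ_σ _ _))
  σ_hexagon P Q R :=
    have h : ((OpmonOne.σ P Q).tensor (OpmonOne.id R)).tgt =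
        ((OpmonOne.id Q).tensor (OpmonOne.σ P R)).src := Pseudomonoid.tensor_assoc Q P R
    (OpmonOne.IsStrict.ext (.σ _ _) (.comp (.tensor (.σ _ _) (.id _))
      (.tensor (.id _) (.σ _ _)) h) (Pseudomonoid.tensor_assoc P Q R).symm
      (Pseudomonoid.tensor_assoc Q R P) (M.σ_hexagon _ _ _)).trans (opm_comp h).symm

end SymStrictMonTwoCat

namespace StrictMonTwoCat
open TwoCat SymStrictMonTwoCat
/-- The forgetful 2-functor to the underlying objects, 1-cells and 2-cells. -/
def forgetOpm (M : StrictMonTwoCat.{u}) : TwoFunctor (opmTwoCat M) M.toTwoCat where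
  obj := Pseudomonoid.A
  map₁ := OpmonOne.f
  map₂ := OpmonTwo.ω
  src_map₁ := OpmonOne.src_f
  tgt_map₁ := OpmonOne.tgt_f
  dom_map₂ := OpmonTwo.dom_ω
  cod_map₂ := OpmonTwo.cod_ω
  map_id₁ _ := rfl
  map_id₂ _ := rfl
  map_comp _ _ h := congrArg OpmonOne.f (opm_comp h)
  map_vcomp _ _ h := congrArg OpmonTwo.ω (opm_vcomp h)
  map_hcomp _ _ h := congrArg OpmonTwo.ω (opm_hcomp (OpmonTwo.tgt_aux h))

section
variable {M : StrictMonTwoCat.{u}}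
/-- The product monad `(A B, t s)` of `(A, t)` and `(B, s)`. -/
def _root_.TwoCat.Monad.tensor (S T : Monad M.toTwoCat) : Monad M.toTwoCat where
  A := S.A ⊗₀ T.A
  t := S.t ⊗₁ T.t
  μ := S.μ ⊗₂ T.μ
  η := S.η ⊗₂ T.η
  t_is := by simp [Is₁]
  μ_is := by simp [Is₂]
  η_is := by simp [Is₂]
  assoc := by
    rw [← M.tensor_id₂, ← M.tensor_hcomp, ← M.tensor_hcomp, ← M.tensor_vcomp, ← M.tensor_vcomp,
      S.assoc, T.assoc] <;> simp
  left_unit := by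
    rw [← M.tensor_id₂, ← M.tensor_hcomp, ← M.tensor_vcomp, S.left_unit, T.left_unit] <;> simp
  right_unit := by
    rw [← M.tensor_id₂, ← M.tensor_hcomp, ← M.tensor_vcomp, S.right_unit, T.right_unit] <;> simp
end
end StrictMonTwoCat

namespace TwoCat.EilenbergMoore
open StrictMonTwoCat

/-- `k` is the comparison 1-cell of an adjunction `l ⊣ r : B ⟶ A` generating the monad `T` on `A`:
the 1-cell from `B` to the Eilenberg-Moore object with `k.l = f` and `u.k = r`. -/
def IsComparison {M : TwoCat.{u}} (E : M.EilenbergMoore) (T : Monad M) (l r k : M.One) : Prop :=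
  M.Is₁ k (M.src r) (E.H.obj T) ∧ k ∘₁ l = E.f T ∧ E.u T ∘₁ k = r

/-- The Eilenberg-Moore construction is monoidal: the comparison 1-cells from `I` to `I¹` (for the
adjunction `1 ⊣ 1`) and from `Aᵗ Bˢ` to `(A B)ᵗˢ` (for the adjunction `fᵗ fˢ ⊣ uᵗ uˢ`) are identity
1-cells. -/
def IsMonoidal {M : StrictMonTwoCat.{u}} (E : M.toTwoCat.EilenbergMoore) : Prop :=
  E.IsComparison (idMonad M.I) (M.id₁ M.I) (M.id₁ M.I) (M.id₁ M.I) ∧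
  ∀ S T : Monad M.toTwoCat, E.IsComparison (S.tensor T) (E.f S ⊗₁ E.f T) (E.u S ⊗₁ E.u T)
    (M.id₁ (E.H.obj S ⊗₀ E.H.obj T))

end TwoCat.EilenbergMoore

namespace SymStrictMonTwoCat
open TwoCat StrictMonTwoCat

/-- The symmetric strict monoidal 2-category of `q`-oidal objects, `(0,q)`-oidal 1-cells and
`(0,q)`-oidal 2-cells: the `q`-fold iterate of `opm`. Its 0-cells are the `q`-oidal objects of `M`,
and the monads in it are the `(0,q)`-oidal monads in `M`. -/
noncomputable def opmPow : ℕ → SymStrictMonTwoCat.{u} → SymStrictMonTwoCat.{u}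
  | 0, M => M
  | q + 1, M => (opmPow q M).opm

/-- The forgetful 2-functor from the `q`-fold iterate of `opm` to `M`. -/
noncomputable def base (M : SymStrictMonTwoCat.{u}) :
    (q : ℕ) → TwoFunctor (opmPow q M).toTwoCat M.toTwoCat
  | 0 => TwoFunctor.id M.toTwoCat
  | q + 1 => (base M q).comp (opmPow q M).forgetOpm

/-- A `(0,q)`-oidal 1-cell is strict if all of its opmonoidal structure 2-cells are identities. -/
def IsStrict (M : SymStrictMonTwoCat.{u}) : (q : ℕ) → (opmPow q M).One → Prop
  | 0, _ => True
  | q + 1, F => M.IsStrict q (OpmonOne.f F) ∧ OpmonOne.IsStrict F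
end SymStrictMonTwoCat

set_option linter.unusedSimpArgs false

/-! The Eilenberg–Moore object represents actions. Under the 2-adjunction, a 1-cell from `X` to it
is a 1-cell `g` from `X` to the base object with an action `t.g ⟶ g`, and a 2-cell is one compatible
with the actions. `IsEMObject` isolates this as a property of one triple `(B, u, ρ)`: it mentions no
2-functor `H`, and asks for existence but not uniqueness of factorizations of 1-cells. In this form
it can be carried through an induction on `q`; `EilenbergMoore.isEMObject` starts the induction.

For the inductive step let `T` be a monad in the 2-category of pseudomonoids, with `(B, u, ρ)` an
Eilenberg–Moore object of its underlying monad. The opmonoidal structure of `t` turns actions into a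
monoidal affair: if `t` acts on `g` and `g'`, then it acts on `m.gg'` by `m.γγ' ∘ t₂.gg'`, and it
acts on the unit by `t₀` (`isAction_act`, `isAction_unit`). Coassociativity and counitality of `t`
say that the associativity and unit 2-cells of the pseudomonoid are compatible with these actions
(`act_assoc`, `act_lam`, `act_rho`). The universal property of `u`, applied to the actions on `m.uu`
and on the unit, therefore yields a multiplication and a unit on `B`; applied to 2-cells, it yields
the associativity and unit 2-cells. Whiskering with `u` is faithful on 2-cells into `B`, so
invertibility and the pentagon and triangle descend from the original pseudomonoid
(`exists_isLifting`). By construction `u` is a strict opmonoidal 1-cell and `ρ` is an opmonoidal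
2-cell.

To iterate, the lifted triple must again be an Eilenberg–Moore object, now of `T` itself. An action
of `T` on an opmonoidal 1-cell `G` is an action `γ` that is also an opmonoidal 2-cell, and this
extra condition says that the structure 2-cells of `G` are compatible with the actions. They thus
lift to the factorization of the underlying 1-cell of `G`, and faithfulness again supplies the
axioms (`lift_one`, `lift_two`, `exists_isEMObject_opm`). Each new triple lies over the previous one
by equalities, so after `q` steps it lies over the counit component and every structure 2-cell of
its 1-cell is an identity. -/

namespace TwoCat

/-! ### Transposition of 1-cells and 2-cells across a strict 2-adjunction. -/

namespace TwoAdjunction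
variable {M N : TwoCat.{u}} {L : TwoFunctor M N} {R : TwoFunctor N M} (D : TwoAdjunction L R)

@[simp] theorem src_unit (X : M.Obj) : M.src (D.unit.app X) = X := (D.unit.app_is X).1
@[simp] theorem tgt_unit (X : M.Obj) : M.tgt (D.unit.app X) = R.obj (L.obj X) :=
  (D.unit.app_is X).2
@[simp] theorem src_counit (Y : N.Obj) : N.src (D.counit.app Y) = L.obj (R.obj Y) :=
  (D.counit.app_is Y).1
@[simp] theorem tgt_counit (Y : N.Obj) : N.tgt (D.counit.app Y) = Y := (D.counit.app_is Y).2

/-- Naturality of the counit at `G` moves it past `G`, and the left triangle equation removes what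
remains. With the next lemma, this makes transposition a bijection on 1-cells. -/
theorem counit_comp_transpose {G : N.One} {X : M.Obj} {Y : N.Obj} (hX : N.src G = L.obj X)
    (hY : N.tgt G = Y) : D.counit.app Y ∘₁ L.map₁ (R.map₁ G ∘₁ D.unit.app X) = G := by
  subst hY
  have e : D.counit.app (N.tgt G) ∘₁ L.map₁ (R.map₁ G) = G ∘₁ D.counit.app (N.src G) :=
    D.counit.naturality₁ G
  rw [L.map_comp _ _ (by simp [hX]), ← N.comp_assoc _ _ _ (by simp [hX]) (by simp), e, hX,
    N.comp_assoc _ _ _ (by simp) (by simp [hX]), D.left_triangle, comp_id₁' hX]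

theorem transpose_counit_comp {h : M.One} {X : M.Obj} {Y : N.Obj} (hX : M.src h = X)
    (hY : M.tgt h = R.obj Y) : R.map₁ (D.counit.app Y ∘₁ L.map₁ h) ∘₁ D.unit.app X = h := by
  subst hX
  have e : D.unit.app (M.tgt h) ∘₁ h = R.map₁ (L.map₁ h) ∘₁ D.unit.app (M.src h) :=
    D.unit.naturality₁ h
  rw [R.map_comp _ _ (by simp [hY]), M.comp_assoc _ _ _ (by simp) (by simp [hY]), ← e, hY,
    ← M.comp_assoc _ _ _ (by simp [hY]) (by simp), D.right_triangle, id₁_comp' hY]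

/-- The 2-cell part of the bijection: the same argument, with 2-naturality in place of naturality
and whiskering in place of composition. -/
theorem counit_hcomp_transpose {W : N.Two} {X : M.Obj} {Y : N.Obj}
    (hX : N.src (N.dom W) = L.obj X) (hY : N.tgt (N.dom W) = Y) :
    N.id₂ (D.counit.app Y) ∘ₕ L.map₂ (R.map₂ W ∘ₕ M.id₂ (D.unit.app X)) = W := by
  subst hY
  have e : N.id₂ (D.counit.app (N.tgt (N.dom W))) ∘ₕ L.map₂ (R.map₂ W) =
    W ∘ₕ N.id₂ (D.counit.app (N.src (N.dom W))) := D.counit.naturality₂ W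
  have hX' : N.src (N.cod W) = L.obj X := by rw [← src_dom, hX]
  rw [L.map_hcomp _ _ (by simp [hX']), ← N.hcomp_assoc _ _ _ (by simp [hX']) (by simp), e, hX,
    N.hcomp_assoc _ _ _ (by simp) (by simp [hX']), L.map_id₂, N.id₂_comp _ _ (by simp),
    D.left_triangle, hcomp_id₂' hX']

theorem transpose_counit_hcomp {α : M.Two} {X : M.Obj} {Y : N.Obj} (hX : M.src (M.dom α) = X)
    (hY : M.tgt (M.dom α) = R.obj Y) :
    R.map₂ (N.id₂ (D.counit.app Y) ∘ₕ L.map₂ α) ∘ₕ M.id₂ (D.unit.app X) = α := by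
  subst hX
  have e : M.id₂ (D.unit.app (M.tgt (M.dom α))) ∘ₕ α =
    R.map₂ (L.map₂ α) ∘ₕ M.id₂ (D.unit.app (M.src (M.dom α))) := D.unit.naturality₂ α
  have hY' : M.tgt (M.cod α) = R.obj Y := by rw [← tgt_dom, hY]
  rw [R.map_hcomp _ _ (by simp [hY']), M.hcomp_assoc _ _ _ (by simp) (by simp [hY']), ← e, hY,
    ← M.hcomp_assoc _ _ _ (by simp [hY']) (by simp), R.map_id₂, M.id₂_comp _ _ (by simp),
    D.right_triangle, id₂_hcomp' hY']

end TwoAdjunction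

/-! ### Actions of a monad, and the Eilenberg–Moore object as the object representing them. -/

section
variable {M : TwoCat.{u}}

theorem mnd_comp {G F : MonadMor M} (h : F.tgt = G.src) : M.mnd.comp G F = G.comp F h := dif_pos h
theorem mnd_hcomp {V W : MonadTrans M} (h : W.cod.tgt = V.cod.src) :
    M.mnd.hcomp V W = V.hcomp W h := dif_pos h

/-- `γ : t.g ⟶ g` is an action of the monad `T` on the 1-cell `g` from `X` to the base object. -/
structure IsAction (T : Monad M) (X : M.Obj) (g : M.One) (γ : M.Two) : Prop where
  is₁ : M.Is₁ g X T.A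
  is₂ : M.Is₂ γ (T.t ∘₁ g) g
  mul : γ ∘ᵥ (T.μ ∘ₕ M.id₂ g) = γ ∘ᵥ (M.id₂ T.t ∘ₕ γ)
  unit : γ ∘ᵥ (T.η ∘ₕ M.id₂ g) = M.id₂ g

/-- The action `(u, ρ)` exhibits `B` as a (not necessarily strictly unique) Eilenberg-Moore object
of `T`: every action factors through `(u, ρ)`, and every 2-cell `u.h ⟶ u.k` compatible with the
actions lifts uniquely to a 2-cell `h ⟶ k`. -/
structure IsEMObject (T : Monad M) (B : M.Obj) (u : M.One) (ρ : M.Two) : Prop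
    extends IsAction T B u ρ where
  lift₁ : ∀ X g γ, IsAction T X g γ → ∃ h, M.Is₁ h X B ∧ u ∘₁ h = g ∧ ρ ∘ₕ M.id₂ h = γ
  lift₂ : ∀ h k ω, M.src h = M.src k → M.tgt h = B → M.tgt k = B → M.Is₂ ω (u ∘₁ h) (u ∘₁ k) →
    ω ∘ᵥ (ρ ∘ₕ M.id₂ h) = (ρ ∘ₕ M.id₂ k) ∘ᵥ (M.id₂ T.t ∘ₕ ω) →
    ∃ α, M.Is₂ α h k ∧ M.id₂ u ∘ₕ α = ω
  faithful : ∀ α β, M.dom α = M.dom β → M.cod α = M.cod β → M.tgt (M.cod α) = B →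
    M.id₂ u ∘ₕ α = M.id₂ u ∘ₕ β → α = β

namespace IsAction
variable {T : Monad M} {X : M.Obj} {g : M.One} {γ : M.Two}

/-- An action as a monad morphism out of an identity monad. -/
def toMonadMor (h : IsAction T X g γ) : MonadMor M where
  src := idMonad X
  tgt := T
  f := g
  φ := γ
  f_is := h.is₁
  φ_is := by simp [idMonad, h.is₁.1, Is₂, h.is₂.1, h.is₂.2]
  mul := by
    obtain ⟨⟨h1, h2⟩, ⟨h3, h4⟩, h5, -⟩ := h
    rw [h5]; simp (maxDischargeDepth := 9) [idMonad, *]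
  unit := by
    obtain ⟨⟨h1, h2⟩, ⟨h3, h4⟩, -, h6⟩ := h
    rw [h6]; simp [idMonad, *]

/-- For an identity monad as source, the codomain `f.1` of the 2-cell is `f`, and the multiplication
and unit axioms of a monad morphism collapse to those of an action. This is the converse of
`toMonadMor`. -/
theorem ofMonadMor (G : MonadMor M) (hX : G.src = idMonad X) (hT : G.tgt = T) :
    IsAction T X G.f G.φ := by
  have h1 := G.src_f
  have h2 := G.tgt_f
  have h3 := G.dom_φ
  have h4 := G.cod_φ
  have h5 := G.mul
  have h6 := G.unit
  simp only [hX, hT] at h1 h2 h3 h4 h5 h6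
  simp only [idMonad] at h1 h4 h5 h6
  have h7 : M.cod G.φ = G.f := by rw [h4, comp_id₁' h1]
  refine ⟨⟨h1, h2⟩, ⟨h3, h7⟩, ?_, ?_⟩
  · rw [← h5]; simp (maxDischargeDepth := 9) [h1, h2, h3, h7]
  · rw [← h6]; simp [h1]

end IsAction

namespace EilenbergMoore
variable (E : M.EilenbergMoore) (T : Monad M)

theorem counit_src : (E.counit T).src = idMonad (E.H.obj T) := E.adj.src_counit T
theorem counit_tgt : (E.counit T).tgt = T := E.adj.tgt_counit T

theorem isAction : IsAction T (E.H.obj T) (E.u T) (E.counit T).φ :=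
  .ofMonadMor _ (E.counit_src T) (E.counit_tgt T)

/-- Composition in `mnd` is total, with a junk value on non-composable pairs. The witness `e` is the
composability proof that exposes the genuine composite. -/
theorem counit_comp_incl {h : M.One} (hh : M.tgt h = E.H.obj T) :
    ∃ e, M.mnd.comp (E.adj.counit.app T) (M.incl.map₁ h) = (E.counit T).comp (M.incl.map₁ h) e :=
  have e : (M.incl.map₁ h).tgt = (E.counit T).src := by
    rw [E.counit_src]; exact congrArg idMonad hh
  ⟨e, mnd_comp e⟩

/-- Actions on 1-cells out of `X` are monad morphisms out of the identity monad on `X`, and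
compatible 2-cells are monad transformations. The three conditions are then surjectivity on 1-cells,
and surjectivity and injectivity on 2-cells, of transposition along the 2-adjunction. -/
theorem isEMObject : IsEMObject T (E.H.obj T) (E.u T) (E.counit T).φ where
  toIsAction := E.isAction T
  lift₁ X g γ h := by
    have e := E.adj.counit_comp_transpose (G := h.toMonadMor) (X := X) (Y := T) rfl rfl
    -- The factorization is the transpose of the action, regarded as a monad morphism.
    set k := E.H.map₁ h.toMonadMor ∘₁ E.adj.unit.app X with hk
    have hs : M.src (E.H.map₁ h.toMonadMor) = E.H.obj (idMonad X) := E.H.src_map₁ _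
    have ht : M.tgt (E.H.map₁ h.toMonadMor) = E.H.obj T := E.H.tgt_map₁ _
    have hu : M.tgt (E.adj.unit.app X) = E.H.obj (idMonad X) := E.adj.tgt_unit X
    have hk1 : M.src k = X := by rw [hk, M.src_comp _ _ (hu.trans hs.symm), E.adj.src_unit]
    have hk2 : M.tgt k = E.H.obj T := by rw [hk, M.tgt_comp _ _ (hu.trans hs.symm), ht]
    obtain ⟨e', he'⟩ := E.counit_comp_incl T hk2
    rw [he'] at e
    refine ⟨k, ⟨hk1, hk2⟩, congrArg MonadMor.f e, ?_⟩
    have e2 := congrArg MonadMor.φ e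
    have hA := E.isAction T
    refine Eq.trans ?_ e2
    -- The inclusion gives `k` an identity 2-cell, so the 2-cell of the composite monad morphism is
    -- just the whiskered action.
    change _ = (M.id₂ (E.u T) ∘ₕ M.id₂ k) ∘ᵥ ((E.counit T).φ ∘ₕ M.id₂ k)
    rw [M.id₂_comp _ _ (by rw [hk2, hA.is₁.1]), id₂_vcomp']
    rw [M.cod_hcomp, hA.is₂.2, M.cod_id₂]
    rw [hA.is₂.1]
    simp [hk2, hA.is₁.1, hA.is₁.2]
  lift₂ h k ω hs hh hk hω hc := by
    have hA := E.isAction T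
    obtain ⟨e1, he1⟩ := E.counit_comp_incl T hh
    obtain ⟨e2, he2⟩ := E.counit_comp_incl T hk
    have hφ (h) (hh : M.tgt h = E.H.obj T) (e) : ((E.counit T).comp (M.incl.map₁ h) e).φ =
        (E.counit T).φ ∘ₕ M.id₂ h := by
      change (M.id₂ (E.u T) ∘ₕ M.id₂ h) ∘ᵥ ((E.counit T).φ ∘ₕ M.id₂ h) = _
      rw [M.id₂_comp _ _ (by rw [hh, hA.is₁.1]), id₂_vcomp']
      rw [M.cod_hcomp, hA.is₂.2, M.cod_id₂]
      rw [hA.is₂.1]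
      simp [hh, hA.is₁.1, hA.is₁.2]
    -- The compatibility `hc` is what makes `ω` a monad transformation between the two restrictions
    -- of the counit; its transpose is the required 2-cell.
    let W : MonadTrans M :=
      { dom := (E.counit T).comp (M.incl.map₁ h) e1
        cod := (E.counit T).comp (M.incl.map₁ k) e2
        ω := ω
        src_dom := congrArg idMonad hs
        tgt_dom := rfl
        ω_is := hω
        compat := by
          rw [hφ h hh, hφ k hk]
          change (ω ∘ₕ M.id₂ (M.id₁ _)) ∘ᵥ _ = _ ∘ᵥ (M.id₂ (E.counit T).tgt.t ∘ₕ ω)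
          rw [E.counit_tgt, ← hc, hcomp_id₂']
          rw [hω.2, M.src_comp, hs]
          rw [hk, hA.is₁.1] }
    have e := E.adj.counit_hcomp_transpose (W := W) (X := M.src h) (Y := T) rfl (E.counit_tgt T)
    set α := E.H.map₂ W ∘ₕ M.id₂ (E.adj.unit.app (M.src h)) with hα
    have hdom : M.dom (E.H.map₂ W) = E.H.map₁ W.dom := E.H.dom_map₂ _
    have hcod : M.cod (E.H.map₂ W) = E.H.map₁ W.cod := E.H.cod_map₂ _
    have hsrc : M.src (E.H.map₁ W.dom) = E.H.obj (idMonad (M.src h)) := E.H.src_map₁ _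
    have hut : M.tgt (E.adj.unit.app (M.src h)) = E.H.obj (idMonad (M.src h)) :=
      E.adj.tgt_unit _
    -- The boundary of the transpose is the transpose of the boundary, and `h` is recovered from its
    -- composite with the counit.
    have hα1 : M.dom α = h := by
      rw [hα, M.dom_hcomp, hdom, M.dom_id₂]
      · have := E.adj.transpose_counit_comp (h := h) (X := M.src h) (Y := T) rfl hh
        rwa [he1] at this
      · rw [M.dom_id₂, hdom, hsrc, hut]
    have hα2 : M.cod α = k := by
      rw [hα, M.cod_hcomp, hcod, M.cod_id₂, hs]
      · have := E.adj.transpose_counit_comp (h := k) (X := M.src k) (Y := T) rfl hk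
        rwa [he2] at this
      · rw [M.dom_id₂, hdom, hsrc, hut]
    refine ⟨α, ⟨hα1, hα2⟩, ?_⟩
    refine Eq.trans ?_ (congrArg MonadTrans.ω e)
    have e3 : (M.incl.map₂ α).cod.tgt = (MonadTrans.id (E.counit T)).cod.src := by
      change idMonad (M.tgt (M.cod α)) = (E.counit T).src
      rw [E.counit_src, hα2, hk]
    exact (congrArg MonadTrans.ω (mnd_hcomp e3)).symm
  faithful α β hd hc ht he := by
    -- Monad transformations are determined by their boundary and underlying 2-cell, so `he` gives
    -- equality already in `mnd`; transposing back then recovers `α` and `β`.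
    have key : M.mnd.hcomp (M.mnd.id₂ (E.adj.counit.app T)) (M.incl.map₂ α) =
        M.mnd.hcomp (M.mnd.id₂ (E.adj.counit.app T)) (M.incl.map₂ β) := by
      have e1 : (M.incl.map₂ α).cod.tgt = (MonadTrans.id (E.counit T)).cod.src := by
        change idMonad (M.tgt (M.cod α)) = (E.counit T).src
        rw [E.counit_src, ht]
      have e2 : (M.incl.map₂ β).cod.tgt = (MonadTrans.id (E.counit T)).cod.src := by
        change idMonad (M.tgt (M.cod β)) = (E.counit T).src
        rw [E.counit_src, ← hc, ht]
      refine (mnd_hcomp e1).trans (Eq.trans ?_ (mnd_hcomp e2).symm)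
      have e3 : (M.incl.map₂ α).dom = (M.incl.map₂ β).dom := congrArg M.incl.map₁ hd
      have e4 : (M.incl.map₂ α).cod = (M.incl.map₂ β).cod := congrArg M.incl.map₁ hc
      apply MonadTrans.ext
      · simp only [MonadTrans.hcomp, e3]
      · simp only [MonadTrans.hcomp, e4]
      · exact he
    have h1 := E.adj.transpose_counit_hcomp (α := α) (X := M.src (M.dom α)) (Y := T) rfl
      (by rw [tgt_dom, ht])
    have h2 := E.adj.transpose_counit_hcomp (α := β) (X := M.src (M.dom α)) (Y := T) (by rw [hd])
      (by rw [tgt_dom, ← hc, ht])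
    rw [← h1, ← h2, key]

end EilenbergMoore
end
end TwoCat

/-! ### Opmonoidal monads and the monoidal product of their actions. -/

namespace StrictMonTwoCat
open TwoCat SymStrictMonTwoCat

/-- A monad in the 2-category of pseudomonoids and opmonoidal 1-cells, presented by its underlying
monad, the pseudomonoid `P` and the opmonoidal structure of the 1-cell `t`. -/
structure OpmonMonad (M : StrictMonTwoCat.{u}) extends Monad M.toTwoCat where
  P : Pseudomonoid M
  t₂ : M.Two
  t₀ : M.Two
  A_eq : A = P.A
  t₂_is : M.Is₂ t₂ (t ∘₁ P.m) (P.m ∘₁ (t ⊗₁ t))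
  t₀_is : M.Is₂ t₀ (t ∘₁ P.u) P.u
  coassoc :
    (P.α ∘ₕ M.id₂ (t ⊗₁ t ⊗₁ t)) ∘ᵥ (M.id₂ P.m ∘ₕ (t₂ ⊗₂ M.id₂ t)) ∘ᵥ
        (t₂ ∘ₕ M.id₂ (P.m ⊗₁ M.id₁ P.A)) =
      (M.id₂ P.m ∘ₕ (M.id₂ t ⊗₂ t₂)) ∘ᵥ (t₂ ∘ₕ M.id₂ (M.id₁ P.A ⊗₁ P.m)) ∘ᵥ
        (M.id₂ t ∘ₕ P.α)
  counit_left :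
    (P.lam ∘ₕ M.id₂ t) ∘ᵥ (M.id₂ P.m ∘ₕ (t₀ ⊗₂ M.id₂ t)) ∘ᵥ
        (t₂ ∘ₕ M.id₂ (P.u ⊗₁ M.id₁ P.A)) = M.id₂ t ∘ₕ P.lam
  counit_right :
    (P.rho ∘ₕ M.id₂ t) ∘ᵥ (M.id₂ P.m ∘ₕ (M.id₂ t ⊗₂ t₀)) ∘ᵥ
        (t₂ ∘ₕ M.id₂ (M.id₁ P.A ⊗₁ P.u)) = M.id₂ t ∘ₕ P.rho
  μ₂ : (M.id₂ P.m ∘ₕ (μ ⊗₂ μ)) ∘ᵥ (t₂ ∘ₕ M.id₂ (t ⊗₁ t)) ∘ᵥ (M.id₂ t ∘ₕ t₂) =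
    t₂ ∘ᵥ (μ ∘ₕ M.id₂ P.m)
  η₂ : M.id₂ P.m ∘ₕ (η ⊗₂ η) = t₂ ∘ᵥ (η ∘ₕ M.id₂ P.m)
  μ₀ : t₀ ∘ᵥ (M.id₂ t ∘ₕ t₀) = t₀ ∘ᵥ (μ ∘ₕ M.id₂ P.u)
  η₀ : t₀ ∘ᵥ (η ∘ₕ M.id₂ P.u) = M.id₂ P.u

namespace OpmonMonad
variable {M : StrictMonTwoCat.{u}} (W : OpmonMonad M)

attribute [simp] A_eq
@[simp] theorem dom_t₂ : M.dom W.t₂ = W.t ∘₁ W.P.m := W.t₂_is.1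
@[simp] theorem cod_t₂ : M.cod W.t₂ = W.P.m ∘₁ (W.t ⊗₁ W.t) := W.t₂_is.2
@[simp] theorem dom_t₀ : M.dom W.t₀ = W.t ∘₁ W.P.u := W.t₀_is.1
@[simp] theorem cod_t₀ : M.cod W.t₀ = W.P.u := W.t₀_is.2

/-- The product of actions `γ` on `g` and `γ'` on `g'`: the action `m.γγ' ∘ t₂.gg'` on `m.gg'`. -/
def act (γ γ' : M.Two) : M.Two :=
  (M.id₂ W.P.m ∘ₕ (γ ⊗₂ γ')) ∘ᵥ (W.t₂ ∘ₕ M.id₂ (M.cod γ ⊗₁ M.cod γ'))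

variable {W} {X X' X'' : M.Obj} {g g' g'' k k' : M.One} {γ γ' γ'' κ κ' : M.Two}

/-- `act` reads the underlying 1-cells off the codomains of the actions, so iterated products need
only the 2-cells; here the 1-cells are named again. -/
theorem act_eq (h : IsAction W.toMonad X g γ) (h' : IsAction W.toMonad X' g' γ') :
    W.act γ γ' = (M.id₂ W.P.m ∘ₕ (γ ⊗₂ γ')) ∘ᵥ (W.t₂ ∘ₕ M.id₂ (g ⊗₁ g')) := by
  rw [act, h.is₂.2, h'.is₂.2]

/-- Compatibility of `t₂` with `μ` replaces `μ` on the product by `μ ⊗ μ`, where the laws of `γ` and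
`γ'` apply separately; interchange then moves `γ ⊗ γ'` past `t₂`. The unit law follows in the same
way from compatibility with `η`. -/
theorem isAction_act (h : IsAction W.toMonad X g γ) (h' : IsAction W.toMonad X' g' γ') :
    IsAction W.toMonad (X ⊗₀ X') (W.P.m ∘₁ (g ⊗₁ g')) (W.act γ γ') := by
  have e := act_eq h h'
  obtain ⟨⟨h1, h2⟩, ⟨h3, h4⟩, h5, h6⟩ := h
  obtain ⟨⟨h1', h2'⟩, ⟨h3', h4'⟩, h5', h6'⟩ := h'
  rw [A_eq] at h2 h2'
  rw [e]
  refine ⟨⟨?_, ?_⟩, ⟨?_, ?_⟩, ?_, ?_⟩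
  · simp [h1, h2, h3, h4, h1', h2', h3', h4']
  · simp [h1, h2, h3, h4, h1', h2', h3', h4']
  · simp (maxDischargeDepth := 9) [h1, h2, h3, h4, h1', h2', h3', h4']
  · simp (maxDischargeDepth := 9) [h1, h2, h3, h4, h1', h2', h3', h4']
  · calc _ = (M.id₂ W.P.m ∘ₕ (γ ⊗₂ γ')) ∘ᵥ ((W.t₂ ∘ᵥ (W.μ ∘ₕ M.id₂ W.P.m)) ∘ₕ M.id₂ (g ⊗₁ g')) := by
          simp (maxDischargeDepth := 9) [h1, h2, h3, h4, h1', h2', h3', h4']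
      _ = (M.id₂ W.P.m ∘ₕ ((γ ∘ᵥ (W.μ ∘ₕ M.id₂ g)) ⊗₂ (γ' ∘ᵥ (W.μ ∘ₕ M.id₂ g')))) ∘ᵥ
            (W.t₂ ∘ₕ M.id₂ ((W.t ∘₁ g) ⊗₁ (W.t ∘₁ g'))) ∘ᵥ
            (M.id₂ W.t ∘ₕ W.t₂ ∘ₕ M.id₂ (g ⊗₁ g')) := by
          rw [← W.μ₂, M.tensor_vcomp, M.tensor_hcomp] <;> simp (maxDischargeDepth := 9) [h1, h2, h3, h4, h1', h2', h3', h4']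
      _ = (M.id₂ W.P.m ∘ₕ (γ ⊗₂ γ')) ∘ᵥ ((M.id₂ (W.P.m ∘₁ (W.t ⊗₁ W.t)) ∘ₕ (γ ⊗₂ γ')) ∘ᵥ
            (W.t₂ ∘ₕ M.id₂ ((W.t ∘₁ g) ⊗₁ (W.t ∘₁ g')))) ∘ᵥ
            (M.id₂ W.t ∘ₕ W.t₂ ∘ₕ M.id₂ (g ⊗₁ g')) := by
          rw [h5, h5', M.tensor_vcomp, M.tensor_hcomp] <;> simp (maxDischargeDepth := 9) [h1, h2, h3, h4, h1', h2', h3', h4']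
      _ = _ := by
          -- The inner pair of actions slides past `t₂`, separating the two successive applications
          -- of the product action.
          rw [← exch (β := W.t₂) (α := γ ⊗₂ γ') (a := W.t ∘₁ W.P.m) (b := g ⊗₁ g')] <;>
            simp (maxDischargeDepth := 9) [h1, h2, h3, h4, h1', h2', h3', h4']
  · calc _ = (M.id₂ W.P.m ∘ₕ (γ ⊗₂ γ')) ∘ᵥ ((W.t₂ ∘ᵥ (W.η ∘ₕ M.id₂ W.P.m)) ∘ₕ M.id₂ (g ⊗₁ g')) := by
          simp (maxDischargeDepth := 9) [h1, h2, h3, h4, h1', h2', h3', h4']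
      _ = M.id₂ W.P.m ∘ₕ ((γ ∘ᵥ (W.η ∘ₕ M.id₂ g)) ⊗₂ (γ' ∘ᵥ (W.η ∘ₕ M.id₂ g'))) := by
          rw [← W.η₂, M.tensor_vcomp, M.tensor_hcomp] <;> simp (maxDischargeDepth := 9) [h1, h2, h3, h4, h1', h2', h3', h4']
      _ = _ := by
          rw [h6, h6'] ; simp (maxDischargeDepth := 9) [h1, h2, h3, h4, h1', h2', h3', h4']

/-- The unit of the pseudomonoid carries the action `t₀`: the opmonoidality of `μ` and `η` at the
nullary level is precisely the pair of action laws. -/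
theorem isAction_unit : IsAction W.toMonad M.I W.P.u W.t₀ where
  is₁ := by simp [Is₁]
  is₂ := by simp [Is₂]
  mul := W.μ₀.symm
  unit := W.η₀

/-- Products of actions are compatible with restriction along 1-cells. -/
theorem act_hcomp (h : IsAction W.toMonad X g γ) (h' : IsAction W.toMonad X' g' γ')
    (hk : M.tgt k = X) (hk' : M.tgt k' = X') :
    W.act γ γ' ∘ₕ M.id₂ (k ⊗₁ k') = W.act (γ ∘ₕ M.id₂ k) (γ' ∘ₕ M.id₂ k') := by
  obtain ⟨⟨h1, h2⟩, ⟨h3, h4⟩, h5, h6⟩ := h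
  obtain ⟨⟨h1', h2'⟩, ⟨h3', h4'⟩, h5', h6'⟩ := h'
  rw [A_eq] at h2 h2'
  have e : (γ ∘ₕ M.id₂ k) ⊗₂ (γ' ∘ₕ M.id₂ k') = (γ ⊗₂ γ') ∘ₕ M.id₂ (k ⊗₁ k') := by
    rw [M.tensor_hcomp, M.tensor_id₂] <;> simp [*]
  simp (maxDischargeDepth := 9) [act, e, h1, h2, h3, h4, h1', h2', h3', h4', hk, hk']

/-- Coassociativity of `t` in the form needed for lifting: the associativity 2-cell of the
pseudomonoid, restricted along three 1-cells with actions, respects the two bracketings of the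
product action. -/
theorem act_assoc (h : IsAction W.toMonad X g γ) (h' : IsAction W.toMonad X' g' γ')
    (h'' : IsAction W.toMonad X'' g'' γ'') :
    (W.P.α ∘ₕ M.id₂ (g ⊗₁ g' ⊗₁ g'')) ∘ᵥ W.act (W.act γ γ') γ'' =
      W.act γ (W.act γ' γ'') ∘ᵥ (M.id₂ W.t ∘ₕ W.P.α ∘ₕ M.id₂ (g ⊗₁ g' ⊗₁ g'')) := by
  rw [act_eq (isAction_act h h') h'', act_eq h (isAction_act h' h''), act_eq h h', act_eq h' h'']
  obtain ⟨⟨h1, h2⟩, ⟨h3, h4⟩, -, -⟩ := h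
  obtain ⟨⟨h1', h2'⟩, ⟨h3', h4'⟩, -, -⟩ := h'
  obtain ⟨⟨h1'', h2''⟩, ⟨h3'', h4''⟩, -, -⟩ := h''
  rw [A_eq] at h2 h2' h2''
  -- The third factor is padded with identities, so that the tensor splits into the three actions
  -- followed, in diagrammatic order backwards, by `t₂` alone; `eR` does the same for the other
  -- bracketing.
  have eL : ((M.id₂ W.P.m ∘ₕ (γ ⊗₂ γ')) ∘ᵥ (W.t₂ ∘ₕ M.id₂ (g ⊗₁ g'))) ⊗₂ γ'' =
      (M.id₂ (W.P.m ⊗₁ M.id₁ W.P.A) ∘ₕ (γ ⊗₂ γ' ⊗₂ γ'')) ∘ᵥ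
        ((W.t₂ ⊗₂ M.id₂ W.t) ∘ₕ M.id₂ (g ⊗₁ g' ⊗₁ g'')) := by
    rw [← M.assoc₂, ← M.assoc₁ g, ← M.tensor_id₂ W.P.m, ← M.tensor_id₂ (g ⊗₁ g'),
      ← M.tensor_hcomp, ← M.tensor_hcomp, ← M.tensor_vcomp] <;>
      simp (maxDischargeDepth := 9) [*]
  have eR : γ ⊗₂ ((M.id₂ W.P.m ∘ₕ (γ' ⊗₂ γ'')) ∘ᵥ (W.t₂ ∘ₕ M.id₂ (g' ⊗₁ g''))) =
      (M.id₂ (M.id₁ W.P.A ⊗₁ W.P.m) ∘ₕ (γ ⊗₂ γ' ⊗₂ γ'')) ∘ᵥ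
        ((M.id₂ W.t ⊗₂ W.t₂) ∘ₕ M.id₂ (g ⊗₁ g' ⊗₁ g'')) := by
    rw [← M.tensor_id₂ g (g' ⊗₁ g''), ← M.tensor_id₂ _ W.P.m, ← M.tensor_hcomp,
      ← M.tensor_hcomp, ← M.tensor_vcomp] <;> simp (maxDischargeDepth := 9) [*]
  rw [eL, eR]
  clear eL eR
  calc _ = ((W.P.α ∘ₕ M.id₂ (g ⊗₁ g' ⊗₁ g'')) ∘ᵥ
        (M.id₂ (W.P.m ∘₁ (W.P.m ⊗₁ M.id₁ W.P.A)) ∘ₕ (γ ⊗₂ γ' ⊗₂ γ''))) ∘ᵥ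
        ((M.id₂ W.P.m ∘ₕ (W.t₂ ⊗₂ M.id₂ W.t)) ∘ᵥ (W.t₂ ∘ₕ M.id₂ (W.P.m ⊗₁ M.id₁ W.P.A))) ∘ₕ
          M.id₂ (g ⊗₁ g' ⊗₁ g'') := by simp (maxDischargeDepth := 9) [*]
    _ = (M.id₂ (W.P.m ∘₁ (M.id₁ W.P.A ⊗₁ W.P.m)) ∘ₕ (γ ⊗₂ γ' ⊗₂ γ'')) ∘ᵥ
        (((W.P.α ∘ₕ M.id₂ (W.t ⊗₁ W.t ⊗₁ W.t)) ∘ᵥ (M.id₂ W.P.m ∘ₕ (W.t₂ ⊗₂ M.id₂ W.t)) ∘ᵥ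
          (W.t₂ ∘ₕ M.id₂ (W.P.m ⊗₁ M.id₁ W.P.A))) ∘ₕ M.id₂ (g ⊗₁ g' ⊗₁ g'')) := by
        -- Once `α` has been moved past the three actions, the remaining 2-cells are one side of the
        -- coassociativity axiom of `t`.
        rw [exch (β := W.P.α) (α := γ ⊗₂ γ' ⊗₂ γ'') (a' := W.P.m ∘₁ (M.id₁ W.P.A ⊗₁ W.P.m))
          (b' := (W.t ∘₁ g) ⊗₁ (W.t ∘₁ g') ⊗₁ (W.t ∘₁ g''))] <;>
        simp (maxDischargeDepth := 9) [*]
    _ = _ := by rw [W.coassoc]; simp (maxDischargeDepth := 9) [*]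

/-- The left unit 2-cell slides past `γ`, after which the left counit axiom of `t` applies. Hence
this 2-cell too is compatible with actions and can be lifted. -/
theorem act_lam (h : IsAction W.toMonad X g γ) :
    (W.P.lam ∘ₕ M.id₂ g) ∘ᵥ W.act W.t₀ γ = γ ∘ᵥ (M.id₂ W.t ∘ₕ W.P.lam ∘ₕ M.id₂ g) := by
  rw [act_eq isAction_unit h]
  obtain ⟨⟨h1, h2⟩, ⟨h3, h4⟩, -, -⟩ := h
  rw [A_eq] at h2
  have e : W.t₀ ⊗₂ γ = (M.id₂ (W.P.u ⊗₁ M.id₁ W.P.A) ∘ₕ γ) ∘ᵥ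
      ((W.t₀ ⊗₂ M.id₂ W.t) ∘ₕ M.id₂ g) := by
    have e1 : M.id₂ (W.P.u ⊗₁ M.id₁ W.P.A) ∘ₕ γ = M.id₂ W.P.u ⊗₂ γ := by
      -- The unit 1-cell starts at `I`; inserting the strict unit as an explicit tensor factor lets
      -- the tensor be interchanged with horizontal composition.
      conv_lhs => rw [← M.unit_tensor₂ γ]
      rw [← M.tensor_id₂, ← M.tensor_hcomp] <;> simp [h1, h2, h3, h4]
    have e2 : (W.t₀ ⊗₂ M.id₂ W.t) ∘ₕ M.id₂ g = W.t₀ ⊗₂ M.id₂ (W.t ∘₁ g) := by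
      conv_lhs => rw [← M.unit_tensor₂ (M.id₂ g)]
      rw [← M.tensor_hcomp] <;> simp [h1, h2, h3, h4]
    rw [e1, e2, ← M.tensor_vcomp] <;> simp [h1, h2, h3, h4]
  rw [e]
  calc _ = ((W.P.lam ∘ₕ M.id₂ g) ∘ᵥ (M.id₂ (W.P.m ∘₁ (W.P.u ⊗₁ M.id₁ W.P.A)) ∘ₕ γ)) ∘ᵥ
        ((M.id₂ W.P.m ∘ₕ (W.t₀ ⊗₂ M.id₂ W.t)) ∘ᵥ (W.t₂ ∘ₕ M.id₂ (W.P.u ⊗₁ M.id₁ W.P.A))) ∘ₕ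
          M.id₂ g := by simp (maxDischargeDepth := 9) [h1, h2, h3, h4]
    _ = γ ∘ᵥ (((W.P.lam ∘ₕ M.id₂ W.t) ∘ᵥ (M.id₂ W.P.m ∘ₕ (W.t₀ ⊗₂ M.id₂ W.t)) ∘ᵥ
          (W.t₂ ∘ₕ M.id₂ (W.P.u ⊗₁ M.id₁ W.P.A))) ∘ₕ M.id₂ g) := by
        rw [exch (β := W.P.lam) (α := γ) (a' := M.id₁ W.P.A) (b' := W.t ∘₁ g)] <;>
        simp (maxDischargeDepth := 9) [h1, h2, h3, h4]
    _ = _ := by rw [W.counit_left]; simp (maxDischargeDepth := 9) [h1, h2, h3, h4]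

/-- The mirror image of `act_lam`, from the right counit axiom. -/
theorem act_rho (h : IsAction W.toMonad X g γ) :
    (W.P.rho ∘ₕ M.id₂ g) ∘ᵥ W.act γ W.t₀ = γ ∘ᵥ (M.id₂ W.t ∘ₕ W.P.rho ∘ₕ M.id₂ g) := by
  rw [act_eq h isAction_unit]
  obtain ⟨⟨h1, h2⟩, ⟨h3, h4⟩, -, -⟩ := h
  rw [A_eq] at h2
  have e : γ ⊗₂ W.t₀ = (M.id₂ (M.id₁ W.P.A ⊗₁ W.P.u) ∘ₕ γ) ∘ᵥ
      ((M.id₂ W.t ⊗₂ W.t₀) ∘ₕ M.id₂ g) := by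
    have e1 : M.id₂ (M.id₁ W.P.A ⊗₁ W.P.u) ∘ₕ γ = γ ⊗₂ M.id₂ W.P.u := by
      conv_lhs => rw [← M.tensor_unit₂ γ]
      rw [← M.tensor_id₂, ← M.tensor_hcomp] <;> simp [h1, h2, h3, h4]
    have e2 : (M.id₂ W.t ⊗₂ W.t₀) ∘ₕ M.id₂ g = M.id₂ (W.t ∘₁ g) ⊗₂ W.t₀ := by
      conv_lhs => rw [← M.tensor_unit₂ (M.id₂ g)]
      rw [← M.tensor_hcomp] <;> simp [h1, h2, h3, h4]
    rw [e1, e2, ← M.tensor_vcomp] <;> simp [h1, h2, h3, h4]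
  rw [e]
  calc _ = ((W.P.rho ∘ₕ M.id₂ g) ∘ᵥ (M.id₂ (W.P.m ∘₁ (M.id₁ W.P.A ⊗₁ W.P.u)) ∘ₕ γ)) ∘ᵥ
        ((M.id₂ W.P.m ∘ₕ (M.id₂ W.t ⊗₂ W.t₀)) ∘ᵥ (W.t₂ ∘ₕ M.id₂ (M.id₁ W.P.A ⊗₁ W.P.u))) ∘ₕ
          M.id₂ g := by simp (maxDischargeDepth := 9) [h1, h2, h3, h4]
    _ = γ ∘ᵥ (((W.P.rho ∘ₕ M.id₂ W.t) ∘ᵥ (M.id₂ W.P.m ∘ₕ (M.id₂ W.t ⊗₂ W.t₀)) ∘ᵥ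
          (W.t₂ ∘ₕ M.id₂ (M.id₁ W.P.A ⊗₁ W.P.u))) ∘ₕ M.id₂ g) := by
        rw [exch (β := W.P.rho) (α := γ) (a' := M.id₁ W.P.A) (b' := W.t ∘₁ g)] <;>
        simp (maxDischargeDepth := 9) [h1, h2, h3, h4]
    _ = _ := by rw [W.counit_right]; simp (maxDischargeDepth := 9) [h1, h2, h3, h4]

end OpmonMonad
end StrictMonTwoCat

/-! ### Lifting invertible 2-cells to an Eilenberg–Moore object. -/

namespace TwoCat.IsEMObject
open StrictMonTwoCat
variable {M : TwoCat.{u}} {T : Monad M} {B : M.Obj} {u : M.One} {ρ : M.Two}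

/-- Compatible invertible 2-cells lift to invertible 2-cells. -/
theorem lift_inv (E : IsEMObject T B u ρ) {h k : M.One} {ω : M.Two} (hs : M.src h = M.src k)
    (hh : M.tgt h = B) (hk : M.tgt k = B) (hω : M.Is₂ ω (u ∘₁ h) (u ∘₁ k)) (hi : IsInv M ω)
    (hc : ω ∘ᵥ (ρ ∘ₕ M.id₂ h) = (ρ ∘ₕ M.id₂ k) ∘ᵥ (M.id₂ T.t ∘ₕ ω)) :
    ∃ α, M.Is₂ α h k ∧ IsInv M α ∧ M.id₂ u ∘ₕ α = ω := by
  obtain ⟨α, ⟨hα1, hα2⟩, hα⟩ := E.lift₂ h k ω hs hh hk hω hc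
  obtain ⟨ω', ⟨h1, h2⟩, h3, h4⟩ := hi
  obtain ⟨h5, h6⟩ := hω
  have hu := E.is₁
  obtain ⟨hu1, hu2⟩ := hu
  have hρ := E.is₂
  obtain ⟨hρ1, hρ2⟩ := hρ
  rw [h6] at h1
  rw [h5] at h2
  -- The inverse of a compatible 2-cell is compatible: compose the equation for `ω` with `ω'` on
  -- both sides. So `ω'` lifts as well.
  obtain ⟨β, ⟨hβ1, hβ2⟩, hβ⟩ := E.lift₂ k h ω' hs.symm hk hh ⟨h1, h2⟩ (by
    calc _ = ω' ∘ᵥ ((ρ ∘ₕ M.id₂ k) ∘ᵥ (M.id₂ T.t ∘ₕ (ω ∘ᵥ ω'))) := by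
          rw [h4]; simp (maxDischargeDepth := 9) [hu1, hu2, hρ1, hρ2, hh, hk, hs, h6]
      _ = ω' ∘ᵥ ((ρ ∘ₕ M.id₂ k) ∘ᵥ (M.id₂ T.t ∘ₕ ω)) ∘ᵥ (M.id₂ T.t ∘ₕ ω') := by
          simp (maxDischargeDepth := 9) [hu1, hu2, hρ1, hρ2, hh, hk, hs, h5, h6, h1, h2]
      _ = (ω' ∘ᵥ ω) ∘ᵥ (ρ ∘ₕ M.id₂ h) ∘ᵥ (M.id₂ T.t ∘ₕ ω') := by
          rw [← hc]
          simp (maxDischargeDepth := 9) [hu1, hu2, hρ1, hρ2, hh, hk, hs, h5, h6, h1, h2]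
      _ = _ := by
          rw [h3]; simp (maxDischargeDepth := 9) [hu1, hu2, hρ1, hρ2, hh, hk, hs, h5, h2])
  -- The two lifts are mutually inverse because they become so after whiskering with `u`, which is
  -- faithful.
  refine ⟨α, ⟨hα1, hα2⟩, ⟨β, ⟨by rw [hβ1, hα2], by rw [hβ2, hα1]⟩, ?_, ?_⟩, hα⟩
  · apply E.faithful
    · simp [hα1, hα2, hβ1, hβ2]
    · simp [hα1, hα2, hβ1, hβ2]
    · simp [hα1, hα2, hβ1, hβ2, hh]
    · rw [wl, hα, hβ, h3, M.id₂_comp] <;> simp [hα1, hα2, hβ1, hβ2, hh, hu1, h5]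
  · apply E.faithful
    · simp [hα1, hα2, hβ1, hβ2]
    · simp [hα1, hα2, hβ1, hβ2]
    · simp [hα1, hα2, hβ1, hβ2, hk]
    · rw [wl, hα, hβ, h4, M.id₂_comp] <;> simp [hα1, hα2, hβ1, hβ2, hk, hu1, h6]

end TwoCat.IsEMObject

/-! ### Lifting the pseudomonoid structure along the action. -/

namespace StrictMonTwoCat
open TwoCat SymStrictMonTwoCat

namespace OpmonMonad
variable {M : StrictMonTwoCat.{u}} {W : OpmonMonad M} {B : M.Obj} {u : M.One} {ρ : M.Two}

/-- The pseudomonoid `Q` on `B` is a lifting of the pseudomonoid of `W` along the action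
`(u, ρ)`. -/
structure IsLifting (W : OpmonMonad M) (B : M.Obj) (u : M.One) (ρ : M.Two)
    (Q : Pseudomonoid M) : Prop where
  A_eq : Q.A = B
  m_eq : u ∘₁ Q.m = W.P.m ∘₁ (u ⊗₁ u)
  m_act : ρ ∘ₕ M.id₂ Q.m = W.act ρ ρ
  u_eq : u ∘₁ Q.u = W.P.u
  u_act : ρ ∘ₕ M.id₂ Q.u = W.t₀
  α_eq : M.id₂ u ∘ₕ Q.α = W.P.α ∘ₕ M.id₂ (u ⊗₁ u ⊗₁ u)
  lam_eq : M.id₂ u ∘ₕ Q.lam = W.P.lam ∘ₕ M.id₂ u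
  rho_eq : M.id₂ u ∘ₕ Q.rho = W.P.rho ∘ₕ M.id₂ u

/-- The product of `ρ` with itself and the action `t₀` factor through `u`, giving the multiplication
and the unit. The coherence 2-cells are compatible with the actions and so lift to invertible ones;
the pentagon and triangle hold because `u` reflects equality of 2-cells. -/
theorem exists_isLifting (E : IsEMObject W.toMonad B u ρ) : ∃ Q, IsLifting W B u ρ Q := by
  have hA := E.toIsAction
  obtain ⟨n, ⟨hn1, hn2⟩, hn3, hn4⟩ := E.lift₁ _ _ _ (isAction_act hA hA)
  obtain ⟨e, ⟨he1, he2⟩, he3, he4⟩ := E.lift₁ _ _ _ isAction_unit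
  obtain ⟨hu1, hu2⟩ := hA.is₁
  obtain ⟨hρ1, hρ2⟩ := hA.is₂
  rw [A_eq] at hu2
  have hid : ρ ∘ₕ M.id₂ (M.id₁ B) = ρ := hcomp_id₂' (by rw [hρ2, hu1])
  have hn5 (x) (hx : M.tgt x = B ⊗₀ B) : u ∘₁ n ∘₁ x = W.P.m ∘₁ (u ⊗₁ u) ∘₁ x := by
    rw [← M.comp_assoc, hn3, M.comp_assoc] <;> simp [hx, hn1, hn2, hu1, hu2]
  -- Restricting `ρ` along the lifted multiplication amounts to forming products of actions. This
  -- turns the compatibility conditions for the three coherence 2-cells into `act_assoc`, `act_lam`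
  -- and `act_rho`.
  have actn (x y) (hx : M.tgt x = B) (hy : M.tgt y = B) :
      ρ ∘ₕ M.id₂ (n ∘₁ (x ⊗₁ y)) = W.act (ρ ∘ₕ M.id₂ x) (ρ ∘ₕ M.id₂ y) := by
    rw [← act_hcomp hA hA hx hy, ← hn4, M.hcomp_assoc, M.id₂_comp] <;> simp [*]
  -- The composites of `u` with the two triple multiplications on `B` are those of the pseudomonoid
  -- restricted along `u ⊗ u ⊗ u`, so the restricted associativity 2-cell has the right boundary.
  obtain ⟨α, ⟨hα1, hα2⟩, hα3, hα4⟩ := E.lift_inv (h := n ∘₁ (n ⊗₁ M.id₁ B))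
    (k := n ∘₁ (M.id₁ B ⊗₁ n)) (ω := W.P.α ∘ₕ M.id₂ (u ⊗₁ u ⊗₁ u)) (by simp [hn1, hn2])
    (by simp [hn1, hn2]) (by simp [hn1, hn2])
    ⟨by simp [hn5, hn1, hn2, hn3, hu1, hu2], by simp [hn5, hn1, hn2, hn3, hu1, hu2]⟩
    (by
      obtain ⟨β, ⟨h1, h2⟩, h3, h4⟩ := W.P.α_inv
      refine ⟨β ∘ₕ M.id₂ (u ⊗₁ u ⊗₁ u), ⟨by simp [h1, hu2], by simp [h2, hu2]⟩, ?_, ?_⟩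
      · rw [← wr, h3] <;> simp [h1, h2, hu2]
      · rw [← wr, h4] <;> simp [h1, h2, hu2])
    (by
      rw [actn n (M.id₁ B) hn2 (by simp), actn (M.id₁ B) n (by simp) hn2, hid, hn4]
      exact act_assoc hA hA hA)
  obtain ⟨lam, ⟨hl1, hl2⟩, hl3, hl4⟩ := E.lift_inv (h := n ∘₁ (e ⊗₁ M.id₁ B))
    (k := M.id₁ B) (ω := W.P.lam ∘ₕ M.id₂ u) (by simp [hn1, he1, he2])
    (by simp [hn1, hn2, he2]) (by simp)
    ⟨by simp [hn5, he1, he2, he3, hu1, hu2], by simp [hu1, hu2]⟩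
    (by
      obtain ⟨β, ⟨h1, h2⟩, h3, h4⟩ := W.P.lam_inv
      refine ⟨β ∘ₕ M.id₂ u, ⟨by simp [h1, hu2], by simp [h2, hu2]⟩, ?_, ?_⟩
      · rw [← wr, h3] <;> simp [h1, h2, hu2]
      · rw [← wr, h4] <;> simp [h1, h2, hu2])
    (by
      rw [actn e (M.id₁ B) he2 (by simp), hid, he4]
      exact act_lam hA)
  obtain ⟨rho, ⟨hr1, hr2⟩, hr3, hr4⟩ := E.lift_inv (h := n ∘₁ (M.id₁ B ⊗₁ e))
    (k := M.id₁ B) (ω := W.P.rho ∘ₕ M.id₂ u) (by simp [hn1, he1, he2])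
    (by simp [hn1, hn2, he2]) (by simp)
    ⟨by simp [hn5, he1, he2, he3, hu1, hu2], by simp [hu1, hu2]⟩
    (by
      obtain ⟨β, ⟨h1, h2⟩, h3, h4⟩ := W.P.rho_inv
      refine ⟨β ∘ₕ M.id₂ u, ⟨by simp [h1, hu2], by simp [h2, hu2]⟩, ?_, ?_⟩
      · rw [← wr, h3] <;> simp [h1, h2, hu2]
      · rw [← wr, h4] <;> simp [h1, h2, hu2])
    (by
      rw [actn (M.id₁ B) e (by simp) he2, hid, he4]
      exact act_rho hA)
  -- Together with `hnt`, this transports any pasting of lifted coherence 2-cells along `u` to the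
  -- corresponding pasting of the original ones.
  have hα5 (x) (hx : M.tgt x = B ⊗₀ B ⊗₀ B) :
      M.id₂ u ∘ₕ α ∘ₕ M.id₂ x = W.P.α ∘ₕ M.id₂ ((u ⊗₁ u ⊗₁ u) ∘₁ x) := by
    rw [← M.hcomp_assoc, hα4, M.hcomp_assoc, M.id₂_comp] <;> simp [hx, hα1, hn1, hn2, hu1, hu2]
  have hnt (β γ) (hβ : M.tgt (M.cod β) = B) (hγ : M.tgt (M.cod γ) = B) :
      M.id₂ u ∘ₕ M.id₂ n ∘ₕ (β ⊗₂ γ) =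
        M.id₂ W.P.m ∘ₕ ((M.id₂ u ∘ₕ β) ⊗₂ (M.id₂ u ∘ₕ γ)) := by
    rw [M.tensor_hcomp] <;> simp [hβ, hγ, hn1, hn2, hn3, hu1, hu2]
  refine ⟨⟨B, n, e, α, lam, rho, ⟨hn1, hn2⟩, ⟨he1, he2⟩, ⟨hα1, hα2⟩, ⟨hl1, hl2⟩, ⟨hr1, hr2⟩, hα3,
    hl3, hr3, ?_, ?_⟩, rfl, hn3, hn4, he3, he4, hα4, hl4, hr4⟩
  · apply E.faithful
    · simp (maxDischargeDepth := 9) [hα1, hα2, hn1, hn2]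
    · simp (maxDischargeDepth := 9) [hα1, hα2, hn1, hn2]
    · simp (maxDischargeDepth := 9) [hα1, hα2, hn1, hn2]
    · have hp := congrArg (M.hcomp · (M.id₂ (u ⊗₁ u ⊗₁ u ⊗₁ u))) W.P.pentagon
      have e1 : (M.id₂ (M.id₁ W.P.A) ⊗₂ W.P.α) ∘ₕ M.id₂ (u ⊗₁ u ⊗₁ u ⊗₁ u) =
          M.id₂ u ⊗₂ (W.P.α ∘ₕ M.id₂ (u ⊗₁ u ⊗₁ u)) := by
        rw [← M.tensor_id₂ u, ← M.tensor_hcomp] <;> simp [hu2]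
      have e2 : (W.P.α ⊗₂ M.id₂ (M.id₁ W.P.A)) ∘ₕ M.id₂ (u ⊗₁ u ⊗₁ u ⊗₁ u) =
          (W.P.α ∘ₕ M.id₂ (u ⊗₁ u ⊗₁ u)) ⊗₂ M.id₂ u := by
        rw [← M.assoc₁ u u, ← M.assoc₁ (u ⊗₁ u), ← M.tensor_id₂ _ u, ← M.tensor_hcomp] <;>
          simp [hu2]
      rw [wl, wl, wl, hα5, hα5, hα5, hnt, hnt, hα4, M.id₂_comp, comp_id₁' hu1]
      · simpa (maxDischargeDepth := 9) [e1, e2, hα1, hα2, hn1, hn2, hn3, hu1, hu2] using hp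
      all_goals simp (maxDischargeDepth := 9) [hα1, hα2, hn1, hn2, hu1]
  · apply E.faithful
    · simp (maxDischargeDepth := 9) [hα1, hα2, hn1, hn2, hl1, hl2, hr1, hr2, he1, he2]
    · simp (maxDischargeDepth := 9) [hα1, hα2, hn1, hn2, hl1, hl2, hr1, hr2, he1, he2]
    · simp (maxDischargeDepth := 9) [hα1, hα2, hn1, hn2, hl1, hl2, hr1, hr2, he1, he2]
    · have hp := congrArg (M.hcomp · (M.id₂ (u ⊗₁ u))) W.P.triangle
      have e1 : (M.id₂ (M.id₁ W.P.A) ⊗₂ W.P.lam) ∘ₕ M.id₂ (u ⊗₁ u) =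
          M.id₂ u ⊗₂ (W.P.lam ∘ₕ M.id₂ u) := by
        rw [← M.tensor_id₂ u, ← M.tensor_hcomp] <;> simp [hu2]
      have e2 : (W.P.rho ⊗₂ M.id₂ (M.id₁ W.P.A)) ∘ₕ M.id₂ (u ⊗₁ u) =
          (W.P.rho ∘ₕ M.id₂ u) ⊗₂ M.id₂ u := by
        rw [← M.tensor_id₂ u, ← M.tensor_hcomp] <;> simp [hu2]
      rw [wl, hα5, hnt, hnt, hl4, hr4, M.id₂_comp, comp_id₁' hu1]
      · have e3 : (u ⊗₁ u ⊗₁ u) ∘₁ (M.id₁ B ⊗₁ e ⊗₁ M.id₁ B) = u ⊗₁ W.P.u ⊗₁ u := by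
          simp [he1, he2, he3, hu1]
        have e4 : (M.id₁ W.P.A ⊗₁ W.P.u ⊗₁ M.id₁ W.P.A) ∘₁ (u ⊗₁ u) = u ⊗₁ W.P.u ⊗₁ u := by
          simp [hu2]
        rw [e3, ← e4]
        simpa (maxDischargeDepth := 9) [e1, e2, hu1, hu2] using hp
      all_goals simp (maxDischargeDepth := 9) [hα1, hα2, hn1, hn2, hu1, hl1, hl2, hr1, hr2, he1, he2]

end OpmonMonad
end StrictMonTwoCat

/-! ### The universal property of the lifted pseudomonoid with respect to opmonoidal cells. -/

namespace StrictMonTwoCat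
open TwoCat SymStrictMonTwoCat

namespace OpmonMonad.IsLifting
variable {M : StrictMonTwoCat.{u}} {W : OpmonMonad M} {B : M.Obj} {u : M.One} {ρ : M.Two}
  {Q : Pseudomonoid M}

/-- The strict opmonoidal 1-cell along which the pseudomonoid is lifted. -/
def incl (L : IsLifting W B u ρ Q) (hu : M.Is₁ u B W.P.A) : OpmonOne M where
  src := Q
  tgt := W.P
  f := u
  φ₂ := M.id₂ (u ∘₁ Q.m)
  φ₀ := M.id₂ (u ∘₁ Q.u)
  f_is := by rw [L.A_eq]; exact hu
  φ₂_is := by simp [Is₂, L.m_eq]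
  φ₀_is := by simp [Is₂, L.u_eq]
  coassoc := by
    have h1 : M.src u = Q.A := by rw [L.A_eq]; exact hu.1
    have h2 := hu.2
    have e1 : W.P.m ∘₁ ((u ∘₁ Q.m) ⊗₁ u) = u ∘₁ Q.m ∘₁ (Q.m ⊗₁ M.id₁ Q.A) := by
      rw [← M.comp_assoc u Q.m, L.m_eq] <;> simp [h1, h2, L.m_eq]
    have e2 : W.P.m ∘₁ (u ⊗₁ (u ∘₁ Q.m)) = u ∘₁ Q.m ∘₁ (M.id₁ Q.A ⊗₁ Q.m) := by
      rw [← M.comp_assoc u Q.m, L.m_eq] <;> simp [h1, h2, L.m_eq]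
    -- With identity structure 2-cells, each side of coassociativity reduces to one whiskered
    -- associativity 2-cell, and the two agree because `Q.α` is a lifting.
    rw [M.tensor_id₂, M.tensor_id₂, M.id₂_comp, M.id₂_comp, M.id₂_comp, M.id₂_comp, ← L.α_eq, e1, e2,
      M.comp_assoc, M.comp_assoc, vcomp_id₂', vcomp_id₂', id₂_vcomp', id₂_vcomp']
    all_goals simp (maxDischargeDepth := 9) [h1, h2]
  counit_left := by
    have h1 : M.src u = Q.A := by rw [L.A_eq]; exact hu.1
    have h2 := hu.2
    have e1 : W.P.m ∘₁ ((u ∘₁ Q.u) ⊗₁ u) = u ∘₁ Q.m ∘₁ (Q.u ⊗₁ M.id₁ Q.A) := by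
      rw [← M.comp_assoc u Q.m, L.m_eq] <;> simp [h1, h2, L.m_eq]
    have e3 : W.P.m ∘₁ (W.P.u ⊗₁ u) =
        u ∘₁ Q.m ∘₁ (Q.u ⊗₁ M.id₁ Q.A) := by
      rw [← e1, L.u_eq]
    rw [M.tensor_id₂, M.id₂_comp, M.id₂_comp, e1, M.comp_assoc, id₂_vcomp', vcomp_id₂', L.lam_eq]
    all_goals simp [h1, h2, e3]
  counit_right := by
    have h1 : M.src u = Q.A := by rw [L.A_eq]; exact hu.1
    have h2 := hu.2
    have e1 : W.P.m ∘₁ (u ⊗₁ (u ∘₁ Q.u)) = u ∘₁ Q.m ∘₁ (M.id₁ Q.A ⊗₁ Q.u) := by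
      rw [← M.comp_assoc u Q.m, L.m_eq] <;> simp [h1, h2, L.m_eq]
    have e3 : W.P.m ∘₁ (u ⊗₁ W.P.u) =
        u ∘₁ Q.m ∘₁ (M.id₁ Q.A ⊗₁ Q.u) := by
      rw [← e1, L.u_eq]
    rw [M.tensor_id₂, M.id₂_comp, M.id₂_comp, e1, M.comp_assoc, id₂_vcomp', vcomp_id₂', L.rho_eq]
    all_goals simp [h1, h2, e3]

/-- Since `u` strictly preserves multiplication, it can be pushed inside a tensor product of
2-cells. This is how the axioms on `Q` are compared with those on `W.P`. -/
theorem mul_hcomp (L : IsLifting W B u ρ Q) (hu : M.Is₁ u B W.P.A) {β γ : M.Two}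
    (hβ : M.tgt (M.cod β) = B) (hγ : M.tgt (M.cod γ) = B) :
    M.id₂ u ∘ₕ M.id₂ Q.m ∘ₕ (β ⊗₂ γ) =
      M.id₂ W.P.m ∘ₕ ((M.id₂ u ∘ₕ β) ⊗₂ (M.id₂ u ∘ₕ γ)) := by
  have h1 := L.A_eq
  obtain ⟨h2, h3⟩ := hu
  rw [M.tensor_hcomp] <;> simp [hβ, hγ, h1, h2, h3, L.m_eq]

/-- The hypotheses `h₂` and `h₀` express that `γ` is an opmonoidal 2-cell from `t.G` to `G`. Read
the other way, they express that `G.φ₂` and `G.φ₀` are compatible with the actions on their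
boundaries, so both lift; the opmonoidal axioms are then checked after whiskering with `u`. -/
theorem lift_one (L : IsLifting W B u ρ Q) (E : IsEMObject W.toMonad B u ρ) {G : OpmonOne M}
    (hG : G.tgt = W.P) {γ : M.Two} (hγ : IsAction W.toMonad G.src.A G.f γ)
    (h₂ : (M.id₂ W.P.m ∘ₕ (γ ⊗₂ γ)) ∘ᵥ (W.t₂ ∘ₕ M.id₂ (G.f ⊗₁ G.f)) ∘ᵥ (M.id₂ W.t ∘ₕ G.φ₂) =
      G.φ₂ ∘ᵥ (γ ∘ₕ M.id₂ G.src.m))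
    (h₀ : W.t₀ ∘ᵥ (M.id₂ W.t ∘ₕ G.φ₀) = G.φ₀ ∘ᵥ (γ ∘ₕ M.id₂ G.src.u)) :
    ∃ H : OpmonOne M, H.src = G.src ∧ H.tgt = Q ∧ u ∘₁ H.f = G.f ∧ M.id₂ u ∘ₕ H.φ₂ = G.φ₂ ∧
      M.id₂ u ∘ₕ H.φ₀ = G.φ₀ ∧ ρ ∘ₕ M.id₂ H.f = γ := by
  obtain ⟨h, ⟨hh1, hh2⟩, hh3, hh4⟩ := E.lift₁ _ _ _ hγ
  have hB := L.A_eq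
  have hA := E.toIsAction
  have hu : M.Is₁ u B W.P.A := W.A_eq ▸ hA.is₁
  obtain ⟨hu1, hu2⟩ := id hu
  obtain ⟨hρ1, hρ2⟩ := hA.is₂
  obtain ⟨hγ1, hγ2⟩ := hγ.is₂
  have hGt : M.tgt G.f = W.P.A := by rw [G.tgt_f, hG]
  have hG2 : M.cod G.φ₂ = W.P.m ∘₁ (G.f ⊗₁ G.f) := by rw [G.cod_φ₂, hG]
  have hG0 : M.cod G.φ₀ = W.P.u := by rw [G.cod_φ₀, hG]
  have hm (x) (hx : M.tgt x = B ⊗₀ B) : u ∘₁ Q.m ∘₁ x = W.P.m ∘₁ (u ⊗₁ u) ∘₁ x := by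
    rw [← M.comp_assoc, L.m_eq, M.comp_assoc] <;> simp [hx, hB, hu1, hu2]
  have hh5 (x) (hx : M.tgt x = G.src.A) : u ∘₁ h ∘₁ x = G.f ∘₁ x := by
    rw [← M.comp_assoc, hh3] <;> simp [hx, hh1, hh2, hu1]
  obtain ⟨φ₂, ⟨hφ1, hφ2⟩, hφ3⟩ := E.lift₂ (h ∘₁ G.src.m) (Q.m ∘₁ (h ⊗₁ h)) G.φ₂
    (by simp [hh1, hh2, hB]) (by simp [hh1, hh2, hB]) (by simp [hh1, hh2, hB])
    ⟨by simp [hh5], by simp [hm, hh2, hu1, hh3, hG2]⟩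
    (by
      -- The restricted action on the codomain of `φ₂` is the product of `γ` with itself, and on the
      -- domain it is `γ` restricted along the multiplication. Compatibility is therefore `h₂`.
      have e1 : ρ ∘ₕ M.id₂ (Q.m ∘₁ (h ⊗₁ h)) = W.act γ γ := by
        rw [← hh4, ← act_hcomp hA hA hh2 hh2, ← L.m_act, M.hcomp_assoc, M.id₂_comp] <;>
          simp [hu1, hh2, hB, hu2, hρ1]
      have e2 : ρ ∘ₕ M.id₂ (h ∘₁ G.src.m) = γ ∘ₕ M.id₂ G.src.m := by
        rw [← hh4, M.hcomp_assoc, M.id₂_comp] <;> simp [hh1, hh2, hu1, hu2, hρ1]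
      rw [e1, e2, ← h₂, act, hγ2, M.vcomp_assoc] <;>
        simp (maxDischargeDepth := 9) [hγ1, hγ2, hGt, hG2])
  obtain ⟨φ₀, ⟨hφ4, hφ5⟩, hφ6⟩ := E.lift₂ (h ∘₁ G.src.u) Q.u G.φ₀
    (by simp [hh1]) (by simp [hh1, hh2]) (by simp [hB])
    ⟨by simp [hh5], by simp [hG0, L.u_eq]⟩
    (by
      have e2 : ρ ∘ₕ M.id₂ (h ∘₁ G.src.u) = γ ∘ₕ M.id₂ G.src.u := by
        rw [← hh4, M.hcomp_assoc, M.id₂_comp] <;> simp [hh1, hh2, hu1, hu2, hρ1]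
      rw [L.u_act, e2, ← h₀])
  -- `k1`, `k2` and `k3` replace the lifted cells by those of `G` once `u` is in front; each
  -- opmonoidal axiom below thereby becomes the corresponding axiom of `G`.
  have k1 (x) (hx : M.tgt x = G.src.A ⊗₀ G.src.A) :
      M.id₂ u ∘ₕ φ₂ ∘ₕ M.id₂ x = G.φ₂ ∘ₕ M.id₂ x := by
    rw [← M.hcomp_assoc, hφ3] <;> simp [hx, hh1, hh2, hφ1, hu1]
  have k2 : M.id₂ u ∘ₕ M.id₂ h = M.id₂ G.f := by rw [M.id₂_comp, hh3]; simp [hh2, hu1]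
  have k3 (x) (hx : M.tgt (M.cod x) = G.src.A) :
      M.id₂ u ∘ₕ M.id₂ h ∘ₕ x = M.id₂ G.f ∘ₕ x := by
    rw [← M.hcomp_assoc, k2] <;> simp [hh1, hh2, hu1, hx]
  refine ⟨⟨G.src, Q, h, φ₂, φ₀, ⟨hh1, hB ▸ hh2⟩, ⟨hφ1, hφ2⟩, ⟨hφ4, hφ5⟩, ?_, ?_, ?_⟩, rfl, rfl,
    hh3, hφ3, hφ6, hh4⟩
  · apply E.faithful
    · simp (maxDischargeDepth := 9) [hφ1, hφ2, hh1, hh2, hB]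
    · simp (maxDischargeDepth := 9) [hφ1, hφ2, hh1, hh2, hB]
    · simp (maxDischargeDepth := 9) [hφ1, hφ2, hh1, hh2, hB]
    · have e1 : M.id₂ u ∘ₕ Q.α ∘ₕ M.id₂ (h ⊗₁ h ⊗₁ h) =
          W.P.α ∘ₕ M.id₂ (G.f ⊗₁ G.f ⊗₁ G.f) := by
        rw [← M.hcomp_assoc, L.α_eq, M.hcomp_assoc, M.id₂_comp] <;>
          simp [hh1, hh2, hh3, hB, hu1, hu2]
      have hc := G.coassoc
      simp only [hG] at hc
      rw [wl, wl, wl, wl, e1, L.mul_hcomp hu, L.mul_hcomp hu, k1, k1, k2, k3, hφ3, hc]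
      all_goals simp (maxDischargeDepth := 9) [hφ1, hφ2, hh1, hh2, hB, hu1]
  · apply E.faithful
    · simp (maxDischargeDepth := 9) [hφ1, hφ2, hφ4, hφ5, hh1, hh2, hB]
    · simp (maxDischargeDepth := 9) [hφ1, hφ2, hφ4, hφ5, hh1, hh2, hB]
    · simp (maxDischargeDepth := 9) [hφ1, hφ2, hφ4, hφ5, hh1, hh2, hB]
    · have e1 : M.id₂ u ∘ₕ Q.lam ∘ₕ M.id₂ h = W.P.lam ∘ₕ M.id₂ G.f := by
        rw [← M.hcomp_assoc, L.lam_eq, M.hcomp_assoc, M.id₂_comp] <;>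
          simp [hh1, hh2, hh3, hB, hu1, hu2]
      have hc := G.counit_left
      simp only [hG] at hc
      rw [wl, wl, e1, L.mul_hcomp hu, k1, k2, k3, hφ6, hc]
      all_goals simp (maxDischargeDepth := 9) [hφ1, hφ2, hφ4, hφ5, hh1, hh2, hB, hu1]
  · apply E.faithful
    · simp (maxDischargeDepth := 9) [hφ1, hφ2, hφ4, hφ5, hh1, hh2, hB]
    · simp (maxDischargeDepth := 9) [hφ1, hφ2, hφ4, hφ5, hh1, hh2, hB]
    · simp (maxDischargeDepth := 9) [hφ1, hφ2, hφ4, hφ5, hh1, hh2, hB]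
    · have e1 : M.id₂ u ∘ₕ Q.rho ∘ₕ M.id₂ h = W.P.rho ∘ₕ M.id₂ G.f := by
        rw [← M.hcomp_assoc, L.rho_eq, M.hcomp_assoc, M.id₂_comp] <;>
          simp [hh1, hh2, hh3, hB, hu1, hu2]
      have hc := G.counit_right
      simp only [hG] at hc
      rw [wl, wl, e1, L.mul_hcomp hu, k1, k2, k3, hφ6, hc]
      all_goals simp (maxDischargeDepth := 9) [hφ1, hφ2, hφ4, hφ5, hh1, hh2, hB, hu1]

/-- The 2-dimensional counterpart: the underlying 2-cell is lifted by the universal property, and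
its opmonoidality, being an equation of 2-cells into `B`, follows from `h₂` and `h₀` by faithfulness
of `u`. -/
theorem lift_two (L : IsLifting W B u ρ Q) (E : IsEMObject W.toMonad B u ρ) {H K : OpmonOne M}
    (hs : H.src = K.src) (hH : H.tgt = Q) (hK : K.tgt = Q) {ω : M.Two}
    (hω : M.Is₂ ω (u ∘₁ H.f) (u ∘₁ K.f))
    (hc : ω ∘ᵥ (ρ ∘ₕ M.id₂ H.f) = (ρ ∘ₕ M.id₂ K.f) ∘ᵥ (M.id₂ W.t ∘ₕ ω))
    (h₂ : (M.id₂ W.P.m ∘ₕ (ω ⊗₂ ω)) ∘ᵥ (M.id₂ u ∘ₕ H.φ₂) =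
      (M.id₂ u ∘ₕ K.φ₂) ∘ᵥ (ω ∘ₕ M.id₂ H.src.m))
    (h₀ : M.id₂ u ∘ₕ H.φ₀ = (M.id₂ u ∘ₕ K.φ₀) ∘ᵥ (ω ∘ₕ M.id₂ H.src.u)) :
    ∃ V : OpmonTwo M, V.dom = H ∧ V.cod = K ∧ M.id₂ u ∘ₕ V.ω = ω := by
  have hB := L.A_eq
  have hA := E.toIsAction
  have hu : M.Is₁ u B W.P.A := W.A_eq ▸ hA.is₁
  obtain ⟨hu1, hu2⟩ := hu
  have hH' : M.tgt H.f = B := by rw [H.tgt_f, hH, hB]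
  have hK' : M.tgt K.f = B := by rw [K.tgt_f, hK, hB]
  obtain ⟨α, ⟨hα1, hα2⟩, hα3⟩ := E.lift₂ H.f K.f ω (by simp [hs]) hH' hK' hω hc
  have hs2 : M.src K.f = H.src.A := by rw [K.src_f, hs]
  have k1 (x) (hx : M.tgt x = H.src.A) : M.id₂ u ∘ₕ α ∘ₕ M.id₂ x = ω ∘ₕ M.id₂ x := by
    rw [← M.hcomp_assoc, hα3] <;> simp [hα1, hx, hu1, hH']
  have d2 : M.cod H.φ₂ = Q.m ∘₁ (H.f ⊗₁ H.f) := by rw [H.cod_φ₂, hH]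
  have d0 : M.cod H.φ₀ = Q.u := by rw [H.cod_φ₀, hH]
  have d2' : M.cod K.φ₂ = Q.m ∘₁ (K.f ⊗₁ K.f) := by rw [K.cod_φ₂, hK]
  have d0' : M.cod K.φ₀ = Q.u := by rw [K.cod_φ₀, hK]
  have d3 : M.dom K.φ₂ = K.f ∘₁ H.src.m := by rw [K.dom_φ₂, hs]
  have d4 : M.dom K.φ₀ = K.f ∘₁ H.src.u := by rw [K.dom_φ₀, hs]
  refine ⟨⟨H, K, α, hs, hH.trans hK.symm, ⟨hα1, hα2⟩, ?_, ?_⟩, rfl, rfl, hα3⟩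
  · rw [hH]
    apply E.faithful
    · simp (maxDischargeDepth := 9) [hα1, hα2, hH', hK', hB, d2, d2', d3, hs2]
    · simp (maxDischargeDepth := 9) [hα1, hα2, hH', hK', hB, d2, d2', d3, hs2]
    · simp (maxDischargeDepth := 9) [hα1, hα2, hH', hK', hB, d2, d2', d3, hs2]
    · rw [wl, wl, L.mul_hcomp ⟨hu1, hu2⟩, hα3, k1, h₂]
      all_goals simp (maxDischargeDepth := 9) [hα1, hα2, hH', hK', hB, d2, d2', d3, hs2, hu1]
  · apply E.faithful
    · simp (maxDischargeDepth := 9) [hα1, hα2, hH', hK', hB, d0, d0', d4, hs2]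
    · simp (maxDischargeDepth := 9) [hα1, hα2, hH', hK', hB, d0, d0', d4, hs2]
    · simp (maxDischargeDepth := 9) [hα1, hα2, hH', hK', hB, d0, d0', d4, hs2]
    · rw [wl, k1, h₀]
      all_goals simp (maxDischargeDepth := 9) [hα1, hα2, hH', hK', hB, d0, d0', d4, hs2, hu1]

end OpmonMonad.IsLifting

/-! ### Monads in the 2-category of pseudomonoids, viewed as opmonoidal monads. -/

/-- The identity opmonoidal 1-cell has identity structure 2-cells, so one factor of the
compatibility condition disappears. What is left is the form of the axiom for the unit of an
opmonoidal monad. -/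
theorem OpmonTwo.compat₂_id {M : StrictMonTwoCat.{u}} {V : OpmonTwo M} {P : Pseudomonoid M}
    {t : OpmonOne M} (h : V.dom = OpmonOne.id P) (h' : V.cod = t) :
    M.id₂ P.m ∘ₕ (V.ω ⊗₂ V.ω) = t.φ₂ ∘ᵥ (V.ω ∘ₕ M.id₂ P.m) := by
  subst h'
  have e := V.compat₂
  have e1 : M.tgt V.cod.f = P.A := by rw [V.cod.tgt_f, ← V.tgt_dom, h]; rfl
  have e2 : M.src V.cod.f = P.A := by rw [V.cod.src_f, ← V.src_dom, h]; rfl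
  simp only [h, OpmonOne.id] at e
  rwa [vcomp_id₂'] at e
  simp [h, OpmonOne.id, e1]

theorem OpmonTwo.compat₀_id {M : StrictMonTwoCat.{u}} {V : OpmonTwo M} {P : Pseudomonoid M}
    {t : OpmonOne M} (h : V.dom = OpmonOne.id P) (h' : V.cod = t) :
    M.id₂ P.u = t.φ₀ ∘ᵥ (V.ω ∘ₕ M.id₂ P.u) := by
  subst h'
  have e := V.compat₀
  simp only [h, OpmonOne.id] at e
  exact e

/-- A monad in the 2-category of pseudomonoids, presented in terms of its underlying monad. -/
noncomputable def OpmonMonad.ofMonad {M : StrictMonTwoCat.{u}} (T : Monad (opmTwoCat M)) : OpmonMonad M :=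
  have hs : OpmonOne.src T.t = T.A := T.t_is.1
  have ht : OpmonOne.tgt T.t = T.A := T.t_is.2
  have hst : OpmonOne.tgt T.t = OpmonOne.src T.t := ht.trans hs.symm
  have hμd : OpmonTwo.dom T.μ = OpmonOne.comp T.t T.t hst := T.μ_is.1.trans (opm_comp hst)
  have hμc : OpmonTwo.cod T.μ = T.t := T.μ_is.2
  have hηd : OpmonTwo.dom T.η = OpmonOne.id T.A := T.η_is.1
  have hηc : OpmonTwo.cod T.η = T.t := T.η_is.2
  { (forgetOpm M).mapMonad T with
    P := T.A
    t₂ := OpmonOne.φ₂ T.t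
    t₀ := OpmonOne.φ₀ T.t
    A_eq := rfl
    t₂_is := by
      have := OpmonOne.φ₂_is T.t
      simp only [hs, ht] at this
      exact this
    t₀_is := by
      have := OpmonOne.φ₀_is T.t
      simp only [hs, ht] at this
      exact this
    coassoc := by
      have := OpmonOne.coassoc T.t
      simp only [hs, ht] at this
      exact this
    counit_left := by
      have := OpmonOne.counit_left T.t
      simp only [hs, ht] at this
      exact this
    counit_right := by
      have := OpmonOne.counit_right T.t
      simp only [hs, ht] at this
      exact this
    μ₂ := by
      have := OpmonTwo.compat₂ T.μ
      simp only [hμd, hμc, OpmonOne.comp, hs, ht] at this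
      exact this
    η₂ := OpmonTwo.compat₂_id hηd hηc
    μ₀ := by
      have := OpmonTwo.compat₀ T.μ
      simp only [hμd, hμc, OpmonOne.comp, hs, ht] at this
      exact this
    η₀ := (OpmonTwo.compat₀_id hηd hηc).symm }

end StrictMonTwoCat

/-! ### From Eilenberg–Moore objects of underlying monads to those of monads on pseudomonoids. -/

theorem TwoCat.IsAction.map {M N : TwoCat.{u}} (F : TwoFunctor M N) {T : Monad M} {X : M.Obj}
    {g : M.One} {γ : M.Two} (h : IsAction T X g γ) :
    IsAction (F.mapMonad T) (F.obj X) (F.map₁ g) (F.map₂ γ) := by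
  obtain ⟨⟨h1, h2⟩, ⟨h3, h4⟩, h5, h6⟩ := h
  refine ⟨⟨?_, ?_⟩, ⟨?_, ?_⟩, ?_, ?_⟩
  · rw [F.src_map₁, h1]
  · rw [F.tgt_map₁, h2]; rfl
  · rw [F.dom_map₂, h3, F.map_comp _ _ (by simp [h2])]; rfl
  · rw [F.cod_map₂, h4]
  · simpa (maxDischargeDepth := 9) [TwoFunctor.mapMonad, h1, h2, h3, h4] using
      congrArg F.map₂ h5
  · simpa (maxDischargeDepth := 9) [TwoFunctor.mapMonad, h1, h2, h3, h4] using
      congrArg F.map₂ h6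

namespace StrictMonTwoCat
open TwoCat SymStrictMonTwoCat
variable {M : StrictMonTwoCat.{u}}

/-- Opmonoidality of a 2-cell is a property, so the forgetful 2-functor is faithful on 2-cells with
given boundary. Equations of opmonoidal 2-cells can thus be verified in `M`. -/
theorem opm_two_ext {V W : (opmTwoCat M).Two} (h : (opmTwoCat M).dom V = (opmTwoCat M).dom W)
    (h' : (opmTwoCat M).cod V = (opmTwoCat M).cod W)
    (h'' : (forgetOpm M).map₂ V = (forgetOpm M).map₂ W) : V = W := OpmonTwo.ext h h' h''

/-- The compatibility of an opmonoidal 2-cell with the binary structure, for composite 1-cells as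
domain. -/
theorem OpmonTwo.compat₂_comp {V : OpmonTwo M} {G F : OpmonOne M} {h : F.tgt = G.src}
    (hd : V.dom = G.comp F h) :
    (M.id₂ G.tgt.m ∘ₕ (V.ω ⊗₂ V.ω)) ∘ᵥ (G.φ₂ ∘ₕ M.id₂ (F.f ⊗₁ F.f)) ∘ᵥ (M.id₂ G.f ∘ₕ F.φ₂) =
      V.cod.φ₂ ∘ᵥ (V.ω ∘ₕ M.id₂ F.src.m) := by
  have := V.compat₂
  rwa [hd] at this

theorem OpmonTwo.compat₀_comp {V : OpmonTwo M} {G F : OpmonOne M} {h : F.tgt = G.src}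
    (hd : V.dom = G.comp F h) :
    G.φ₀ ∘ᵥ (M.id₂ G.f ∘ₕ F.φ₀) = V.cod.φ₀ ∘ᵥ (V.ω ∘ₕ M.id₂ F.src.u) := by
  have := V.compat₀
  rwa [hd] at this

/-- Strictness of the outer 1-cell makes its contribution to the composite structure an identity,
leaving only whiskering; hence lifting along `U` can be expressed by whiskering with `U.f`. -/
theorem OpmonOne.IsStrict.comp_φ₂ {G F : OpmonOne M} (hG : G.IsStrict) (h : F.tgt = G.src) :
    (G.comp F h).φ₂ = M.id₂ G.f ∘ₕ F.φ₂ := by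
  change (G.φ₂ ∘ₕ M.id₂ (F.f ⊗₁ F.f)) ∘ᵥ (M.id₂ G.f ∘ₕ F.φ₂) = _
  rw [hG.1, M.id₂_comp, id₂_vcomp'] <;> simp [h]

theorem OpmonOne.IsStrict.comp_φ₀ {G F : OpmonOne M} (hG : G.IsStrict) (h : F.tgt = G.src) :
    (G.comp F h).φ₀ = M.id₂ G.f ∘ₕ F.φ₀ := by
  change G.φ₀ ∘ᵥ (M.id₂ G.f ∘ₕ F.φ₀) = _
  rw [hG.2, id₂_vcomp']; simp [h]

theorem OpmonOne.IsStrict.comp_eq {U G H : OpmonOne M} (hU : U.IsStrict) (h : H.tgt = U.src)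
    (hs : H.src = G.src) (ht : U.tgt = G.tgt) (hf : U.f ∘₁ H.f = G.f)
    (h₂ : M.id₂ U.f ∘ₕ H.φ₂ = G.φ₂) (h₀ : M.id₂ U.f ∘ₕ H.φ₀ = G.φ₀) : U.comp H h = G :=
  OpmonOne.ext hs ht hf ((hU.comp_φ₂ h).trans h₂) ((hU.comp_φ₀ h).trans h₀)

theorem OpmonOne.IsStrict.compat₂ {U H K : OpmonOne M} (hU : U.IsStrict) {V : OpmonTwo M}
    {h : H.tgt = U.src} {h' : K.tgt = U.src} (hd : V.dom = U.comp H h)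
    (hc : V.cod = U.comp K h') :
    (M.id₂ U.tgt.m ∘ₕ (V.ω ⊗₂ V.ω)) ∘ᵥ (M.id₂ U.f ∘ₕ H.φ₂) =
      (M.id₂ U.f ∘ₕ K.φ₂) ∘ᵥ (V.ω ∘ₕ M.id₂ H.src.m) := by
  have := V.compat₂
  rwa [hd, hc, hU.comp_φ₂, hU.comp_φ₂] at this

theorem OpmonOne.IsStrict.compat₀ {U H K : OpmonOne M} (hU : U.IsStrict) {V : OpmonTwo M}
    {h : H.tgt = U.src} {h' : K.tgt = U.src} (hd : V.dom = U.comp H h)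
    (hc : V.cod = U.comp K h') :
    M.id₂ U.f ∘ₕ H.φ₀ = (M.id₂ U.f ∘ₕ K.φ₀) ∘ᵥ (V.ω ∘ₕ M.id₂ H.src.u) := by
  have := V.compat₀
  rwa [hd, hc, hU.comp_φ₀, hU.comp_φ₀] at this

/-- The action along which a pseudomonoid is lifted is an opmonoidal 2-cell. -/
theorem OpmonMonad.IsLifting.exists_action {W : OpmonMonad M} {B : M.Obj} {u : M.One} {ρ : M.Two}
    {Q : Pseudomonoid M} (L : IsLifting W B u ρ Q) (hu : M.Is₁ u B W.P.A)
    (hρ : M.Is₂ ρ (W.t ∘₁ u) u) {t : OpmonOne M} (hs : t.src = W.P) (ht : t.tgt = W.P)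
    (hf : t.f = W.t) (h₂ : t.φ₂ = W.t₂) (h₀ : t.φ₀ = W.t₀) :
    ∃ R : OpmonTwo M, R.dom = t.comp (L.incl hu) hs.symm ∧ R.cod = L.incl hu ∧ R.ω = ρ := by
  have hB := L.A_eq
  obtain ⟨hρ1, hρ2⟩ := hρ
  obtain ⟨hu1, hu2⟩ := id hu
  refine ⟨⟨t.comp (L.incl hu) hs.symm, L.incl hu, ρ, rfl, ht, ⟨?_, hρ2⟩, ?_, ?_⟩, rfl, rfl, rfl⟩
  · simp only [OpmonOne.comp, incl, hf, hρ1]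
  · have h1 := L.m_act
    rw [OpmonMonad.act, hρ2] at h1
    simp only [OpmonOne.comp, incl, ht, h₂, hf]
    rw [M.id₂_comp, vcomp_id₂', id₂_vcomp', h1]
    · simp [hρ2, hu1, hB]
    · simp [hu2, L.m_eq]
    · simp [hu1, hu2, hB]
  · have h1 := L.u_act
    simp only [OpmonOne.comp, incl, h₀, hf]
    rw [M.id₂_comp, vcomp_id₂', id₂_vcomp', h1]
    · simp [hρ2, hu1, hB]
    · simp [L.u_eq]
    · simp [hu1, hu2, hB]

/-- The inductive step. The lifted pseudomonoid, its strict 1-cell and the opmonoidal action form a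
triple lying exactly over the given one; its universal property combines `lift_one`, `lift_two` and
the faithfulness of the given `u`. -/
theorem exists_isEMObject_opm {T : Monad (opmTwoCat M)} {B : M.Obj} {u : M.One} {ρ : M.Two}
    (E : IsEMObject ((forgetOpm M).mapMonad T) B u ρ) :
    ∃ Q U R, IsEMObject T Q U R ∧ (forgetOpm M).obj Q = B ∧ (forgetOpm M).map₁ U = u ∧
      (forgetOpm M).map₂ R = ρ ∧ OpmonOne.IsStrict U := by
  -- The underlying monad of `ofMonad T` is by definition the image of `T` under the forgetful
  -- 2-functor.
  have E' : IsEMObject (OpmonMonad.ofMonad T).toMonad B u ρ := E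
  obtain ⟨(Q : (opmTwoCat M).Obj), L⟩ := OpmonMonad.exists_isLifting E'
  have hu : M.Is₁ u B (OpmonMonad.ofMonad T).P.A := E.is₁
  have hB := L.A_eq
  -- Packing the 1-cell with its equations keeps it opaque, as a 1-cell of `opmTwoCat M`, so that
  -- the general 2-category rewriting rules apply to it.
  obtain ⟨U, hU1, hU2, hU3, hU4⟩ : ∃ U : (opmTwoCat M).One, (opmTwoCat M).src U = Q ∧
      (opmTwoCat M).tgt U = T.A ∧ (forgetOpm M).map₁ U = u ∧ U = L.incl hu :=
    ⟨L.incl hu, rfl, rfl, rfl, rfl⟩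
  have hUs : OpmonOne.IsStrict U := by rw [hU4]; exact ⟨rfl, rfl⟩
  obtain ⟨R, hR1, hR2, hR3⟩ : ∃ R : (opmTwoCat M).Two, (opmTwoCat M).dom R = T.t ∘₁ U ∧
      (opmTwoCat M).cod R = U ∧ (forgetOpm M).map₂ R = ρ := by
    obtain ⟨R, h1, h2, h3⟩ := L.exists_action hu E.is₂ (t := T.t) T.t_is.1 T.t_is.2 rfl rfl rfl
    refine ⟨R, h1.trans ?_, h2.trans hU4.symm, h3⟩
    rw [hU4]
    exact (opm_comp _).symm
  refine ⟨Q, U, R, ⟨⟨⟨hU1, hU2⟩, ⟨hR1, hR2⟩, ?_, ?_⟩, ?_, ?_, ?_⟩, hB, hU3, hR3, hUs⟩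
  · apply opm_two_ext
    · simp (maxDischargeDepth := 9) [hU1, hU2, hR1, hR2]
    · simp (maxDischargeDepth := 9) [hU1, hU2, hR1, hR2]
    · have := E.mul
      simpa (maxDischargeDepth := 9) [hU1, hU2, hR1, hR2, hU3, hR3, TwoFunctor.mapMonad] using this
  · apply opm_two_ext
    · simp (maxDischargeDepth := 9) [hU1, hU2, hR1, hR2]
    · simp (maxDischargeDepth := 9) [hU1, hU2, hR1, hR2]
    · have := E.unit
      simpa (maxDischargeDepth := 9) [hU1, hU2, hR1, hR2, hU3, hR3, TwoFunctor.mapMonad] using this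
  · intro X G Γ hΓ
    have hG : OpmonOne.src G = X := hΓ.is₁.1
    have hG' : OpmonOne.tgt G = T.A := hΓ.is₁.2
    have hGt : OpmonOne.tgt G = OpmonOne.src T.t := hG'.trans T.t_is.1.symm
    have hd : OpmonTwo.dom Γ = OpmonOne.comp T.t G hGt := hΓ.is₂.1.trans (opm_comp hGt)
    have hc : OpmonTwo.cod Γ = G := hΓ.is₂.2
    have ht2 : OpmonOne.tgt T.t = T.A := T.t_is.2
    -- The opmonoidality of `Γ`, written out for the composite domain `t.G`, supplies the two extra
    -- hypotheses of `lift_one`.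
    have e2 := OpmonTwo.compat₂_comp hd
    have e0 := OpmonTwo.compat₀_comp hd
    rw [hc, ht2] at e2
    rw [hc] at e0
    have hΓ' := hΓ.map (forgetOpm M)
    rw [← hG] at hΓ'
    obtain ⟨(H : (opmTwoCat M).One), h1, h2, h3, h4, h5, h6⟩ := L.lift_one E' (G := G) hG' hΓ' e2 e0
    have hHU : OpmonOne.tgt H = OpmonOne.src U := h2.trans hU1.symm
    -- The factorization is an equality of opmonoidal 1-cells: as `U` is strict, the structure of
    -- `U.H` is that of `H` whiskered with `u`, which is the structure of `G`.
    have e : (opmTwoCat M).comp U H = G := (opm_comp hHU).trans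
      (hUs.comp_eq hHU h1 (hU2.trans hG'.symm) (by rw [← h3, ← hU3]; rfl)
        (by rw [← h4, ← hU3]; rfl) (by rw [← h5, ← hU3]; rfl))
    have hH1 : (opmTwoCat M).src H = X := h1.trans hG
    have hH2 : (opmTwoCat M).tgt H = Q := h2
    refine ⟨H, ⟨hH1, hH2⟩, e, ?_⟩
    apply opm_two_ext
    · rw [hΓ.is₂.1, ← e]; simp (maxDischargeDepth := 9) [hU1, hU2, hR1, hR2, hH1, hH2]
    · rw [hΓ.is₂.2, ← e]; simp (maxDischargeDepth := 9) [hU1, hU2, hR1, hR2, hH1, hH2]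
    · rw [(forgetOpm M).map_hcomp, (forgetOpm M).map_id₂, hR3]
      · exact h6
      · simp (maxDischargeDepth := 9) [hU1, hU2, hR1, hR2, hH1, hH2]
  · intro H K ω hs hH hK hω hc
    have hHU : OpmonOne.tgt H = OpmonOne.src U := hH.trans hU1.symm
    have hKU : OpmonOne.tgt K = OpmonOne.src U := hK.trans hU1.symm
    obtain ⟨hω1, hω2⟩ := hω
    have hd : OpmonTwo.dom ω = OpmonOne.comp U H hHU := hω1.trans (opm_comp hHU)
    have hd' : OpmonTwo.cod ω = OpmonOne.comp U K hKU := hω2.trans (opm_comp hKU)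
    have hUf : OpmonOne.f U = u := hU3
    have e2 := hUs.compat₂ hd hd'
    have e0 := hUs.compat₀ hd hd'
    rw [hUf] at e2 e0
    have e3 : M.Is₂ (OpmonTwo.ω ω) (u ∘₁ OpmonOne.f H) (u ∘₁ OpmonOne.f K) := by
      rw [← hUf]
      refine ⟨(OpmonTwo.dom_ω ω).trans ?_, (OpmonTwo.cod_ω ω).trans ?_⟩
      · rw [hd]; rfl
      · rw [hd']; rfl
    -- Forgetting the opmonoidal structure turns compatibility with `R` into compatibility with `ρ`,
    -- as required for lifting in `M`.
    have e4 := congrArg (forgetOpm M).map₂ hc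
    rw [(forgetOpm M).map_vcomp, (forgetOpm M).map_vcomp, (forgetOpm M).map_hcomp,
      (forgetOpm M).map_hcomp, (forgetOpm M).map_hcomp, (forgetOpm M).map_id₂,
      (forgetOpm M).map_id₂, (forgetOpm M).map_id₂, hR3] at e4
    · have e5 : OpmonOne.tgt U = T.A := hU2
      obtain ⟨(V : (opmTwoCat M).Two), h1, h2, h3⟩ := L.lift_two E' (H := H) (K := K) hs hH hK e3 e4
        (by rw [e5] at e2; exact e2) e0
      have h1' : (opmTwoCat M).dom V = H := h1
      have h2' : (opmTwoCat M).cod V = K := h2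
      refine ⟨V, ⟨h1, h2⟩, ?_⟩
      apply opm_two_ext
      · rw [hω1]; simp [h1', hU1, hH]
      · rw [hω2]; simp [h2', hU1, hH, h1']
      · rw [(forgetOpm M).map_hcomp, (forgetOpm M).map_id₂, hU3]
        · exact h3
        · simp [h2', hU1, hK]
    all_goals simp (maxDischargeDepth := 9) [hU1, hU2, hR1, hR2, hω1, hω2, hH, hK, hs]
  · intro V W hd hc ht he
    apply opm_two_ext hd hc
    have e := congrArg (forgetOpm M).map₂ he
    rw [(forgetOpm M).map_hcomp, (forgetOpm M).map_hcomp, (forgetOpm M).map_id₂, hU3] at e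
    · refine E.faithful _ _ ?_ ?_ ?_ e
      · simp [hd]
      · simp [hc]
      · simp [ht]; exact hB
    · simp [← hc, ht, hU1]
    · simp [ht, hU1]

end StrictMonTwoCat

/-! ### Induction on `q` and the conclusion. -/

namespace SymStrictMonTwoCat
open TwoCat StrictMonTwoCat

/-- Eilenberg-Moore objects of `(0,q)`-oidal monads exist over those of the underlying monads. -/
theorem exists_isEMObject_opmPow (M : SymStrictMonTwoCat.{u}) (E : M.toTwoCat.EilenbergMoore)
    (q : ℕ) (T : Monad (M.opmPow q).toTwoCat) :
    ∃ Q U R, IsEMObject T Q U R ∧ (M.base q).obj Q = E.H.obj ((M.base q).mapMonad T) ∧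
      (M.base q).map₁ U = E.u ((M.base q).mapMonad T) ∧
      (M.base q).map₂ R = (E.counit ((M.base q).mapMonad T)).φ ∧ M.IsStrict q U := by
  induction q with
  -- For `q = 0` the forgetful 2-functor is the identity and strictness is vacuous, so the counit
  -- component itself serves.
  | zero => exact ⟨_, _, _, E.isEMObject T, rfl, rfl, rfl, trivial⟩
  | succ q ih =>
    -- The hypothesis is applied to the monad with its outermost opmonoidal structure forgotten. The
    -- next level lies over the resulting triple by equalities, so the identifications with the
    -- counit data and the strictness at the lower levels persist.
    obtain ⟨Q, U, R, h, h1, h2, h3, h4⟩ := ih ((M.opmPow q).forgetOpm.mapMonad T)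
    obtain ⟨Q', U', R', h', rfl, rfl, rfl, h5⟩ := exists_isEMObject_opm h
    exact ⟨Q', U', R', h', h1, h2, h3, h4, h5⟩

end SymStrictMonTwoCat

theorem mainTheorem6 (M : SymStrictMonTwoCat.{u}) (E : M.toTwoCat.EilenbergMoore)
    (hE : E.IsMonoidal (M := M.toStrictMonTwoCat)) (q : ℕ) (T : TwoCat.Monad (M.opmPow q).toTwoCat) :
    ∃ (B : (M.opmPow q).Obj) (U : TwoCat.MonadMor (M.opmPow q).toTwoCat),
      U.src = TwoCat.idMonad B ∧ U.tgt = T ∧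
      (M.base q).obj B = E.H.obj ((M.base q).mapMonad T) ∧
      (M.base q).mapMonadMor U = E.counit ((M.base q).mapMonad T) ∧
      M.IsStrict q U.f := by
  obtain ⟨B, U, R, h, h1, h2, h3, h4⟩ := M.exists_isEMObject_opmPow E q T
  -- The required monad morphism is the action of the Eilenberg–Moore object at level `q`, regarded
  -- as a morphism out of an identity monad.
  refine ⟨B, h.toIsAction.toMonadMor, rfl, rfl, h1, ?_, h4⟩
  apply TwoCat.MonadMor.ext
  -- A 2-functor sends the identity monad on `B` to the identity monad on its image, which is the
  -- source of the counit component.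
  · rw [E.counit_src, ← h1]
    apply TwoCat.Monad.ext <;>
      simp [TwoCat.TwoFunctor.mapMonadMor, TwoCat.TwoFunctor.mapMonad, TwoCat.idMonad,
        TwoCat.IsAction.toMonadMor]
  · rw [E.counit_tgt]; rfl
  · exact h2
  · exact h3
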